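/- Let $\theta_{12},\theta_{34}$ be nonzero real numbers, and on $L^2(\mathbb{R}^2)$, in the variables $(x_1,x_3)$, let $\hat x_1=x_1$, $\hat x_2=-i\theta_{12}\,\partial/\partial x_1$, $\hat x_3=x_3$, $\hat x_4=-i\theta_{34}\,\partial/\partial x_3$, so that for $k\in\mathbb{R}^4$ $$[e^{ik\cdot\hat x}\psi](x_1,x_3)=e^{i(k_1k_2\theta_{12}+k_3k_4\theta_{34})/2}\,e^{i(k_1x_1+k_3x_3)}\,\psi(x_1+\theta_{12}k_2,\;x_3+\theta_{34}k_4).$$ For a function $f:\mathbb{R}^4\to\mathbb{C}$ let $$\hat{\mathcal W}[f]=\int_{\mathbb{R}^4} f(x)\,\hat\Delta(x)\,d^4x,\qquad \hat\Delta(x)=\frac1{(2\pi)^4}\int_{\mathbb{R}^4}e^{ik\cdot\hat x}\,e^{-ik\cdot x}\,d^4k,$$ be its Weyl quantization, the integrals being understood weakly: $\hat{\mathcal W}[f]$ is the bounded operator $T$ on $L^2(\mathbb{R}^2)$ such that, for all Schwartz functions $\varphi,\psi$ on $\mathbb{R}^2$, $\langle\varphi,T\psi\rangle=\int f(x)\,\langle\varphi,\hat\Delta(x)\psi\rangle\,d^4x$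 with an absolutely convergent integral, where $\langle\varphi,\hat\Delta(x)\psi\rangle=(2\pi)^{-4}\int\langle\varphi,e^{ik\cdot\hat x}\psi\rangle e^{-ik\cdot x}\,d^4k$. Consider the following classes of complex-valued functions on $\mathbb{R}^4$: * the Schwartz space $\mathcal S(\mathbb{R}^4)$; * for real $m<0$ and $0<\rho\le1$, the class $\Gamma^m_\rho(\mathbb{R}^4)$ of all $f\in C^\infty(\mathbb{R}^4)$ such that for every multi-index $\alpha\in\mathbb{N}_0^4$ there is a constant $C_\alpha$ with $|\partial_\alpha f(x)|\le C_\alpha(1+|x|^2)^{(m-\rho|\alpha|)/2}$ for all $x$; * the class $\mathcal K^\infty(\mathbb{R}^4)$ of all $f\in C^\infty(\mathbb{R}^4)$ with $\lim_{|x|\to\infty}|\partial_\alpha f(x)|=0$ for every multi-index $\alpha\in\mathbb{N}_0^4$. Then for each of these classes $\mathcal F$ (for every admissible $m,\rho$ in the second case), the operator $\hat{\mathcal W}[f]$ exists and is unique for every $f\in\mathcal F$, and $\hat{\mathcal W}[\mathcal F]=\{\hat{\mathcal W}[f] : f\in\mathcal F\}$ is a (not necessarily unital) complex subalgebra of the algebra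 $\mathcal K$ of compact operators on $L^2(\mathbb{R}^2)$ that is dense in $\mathcal K$ in the operator norm. -/

import Mathlib

open MeasureTheory Filter Topology
open scoped ContDiff SchwartzMap InnerProductSpace

noncomputable section

namespace WeylQuantization

/-- The space `ℝ⁴` of symbols' arguments; `x 0, x 1, x 2, x 3` are `x₁, x₂, x₃, x₄`. -/
abbrev R4 := EuclideanSpace ℝ (Fin 4)

/-- The configuration space `ℝ²`; for `u : R2`, `u 0` is `x₁` and `u 1` is `x₃`. -/
abbrev R2 := EuclideanSpace ℝ (Fin 2)

/-- The Hilbert space `L²(ℝ²)`. -/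
abbrev L2 := Lp ℂ 2 (volume : Measure R2)

/-! ### The coordinate operators and their exponentials -/

/-- The coordinate operators: `x̂₁`, `x̂₃` are multiplication by `x₁`, `x₃`, and
`x̂₂ = -i θ₁₂ ∂/∂x₁`, `x̂₄ = -i θ₃₄ ∂/∂x₃`. -/
def xHat (θ₁₂ θ₃₄ : ℝ) (j : Fin 4) (ψ : R2 → ℂ) (u : R2) : ℂ :=
  match j with
  | 0 => (u 0 : ℂ) * ψ u
  | 1 => -Complex.I * θ₁₂ * fderiv ℝ ψ u (EuclideanSpace.single 0 1)
  | 2 => (u 1 : ℂ) * ψ u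
  | 3 => -Complex.I * θ₃₄ * fderiv ℝ ψ u (EuclideanSpace.single 1 1)

/-- The unitary operator `exp (i ∑ⱼ kⱼ x̂ⱼ)`, in its explicit form
`ψ(x₁, x₃) ↦ exp(i(k₁k₂θ₁₂ + k₃k₄θ₃₄)/2) exp(i(k₁x₁ + k₃x₃)) ψ(x₁ + θ₁₂k₂, x₃ + θ₃₄k₄)`.
That this is the exponential is `expXHat_zero` and `hasDerivAt_expXHat` below. -/
def expXHat (θ₁₂ θ₃₄ : ℝ) (k : R4) (ψ : R2 → ℂ) (u : R2) : ℂ :=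
  Complex.exp (Complex.I * ((k 0 * k 1 * θ₁₂ + k 2 * k 3 * θ₃₄) / 2 : ℝ)) *
    Complex.exp (Complex.I * (k 0 * u 0 + k 2 * u 1 : ℝ)) *
      ψ (u + !₂[θ₁₂ * k 1, θ₃₄ * k 3])

theorem expXHat_zero (θ₁₂ θ₃₄ : ℝ) (ψ : R2 → ℂ) : expXHat θ₁₂ θ₃₄ 0 ψ = ψ := by
  funext u
  have h : (!₂[(0 : ℝ), 0] : R2) = 0 := by
    ext i; fin_cases i <;> rfl
  simp [expXHat, h]

/-- `d/dt exp(i t k·x̂) ψ = i (k·x̂) exp(i t k·x̂) ψ`. -/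
theorem hasDerivAt_expXHat (θ₁₂ θ₃₄ : ℝ) (k : R4) (ψ : R2 → ℂ) (hψ : Differentiable ℝ ψ)
    (u : R2) (t : ℝ) :
    HasDerivAt (fun s : ℝ => expXHat θ₁₂ θ₃₄ (s • k) ψ u)
      (Complex.I * ∑ j, (k j : ℂ) * xHat θ₁₂ θ₃₄ j (expXHat θ₁₂ θ₃₄ (t • k) ψ) u) t := by
  set w : R2 := !₂[θ₁₂ * k 1, θ₃₄ * k 3] with hw
  have hshift : ∀ s : ℝ, (!₂[θ₁₂ * (s * k 1), θ₃₄ * (s * k 3)] : R2) = s • w := by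
    intro s; ext i; fin_cases i <;> simp [hw] <;> ring
  have hwb : w = (θ₁₂ * k 1) • EuclideanSpace.single 0 1 +
      (θ₃₄ * k 3) • EuclideanSpace.single 1 1 := by
    ext i; fin_cases i <;> simp [hw]
  set c : ℝ → ℂ := fun s => Complex.exp (Complex.I *
    (((s * k 0) * (s * k 1) * θ₁₂ + (s * k 2) * (s * k 3) * θ₃₄) / 2 : ℝ)) with hc
  set e : ℝ → R2 → ℂ := fun s v => Complex.exp (Complex.I *
    ((s * k 0) * v 0 + (s * k 2) * v 1 : ℝ)) with he
  have hE : ∀ s : ℝ, expXHat θ₁₂ θ₃₄ (s • k) ψ = fun v => c s * e s v * ψ (v + s • w) := by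
    intro s; funext v
    simp [expXHat, hc, he, hshift]
  have hfd : ∀ d : R2, fderiv ℝ (expXHat θ₁₂ θ₃₄ (t • k) ψ) u d =
      Complex.I * ((t * k 0) * d 0 + (t * k 2) * d 1 : ℝ) * (c t * e t u * ψ (u + t • w)) +
        c t * e t u * fderiv ℝ ψ (u + t • w) d := by
    intro d
    have hlin : HasFDerivAt (fun v : R2 => (t * k 0) * v 0 + (t * k 2) * v 1)
        ((t * k 0) • (EuclideanSpace.proj (𝕜 := ℝ) : Fin 2 → R2 →L[ℝ] ℝ) 0 +
          (t * k 2) • (EuclideanSpace.proj (𝕜 := ℝ) : Fin 2 → R2 →L[ℝ] ℝ) 1) u :=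
      ContinuousLinearMap.hasFDerivAt
        ((t * k 0) • (EuclideanSpace.proj (𝕜 := ℝ) : Fin 2 → R2 →L[ℝ] ℝ) 0 +
          (t * k 2) • (EuclideanSpace.proj (𝕜 := ℝ) : Fin 2 → R2 →L[ℝ] ℝ) 1)
    have h1 := ((Complex.ofRealCLM.hasFDerivAt.comp u hlin).const_mul Complex.I).cexp
    have h2 : HasFDerivAt (fun v : R2 => ψ (v + t • w)) (fderiv ℝ ψ (u + t • w)) u := by
      have h0 : HasFDerivAt (fun v : R2 => v + t • w) (ContinuousLinearMap.id ℝ R2) u :=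
        (hasFDerivAt_id u).add_const (t • w)
      have h := HasFDerivAt.comp u (hψ (u + t • w)).hasFDerivAt h0
      rw [ContinuousLinearMap.comp_id] at h
      exact h
    have h3 := (h1.const_mul (c t)).mul h2
    have hEe : expXHat θ₁₂ θ₃₄ (t • k) ψ =ᶠ[𝓝 u] _ := Eventually.of_forall (congrFun (hE t))
    rw [(h3.congr_of_eventuallyEq hEe).fderiv]
    simp [he]
    ring
  have hc' : HasDerivAt c (Complex.I * (t * (k 0 * k 1 * θ₁₂ + k 2 * k 3 * θ₃₄) : ℝ) * c t) t := by
    have h0 : HasDerivAt (fun s : ℝ =>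
        (((s * k 0) * (s * k 1) * θ₁₂ + (s * k 2) * (s * k 3) * θ₃₄) / 2 : ℝ))
        (t * (k 0 * k 1 * θ₁₂ + k 2 * k 3 * θ₃₄)) t := by
      have h := (((hasDerivAt_id t).mul (hasDerivAt_id t)).mul_const
        ((k 0 * k 1 * θ₁₂ + k 2 * k 3 * θ₃₄) / 2)).congr_deriv
          (show _ = t * (k 0 * k 1 * θ₁₂ + k 2 * k 3 * θ₃₄) by simp; ring)
      refine h.congr_of_eventuallyEq (Eventually.of_forall fun s => ?_)
      simp; ring
    refine (h0.ofReal_comp.const_mul Complex.I).cexp.congr_deriv ?_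
    simp only [hc]; ring
  have he' : HasDerivAt (fun s => e s u)
      (Complex.I * (k 0 * u 0 + k 2 * u 1 : ℝ) * e t u) t := by
    have h0 : HasDerivAt (fun s : ℝ => (s * k 0) * u 0 + (s * k 2) * u 1)
        (k 0 * u 0 + k 2 * u 1) t := by
      have h := ((hasDerivAt_id t).mul_const (k 0 * u 0 + k 2 * u 1)).congr_deriv (one_mul _)
      refine h.congr_of_eventuallyEq (Eventually.of_forall fun s => ?_)
      simp; ring
    refine (h0.ofReal_comp.const_mul Complex.I).cexp.congr_deriv ?_
    simp only [he]; ring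
  have hψ' : HasDerivAt (fun s : ℝ => ψ (u + s • w)) (fderiv ℝ ψ (u + t • w) w) t := by
    have h0 : HasDerivAt (fun s : ℝ => u + s • w) w t := by
      simpa using ((hasDerivAt_id t).smul_const w).const_add u
    exact (hψ (u + t • w)).hasFDerivAt.comp_hasDerivAt t h0
  have hmain := (hc'.mul he').mul hψ'
  have hfun : (fun s : ℝ => expXHat θ₁₂ θ₃₄ (s • k) ψ u) =
      fun s => c s * e s u * ψ (u + s • w) := by
    funext s; rw [hE s]
  rw [hfun]
  refine hmain.congr_deriv ?_
  have hDw : fderiv ℝ ψ (u + t • w) w =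
      (θ₁₂ * k 1 : ℝ) * fderiv ℝ ψ (u + t • w) (EuclideanSpace.single 0 1) +
      (θ₃₄ * k 3 : ℝ) * fderiv ℝ ψ (u + t • w) (EuclideanSpace.single 1 1) := by
    conv_lhs => rw [show fderiv ℝ ψ (u + t • w) w = fderiv ℝ ψ (u + t • w)
      ((θ₁₂ * k 1) • EuclideanSpace.single 0 1 + (θ₃₄ * k 3) • EuclideanSpace.single 1 1) by
        rw [← hwb]]
    simp
  rw [hDw]
  simp only [Fin.sum_univ_four, xHat, hfd]
  rw [hE t]
  simp
  ring_nf
  simp only [Complex.I_sq, mul_assoc]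
  ring_nf
  simp only [Complex.I_pow_three]
  ring

/-! ### The Weyl formula -/

/-- The matrix element `⟨φ, Δ̂(x) ψ⟩` of
`Δ̂(x) = (2π)⁻⁴ ∫ exp(i k·x̂) exp(-i k·x) d⁴k`. -/
def deltaHat (θ₁₂ θ₃₄ : ℝ) (φ ψ : 𝓢(R2, ℂ)) (x : R4) : ℂ :=
  ((2 * Real.pi : ℝ) : ℂ)⁻¹ ^ 4 *
    ∫ k : R4, (∫ u : R2, (starRingEnd ℂ) (φ u) * expXHat θ₁₂ θ₃₄ k ψ u) *
      Complex.exp (-Complex.I * (∑ j, k j * x j : ℝ))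

/-- `T` is the Weyl operator `Ŵ[f] = ∫ f(x) Δ̂(x) d⁴x`, the operator-valued integral being
understood weakly on the Schwartz space of `ℝ²`: for all Schwartz `φ`, `ψ`,
`⟨φ, T ψ⟩ = ∫ f(x) ⟨φ, Δ̂(x) ψ⟩ d⁴x`, with an absolutely convergent integral. -/
def IsWeylOperator (θ₁₂ θ₃₄ : ℝ) (f : R4 → ℂ) (T : L2 →L[ℂ] L2) : Prop :=
  ∀ φ ψ : 𝓢(R2, ℂ),
    Integrable (fun x : R4 => f x * deltaHat θ₁₂ θ₃₄ φ ψ x) ∧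
    ⟪φ.toLp 2, T (ψ.toLp 2)⟫_ℂ = ∫ x : R4, f x * deltaHat θ₁₂ θ₃₄ φ ψ x

/-- The set `Ŵ[F]` of the Weyl operators of the symbols in `F`. -/
def weylImage (θ₁₂ θ₃₄ : ℝ) (F : Set (R4 → ℂ)) : Set (L2 →L[ℂ] L2) :=
  {T | ∃ f ∈ F, IsWeylOperator θ₁₂ θ₃₄ f T}

/-! ### The symbol classes -/

/-- The Schwartz functions on `ℝ⁴`. -/
def schwartzClass : Set (R4 → ℂ) :=
  Set.range (fun f : 𝓢(R4, ℂ) => (f : R4 → ℂ))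

/-- `Γ^m_ρ(ℝ⁴)`; the partial derivatives of order `n` are bounded together, through the norm of
the `n`-th derivative. -/
def gammaClass (m ρ : ℝ) : Set (R4 → ℂ) :=
  {f | ContDiff ℝ ∞ f ∧ ∀ n : ℕ, ∃ C : ℝ, ∀ x : R4,
    ‖iteratedFDeriv ℝ n f x‖ ≤ C * (1 + ‖x‖ ^ 2) ^ ((m - ρ * n) / 2)}

/-- `K^∞(ℝ⁴)`: smooth functions all of whose partial derivatives, of every order `n ≥ 0`, tend to
zero at infinity. -/
def kInftyClass : Set (R4 → ℂ) :=
  {f | ContDiff ℝ ∞ f ∧ ∀ n : ℕ, Tendsto (fun x : R4 => ‖iteratedFDeriv ℝ n f x‖)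
    (cocompact R4) (𝓝 0)}

/-! ### Dense subalgebras of the compact operators -/

/-- The compact operators on `L²(ℝ²)`. -/
def compactOperators : Set (L2 →L[ℂ] L2) := {T | IsCompactOperator T}

/-- `A` is a (non-unital, complex) subalgebra of the compact operators, dense in them for the
operator norm. -/
def IsNormDenseSubalgebra (A : Set (L2 →L[ℂ] L2)) : Prop :=
  (∃ B : NonUnitalSubalgebra ℂ (L2 →L[ℂ] L2), (B : Set (L2 →L[ℂ] L2)) = A) ∧
    A ⊆ compactOperators ∧ compactOperators ⊆ closure A

end WeylQuantization

end

/-!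
In the phase-space coordinates `(x₁, x₃, x₂ / θ₁₂, x₄ / θ₃₄)` the exponentials `exp (i k·x̂)` are
the phase-space displacements of the Schrödinger representation, and `Δ̂(x)`, their symplectic
Fourier transform, is a multiple of the parity operator at `x`. The displacements of a Gaussian,
the coherent states, resolve the identity, so an operator `T` is determined by its kernel
`⟨e z, T e w⟩` and is bounded as soon as this kernel is dominated by an integrable function of
`z - w` (Schur's test). The kernel of `Ŵ[f]` is the Fourier transform of `f` seen through a
Gaussian window centred at the midpoint of `z` and `w`: it decays rapidly in `z - w` when the
derivatives of `f` are bounded, which gives existence and uniqueness, and vanishes at infinity in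
the midpoint when `f` does, which makes `Ŵ[f]` compact. The symbol of a product of two operators
is the Moyal product, an absolutely convergent integral of products of the windowed Fourier
transforms, and the three classes are closed under it. The rank-one operators built from coherent
states have Schwartz symbols, and they span a dense subspace of the compact operators.
-/

noncomputable section

open scoped FourierTransform

namespace WeylQuantization

/-- The unimodular number `exp (i t)`. -/
def phase (t : ℝ) : ℂ := Complex.exp (Complex.I * t)

section Phase

@[simp] theorem phase_zero : phase 0 = 1 := by simp [phase]

theorem phase_add (s t : ℝ) : phase (s + t) = phase s * phase t := by
  simp [phase, mul_add, Complex.exp_add]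

@[simp] theorem norm_phase (t : ℝ) : ‖phase t‖ = 1 := by
  simp [phase, mul_comm Complex.I, Complex.norm_exp_ofReal_mul_I]

@[simp] theorem conj_phase (t : ℝ) : (starRingEnd ℂ) (phase t) = phase (-t) := by
  simp [phase, ← Complex.exp_conj]

theorem hasDerivAt_phase (t : ℝ) : HasDerivAt phase (Complex.I * phase t) t := by
  have h : HasDerivAt (fun s : ℝ => Complex.I * (s : ℂ)) Complex.I t := by
    simpa using (Complex.ofRealCLM.hasDerivAt (x := t)).const_mul Complex.I
  exact h.cexp.congr_deriv (mul_comm _ _)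

theorem contDiff_phase : ContDiff ℝ ∞ phase :=
  (contDiff_const.mul Complex.ofRealCLM.contDiff).cexp

@[fun_prop] theorem continuous_phase : Continuous phase := contDiff_phase.continuous

theorem iteratedDeriv_phase (n : ℕ) :
    iteratedDeriv n phase = fun t => Complex.I ^ n * phase t := by
  induction n with
  | zero => simp
  | succ n ih =>
    ext t
    rw [iteratedDeriv_succ, ih, ((hasDerivAt_phase t).const_mul _).deriv]
    ring

theorem hasTemperateGrowth_phase : Function.HasTemperateGrowth phase := by
  refine ⟨contDiff_phase, fun n => ⟨0, 1, fun t => ?_⟩⟩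
  simp [norm_iteratedFDeriv_eq_norm_iteratedDeriv, iteratedDeriv_phase]

end Phase

section ChangeOfVariables

variable {E F : Type*} [NormedAddCommGroup E] [NormedSpace ℝ E] [MeasureSpace E] [BorelSpace E]
  [(volume : Measure E).IsAddHaarMeasure]
  [NormedAddCommGroup F] [NormedSpace ℝ F] [MeasureSpace F] [BorelSpace F]
  [(volume : Measure F).IsAddHaarMeasure]

/-- The factor by which a linear isomorphism changes integrals: `∫ f (e x) dx = J(e) ∫ f y dy`. -/
def jacobian (e : E ≃L[ℝ] F) : ℝ := (Measure.map e volume).addHaarScalarFactor volume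

theorem jacobian_pos (e : E ≃L[ℝ] F) : 0 < jacobian e :=
  NNReal.coe_pos.2 (Measure.addHaarScalarFactor_pos_of_isAddHaarMeasure _ _)

instance [FiniteDimensional ℝ E] [FiniteDimensional ℝ F] :
    (volume : Measure (E × F)).IsAddHaarMeasure :=
  inferInstanceAs ((volume : Measure E).prod (volume : Measure F)).IsAddHaarMeasure

variable [FiniteDimensional ℝ F]

theorem map_volume_continuousLinearEquiv (e : E ≃L[ℝ] F) :
    Measure.map e volume = (Measure.map e volume).addHaarScalarFactor volume • volume :=
  Measure.isAddLeftInvariant_eq_smul _ _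

theorem integrable_comp_continuousLinearEquiv_iff (e : E ≃L[ℝ] F) {G : Type*}
    [NormedAddCommGroup G] {f : F → G} : Integrable (fun x => f (e x)) ↔ Integrable f := by
  have hmap := e.toHomeomorph.measurableEmbedding.integrable_map_iff (μ := volume) (g := f)
  change Integrable f (Measure.map e volume) ↔ _ at hmap
  rw [map_volume_continuousLinearEquiv e] at hmap
  exact hmap.symm.trans (integrable_smul_measure
    (by simpa using (Measure.addHaarScalarFactor_pos_of_isAddHaarMeasure _ _).ne') (by simp))

theorem integral_comp_continuousLinearEquiv (e : E ≃L[ℝ] F) (f : F → ℂ) :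
    ∫ x, f (e x) = jacobian e * ∫ y, f y := by
  have hmap := e.toHomeomorph.measurableEmbedding.integral_map (μ := volume) f
  change ∫ y, f y ∂(Measure.map e volume) = _ at hmap
  rw [map_volume_continuousLinearEquiv e, integral_smul_nnreal_measure] at hmap
  exact hmap.symm.trans (by simp [jacobian, NNReal.smul_def])

end ChangeOfVariables

section Decay

variable {E : Type*} [NormedAddCommGroup E]

/-- The weight `(1 + ‖x‖)⁻ⁿ`, the scale on which rapid decay is measured. -/
def decay (n : ℕ) (x : E) : ℝ := ((1 + ‖x‖) ^ n)⁻¹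

theorem decay_pos (n : ℕ) (x : E) : 0 < decay n x := by unfold decay; positivity

theorem decay_nonneg (n : ℕ) (x : E) : 0 ≤ decay n x := (decay_pos n x).le

theorem decay_le_one (n : ℕ) (x : E) : decay n x ≤ 1 :=
  inv_le_one_of_one_le₀ (one_le_pow₀ (by simp))

theorem decay_add (m n : ℕ) (x : E) : decay (m + n) x = decay m x * decay n x := by
  simp [decay, pow_add, mul_comm]

@[simp] theorem decay_neg (n : ℕ) (x : E) : decay n (-x) = decay n x := by simp [decay]

@[fun_prop] theorem continuous_decay (n : ℕ) : Continuous (decay n : E → ℝ) := by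
  unfold decay
  exact Continuous.inv₀ (by fun_prop) fun x => by positivity

theorem integrable_decay [NormedSpace ℝ E] [FiniteDimensional ℝ E] [MeasureSpace E]
    [BorelSpace E] [(volume : Measure E).IsAddHaarMeasure] :
    Integrable (decay (Module.finrank ℝ E + 1) : E → ℝ) := by
  refine (integrable_one_add_norm (r := (Module.finrank ℝ E + 1 : ℕ))
    (by exact_mod_cast Nat.lt_succ_self _)).congr (Eventually.of_forall fun x => ?_)
  simp only [decay, Real.rpow_neg (show 0 ≤ 1 + ‖x‖ by positivity), Real.rpow_natCast]

/-- The Peetre inequality. -/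
theorem one_add_norm_add_le (x y : E) : 1 + ‖x + y‖ ≤ (1 + ‖x‖) * (1 + ‖y‖) := by
  nlinarith [norm_add_le x y, norm_nonneg x, norm_nonneg y]

theorem decay_mul_decay_le (n : ℕ) (x y : E) : decay n x * decay n y ≤ decay n (x + y) := by
  unfold decay
  rw [← mul_inv, ← mul_pow]
  gcongr
  exact one_add_norm_add_le x y

theorem le_mul_decay_of_pow_mul_le {a b : ℝ} {n : ℕ} {x : E} (h : (1 + ‖x‖) ^ n * a ≤ b) :
    a ≤ b * decay n x := by
  rwa [decay, ← div_eq_mul_inv, le_div_iff₀' (by positivity)]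

theorem le_mul_decay_of_le_of_norm_pow_mul_le {a B : ℝ} {n : ℕ} {x : E} (ha : 0 ≤ a) (h : a ≤ B)
    (hn : ‖x‖ ^ n * a ≤ B) : a ≤ 2 ^ n * (2 * B) * decay n x := by
  refine le_mul_decay_of_pow_mul_le ?_
  have hpow : (1 + ‖x‖) ^ n ≤ 2 ^ n * (1 + ‖x‖ ^ n) := by
    calc (1 + ‖x‖) ^ n ≤ 2 ^ (n - 1) * (1 ^ n + ‖x‖ ^ n) :=
          add_pow_le zero_le_one (norm_nonneg x) n
      _ ≤ 2 ^ n * (1 + ‖x‖ ^ n) := by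
          rw [one_pow]
          gcongr
          · exact one_le_two
          · exact n.sub_le 1
  calc (1 + ‖x‖) ^ n * a ≤ 2 ^ n * (1 + ‖x‖ ^ n) * a := by gcongr
    _ = 2 ^ n * (a + ‖x‖ ^ n * a) := by ring
    _ ≤ 2 ^ n * (2 * B) := by gcongr; linarith

variable [NormedSpace ℝ E] {F : Type*} [NormedAddCommGroup F] [NormedSpace ℝ F]

theorem exists_norm_iteratedFDeriv_le_decay (f : 𝓢(E, F)) (k N : ℕ) :
    ∃ C : ℝ, 0 ≤ C ∧ ∀ j ≤ N, ∀ x, ‖iteratedFDeriv ℝ j f x‖ ≤ C * decay k x := by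
  refine ⟨_, ?_, fun j hj x => le_mul_decay_of_pow_mul_le
    (SchwartzMap.one_add_le_sup_seminorm_apply (𝕜 := ℝ) (m := (k, N)) le_rfl hj f x)⟩
  positivity

theorem exists_norm_le_decay (f : 𝓢(E, F)) (k : ℕ) :
    ∃ C : ℝ, 0 ≤ C ∧ ∀ x, ‖f x‖ ≤ C * decay k x := by
  obtain ⟨C, hC, h⟩ := exists_norm_iteratedFDeriv_le_decay f k 0
  exact ⟨C, hC, fun x => by simpa using h 0 le_rfl x⟩

end Decay

section OscillatoryIntegral

variable {E : Type*} [NormedAddCommGroup E] [InnerProductSpace ℝ E]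

theorem hasTemperateGrowth_phase_comp (ℓ : E →L[ℝ] ℝ) :
    Function.HasTemperateGrowth (fun x => phase (ℓ x)) :=
  hasTemperateGrowth_phase.comp ℓ.hasTemperateGrowth

variable [FiniteDimensional ℝ E] [MeasurableSpace E] [BorelSpace E]

theorem integral_phase_mul_eq_fourier (F : E → ℂ) (ℓ : E →L[ℝ] ℝ) :
    ∫ x, phase (ℓ x) * F x =
      𝓕 F (-((2 * Real.pi)⁻¹ • (InnerProductSpace.toDual ℝ E).symm ℓ)) := by
  rw [Real.fourier_eq']
  refine integral_congr_ae (Eventually.of_forall fun x => ?_)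
  simp only [smul_eq_mul, inner_neg_right, inner_smul_right]
  rw [real_inner_comm, InnerProductSpace.toDual_symm_apply, phase]
  congr 2
  push_cast
  field_simp

theorem norm_pow_mul_norm_integral_phase_mul_le {N : ℕ} {F : E → ℂ} (hF : ContDiff ℝ N F)
    (hint : ∀ j ≤ N, Integrable (iteratedFDeriv ℝ j F)) (ℓ : E →L[ℝ] ℝ) :
    ‖ℓ‖ ^ N * ‖∫ x, phase (ℓ x) * F x‖ ≤
      (4 * Real.pi) ^ N * ∑ j ∈ Finset.range (N + 1), ∫ x, ‖iteratedFDeriv ℝ j F x‖ := by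
  have h := Real.pow_mul_norm_iteratedFDeriv_fourier_le (f := F) (K := 0) (N := N)
    (by exact_mod_cast hF)
    (fun k n hk hn => by
      obtain rfl : k = 0 := by simpa using hk
      simpa using (hint n (by exact_mod_cast hn)).norm) (k := 0) (n := N) le_rfl le_rfl
    (-((2 * Real.pi)⁻¹ • (InnerProductSpace.toDual ℝ E).symm ℓ))
  simp only [pow_zero, ← integral_phase_mul_eq_fourier, one_mul, norm_iteratedFDeriv_zero,
    zero_add, Finset.range_one, Finset.singleton_product, Finset.sum_map,
    Function.Embedding.coeFn_mk, norm_neg, norm_smul, Nat.cast_zero, mul_zero,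
    Real.norm_eq_abs, LinearIsometryEquiv.norm_map] at h
  rw [abs_of_pos (by positivity), mul_pow, inv_pow, mul_assoc, ← le_div_iff₀' (by positivity),
    div_inv_eq_mul] at h
  refine h.trans_eq ?_
  rw [show (4 * Real.pi) ^ N = 2 ^ N * (2 * Real.pi) ^ N by rw [← mul_pow]; ring_nf]
  ring

theorem exists_norm_integral_phase_mul_le (N : ℕ) :
    ∃ C : ℝ, 0 ≤ C ∧ ∀ (F : E → ℂ) (B : ℝ), ContDiff ℝ N F →
      (∀ j ≤ N, ∀ x, ‖iteratedFDeriv ℝ j F x‖ ≤ B * decay (Module.finrank ℝ E + 1) x) →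
      ∀ ℓ : E →L[ℝ] ℝ, ‖∫ x, phase (ℓ x) * F x‖ ≤ C * B * decay N ℓ := by
  set I : ℝ := ∫ x : E, decay (Module.finrank ℝ E + 1) x
  have hI : 0 ≤ I := integral_nonneg fun x => decay_nonneg _ x
  refine ⟨2 ^ N * (2 * ((4 * Real.pi) ^ N * ((N + 1) * I))), by positivity,
    fun F B hF hB ℓ => ?_⟩
  have hB0 : 0 ≤ B := by
    have h := (norm_nonneg _).trans (hB 0 N.zero_le 0)
    exact nonneg_of_mul_nonneg_left h (decay_pos _ _)
  have hdecay : Integrable fun x : E => B * decay (Module.finrank ℝ E + 1) x :=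
    integrable_decay.const_mul B
  have hint : ∀ j ≤ N, Integrable (iteratedFDeriv ℝ j F) := fun j hj =>
    hdecay.mono' (hF.continuous_iteratedFDeriv (by exact_mod_cast hj)).aestronglyMeasurable
      (Eventually.of_forall (hB j hj))
  have hle : ∀ j ≤ N, ∫ x, ‖iteratedFDeriv ℝ j F x‖ ≤ I * B := fun j hj => by
    rw [mul_comm, ← integral_const_mul]
    exact integral_mono (hint j hj).norm hdecay (hB j hj)
  have hpi : (1 : ℝ) ≤ (4 * Real.pi) ^ N := one_le_pow₀ (by nlinarith [Real.pi_gt_three])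
  have hzero : ‖∫ x, phase (ℓ x) * F x‖ ≤ (4 * Real.pi) ^ N * ((N + 1) * (I * B)) :=
    calc ‖∫ x, phase (ℓ x) * F x‖ ≤ ∫ x, ‖phase (ℓ x) * F x‖ := norm_integral_le_integral_norm _
      _ = ∫ x, ‖iteratedFDeriv ℝ 0 F x‖ := by simp
      _ ≤ 1 * (1 * (I * B)) := by simpa using hle 0 N.zero_le
      _ ≤ (4 * Real.pi) ^ N * ((N + 1) * (I * B)) := by gcongr; simp
  have hpow : ‖ℓ‖ ^ N * ‖∫ x, phase (ℓ x) * F x‖ ≤ (4 * Real.pi) ^ N * ((N + 1) * (I * B)) := by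
    refine (norm_pow_mul_norm_integral_phase_mul_le hF hint ℓ).trans ?_
    gcongr
    refine (Finset.sum_le_sum fun j hj =>
      hle j (Nat.lt_succ_iff.1 (Finset.mem_range.1 hj))).trans_eq ?_
    simp
  refine (le_mul_decay_of_le_of_norm_pow_mul_le (norm_nonneg _) hzero hpow).trans_eq ?_
  ring

end OscillatoryIntegral

section TightFrame

variable {X H : Type*} [MeasureSpace X] [NormedAddCommGroup H] [InnerProductSpace ℂ H]

/-- A continuous tight frame: a continuous family `e` of vectors resolving the identity,
`∫ |e z⟩⟨e z| dz = κ`, in the weak sense. -/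
structure IsTightFrame [TopologicalSpace X] (e : X → H) (κ : ℝ) : Prop where
  continuous : Continuous e
  pos : 0 < κ
  memLp (φ : H) : MemLp (fun z => ⟪e z, φ⟫_ℂ) 2
  integral_inner_mul_inner (φ ψ : H) : ∫ z, ⟪φ, e z⟫_ℂ * ⟪e z, ψ⟫_ℂ = κ * ⟪φ, ψ⟫_ℂ

theorem inner_toLp_inner_toLp {e : X → H} {φ ψ : H} (hφ : MemLp (fun z => ⟪e z, φ⟫_ℂ) 2)
    (hψ : MemLp (fun z => ⟪e z, ψ⟫_ℂ) 2) :
    ⟪hφ.toLp _, hψ.toLp _⟫_ℂ = ∫ z, ⟪φ, e z⟫_ℂ * ⟪e z, ψ⟫_ℂ := by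
  rw [L2.inner_def]
  refine integral_congr_ae ?_
  filter_upwards [hφ.coeFn_toLp, hψ.coeFn_toLp] with z h₁ h₂
  rw [h₁, h₂, RCLike.inner_apply, inner_conj_symm, mul_comm]

theorem eLpNorm_inner_of_integral_eq {e : X → H} {φ : H} {κ : ℝ} (hκ : 0 ≤ κ)
    (hφ : MemLp (fun z => ⟪e z, φ⟫_ℂ) 2)
    (h : ∫ z, ⟪φ, e z⟫_ℂ * ⟪e z, φ⟫_ℂ = κ * ⟪φ, φ⟫_ℂ) :
    eLpNorm (fun z => ⟪e z, φ⟫_ℂ) 2 = ENNReal.ofReal (√κ * ‖φ‖) := by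
  rw [← inner_toLp_inner_toLp hφ hφ, inner_self_eq_norm_sq_to_K, inner_self_eq_norm_sq_to_K] at h
  have hsq : ‖hφ.toLp _‖ ^ 2 = (√κ * ‖φ‖) ^ 2 := by
    rw [mul_pow, Real.sq_sqrt hκ]
    exact Complex.ofReal_injective (by push_cast; exact h)
  rw [← ENNReal.ofReal_toReal hφ.eLpNorm_ne_top, ← Lp.norm_toLp _ hφ,
    (sq_eq_sq₀ (norm_nonneg _) (by positivity)).1 hsq]

section DenseRange

variable [TopologicalSpace X] [OpensMeasurableSpace X] {D : Type*} {ι : D → H} {e : X → H} {κ : ℝ}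

theorem eLpNorm_inner_le_of_denseRange (hι : DenseRange ι) (he : Continuous e)
    (h : ∀ d, eLpNorm (fun z => ⟪e z, ι d⟫_ℂ) 2 = ENNReal.ofReal (√κ * ‖ι d‖)) (φ : H) :
    eLpNorm (fun z => ⟪e z, φ⟫_ℂ) 2 ≤ ENNReal.ofReal (√κ * ‖φ‖) := by
  obtain ⟨a, ha, hlim⟩ := mem_closure_iff_seq_limit.1 (hι φ)
  choose d hd using ha
  obtain rfl : a = fun n => ι (d n) := funext fun n => (hd n).symm
  refine (Lp.eLpNorm_lim_le_liminf_eLpNorm (f := fun n z => ⟪e z, ι (d n)⟫_ℂ)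
    (fun n => (he.inner continuous_const).aestronglyMeasurable) _
    (Eventually.of_forall fun z => tendsto_const_nhds.inner hlim)).trans_eq ?_
  simp_rw [h]
  exact ((ENNReal.continuous_ofReal.tendsto _).comp (hlim.norm.const_mul _)).liminf_eq

theorem IsTightFrame.of_denseRange [SecondCountableTopology X] (hι : DenseRange ι)
    (he : Continuous e) (hκ : 0 < κ)
    (hmem : ∀ d, MemLp (fun z => ⟪e z, ι d⟫_ℂ) 2)
    (h : ∀ c d, ∫ z, ⟪ι c, e z⟫_ℂ * ⟪e z, ι d⟫_ℂ = κ * ⟪ι c, ι d⟫_ℂ) : IsTightFrame e κ := by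
  have hle := eLpNorm_inner_le_of_denseRange hι he fun d =>
    eLpNorm_inner_of_integral_eq hκ.le (hmem d) (h d d)
  have hLp (φ : H) : MemLp (fun z => ⟪e z, φ⟫_ℂ) 2 :=
    ⟨(he.inner continuous_const).aestronglyMeasurable, (hle φ).trans_lt ENNReal.ofReal_lt_top⟩
  let analysis : H →ₗ[ℂ] Lp ℂ 2 (volume : Measure X) :=
    { toFun φ := (hLp φ).toLp _
      map_add' φ ψ := by
        rw [← MemLp.toLp_add]
        simp only [inner_add_right]
        rfl
      map_smul' c φ := by
        rw [RingHom.id_apply, ← MemLp.toLp_const_smul]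
        simp only [inner_smul_right]
        rfl }
  let A := analysis.mkContinuous √κ fun φ => by
    exact (Lp.norm_toLp _ (hLp φ)).trans_le
      (ENNReal.toReal_le_of_le_ofReal (by positivity) (hle φ))
  refine ⟨he, hκ, hLp, fun φ ψ => ?_⟩
  rw [← inner_toLp_inner_toLp (hLp φ) (hLp ψ)]
  change ⟪A φ, A ψ⟫_ℂ = κ * ⟪φ, ψ⟫_ℂ
  refine hι.induction_on₂ (p := fun φ ψ => ⟪A φ, A ψ⟫_ℂ = κ * ⟪φ, ψ⟫_ℂ)
    (isClosed_eq (by fun_prop) (by fun_prop)) (fun c d => ?_) φ ψ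
  exact (inner_toLp_inner_toLp (hLp _) (hLp _)).trans (h c d)

end DenseRange

/-- The sesquilinear form `∬ ⟨φ, e z⟩ K(z, w) ⟨e w, ψ⟩ dz dw` with kernel `K` in the frame `e`. -/
def kernelForm (e : X → H) (K : X × X → ℂ) (φ ψ : H) : ℂ :=
  ∫ p : X × X, ⟪φ, e p.1⟫_ℂ * K p * ⟪e p.2, ψ⟫_ℂ

namespace IsTightFrame

variable [TopologicalSpace X] {e : X → H} {κ : ℝ} (he : IsTightFrame e κ)
include he

theorem ofReal_ne_zero : (κ : ℂ) ≠ 0 := by exact_mod_cast he.pos.ne'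

theorem eLpNorm_inner (φ : H) :
    eLpNorm (fun z => ⟪e z, φ⟫_ℂ) 2 = ENNReal.ofReal (√κ * ‖φ‖) :=
  eLpNorm_inner_of_integral_eq he.pos.le (he.memLp φ) (he.integral_inner_mul_inner φ φ)

theorem ext_inner {φ ψ : H} (h : ∀ z, ⟪e z, φ⟫_ℂ = ⟪e z, ψ⟫_ℂ) : φ = ψ := by
  refine ext_inner_left ℂ fun χ => mul_left_cancel₀ he.ofReal_ne_zero ?_
  simp_rw [← he.integral_inner_mul_inner, h]

theorem ext_inner_inner [CompleteSpace H] {S T : H →L[ℂ] H}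
    (h : ∀ z w, ⟪e z, S (e w)⟫_ℂ = ⟪e z, T (e w)⟫_ℂ) : S = T := by
  ext1 φ
  refine ext_inner_right ℂ fun χ => ?_
  rw [← ContinuousLinearMap.adjoint_inner_right, ← ContinuousLinearMap.adjoint_inner_right]
  congr 1
  refine he.ext_inner fun z => ?_
  rw [ContinuousLinearMap.adjoint_inner_right, ContinuousLinearMap.adjoint_inner_right,
    he.ext_inner fun w => h w z]

theorem topologicalClosure_span_range [CompleteSpace H] :
    (Submodule.span ℂ (Set.range e)).topologicalClosure = ⊤ := by
  rw [Submodule.topologicalClosure_eq_top_iff, Submodule.eq_bot_iff]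
  refine fun φ hφ => he.ext_inner fun z => ?_
  rw [inner_zero_right]
  exact (Submodule.mem_orthogonal _ _).1 hφ _ (Submodule.subset_span ⟨z, rfl⟩)

theorem integral_inner_mul_inner_comp [CompleteSpace H] (S T : H →L[ℂ] H) (φ ψ : H) :
    ∫ z, ⟪φ, S (e z)⟫_ℂ * ⟪e z, T ψ⟫_ℂ = κ * ⟪φ, (S * T) ψ⟫_ℂ := by
  simp_rw [← ContinuousLinearMap.adjoint_inner_left S]
  rw [he.integral_inner_mul_inner, ContinuousLinearMap.adjoint_inner_left]
  rfl

theorem map_mem_of_isClosed [CompleteSpace H] {G : Type*} [NormedAddCommGroup G] [NormedSpace ℂ G]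
    {σ : ℂ →+* ℂ} (R : H →SL[σ] G) {M : Submodule ℂ G} (hM : IsClosed (M : Set G))
    (h : ∀ z, R (e z) ∈ M) (φ : H) : R φ ∈ M := by
  have hle := Submodule.topologicalClosure_minimal (Submodule.span ℂ (Set.range e))
    (t := M.comap (R : H →ₛₗ[σ] G)) (Submodule.span_le.2 (Set.range_subset_iff.2 h))
    (hM.preimage R.continuous)
  exact hle (he.topologicalClosure_span_range ▸ Submodule.mem_top)

theorem rankOne_mem_of_isClosed [CompleteSpace H] {M : Submodule ℂ (H →L[ℂ] H)}
    (hM : IsClosed (M : Set (H →L[ℂ] H)))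
    (h : ∀ z w, InnerProductSpace.rankOne ℂ (e z) (e w) ∈ M) (φ ψ : H) :
    InnerProductSpace.rankOne ℂ φ ψ ∈ M := by
  refine he.map_mem_of_isClosed (InnerProductSpace.rankOne ℂ φ) hM (fun w => ?_) ψ
  let R : H →L[ℂ] H →L[ℂ] H := ContinuousLinearMap.smulRightL ℂ H H (innerSL ℂ (e w))
  have hR (χ : H) : R χ = InnerProductSpace.rankOne ℂ χ (e w) := rfl
  rw [← hR]
  exact he.map_mem_of_isClosed R hM (fun z => (hR (e z)).symm ▸ h z w) φ

theorem kernelForm_inner_of_integrable [CompleteSpace H] [SFinite (volume : Measure X)]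
    {T : H →L[ℂ] H} {φ ψ : H}
    (hi : Integrable fun p : X × X => ⟪φ, e p.1⟫_ℂ * ⟪e p.1, T (e p.2)⟫_ℂ * ⟪e p.2, ψ⟫_ℂ) :
    kernelForm e (fun p => ⟪e p.1, T (e p.2)⟫_ℂ) φ ψ = κ ^ 2 * ⟪φ, T ψ⟫_ℂ := by
  have hinner (z : X) : ∫ w, ⟪φ, e z⟫_ℂ * ⟪e z, T (e w)⟫_ℂ * ⟪e w, ψ⟫_ℂ =
      κ * (⟪φ, e z⟫_ℂ * ⟪e z, T ψ⟫_ℂ) := by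
    simp only [mul_assoc, integral_const_mul]
    rw [mul_left_comm, ← mul_one T]
    exact congrArg _ (he.integral_inner_mul_inner_comp T 1 (e z) ψ)
  rw [kernelForm, Measure.volume_eq_prod, integral_prod _ hi]
  simp only [hinner]
  rw [integral_const_mul, he.integral_inner_mul_inner, sq, mul_assoc]

end IsTightFrame

end TightFrame

section SchurTest

variable {E : Type*} [NormedAddCommGroup E] [MeasureSpace E] [BorelSpace E]
  [(volume : Measure E).IsAddRightInvariant]

theorem lintegral_enorm_add_mul_enorm_le {u v : E → ℂ} (hu : Measurable u) (hv : Measurable v)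
    (d : E) : ∫⁻ w, ‖u (w + d)‖ₑ * ‖v w‖ₑ ≤ eLpNorm u 2 * eLpNorm v 2 := by
  have h := ENNReal.lintegral_mul_le_Lp_mul_Lq (volume : Measure E) Real.HolderConjugate.two_two
    (hu.comp (measurable_add_const d)).enorm.aemeasurable hv.enorm.aemeasurable
  simp only [Pi.mul_apply, Function.comp_apply] at h
  rwa [lintegral_add_right_eq_self (fun w => ‖u w‖ₑ ^ (2 : ℝ)) d, ← ENNReal.toReal_ofNat,
    ← eLpNorm_eq_lintegral_rpow_enorm_toReal (by simp) (by simp),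
    ← eLpNorm_eq_lintegral_rpow_enorm_toReal (by simp) (by simp)] at h

variable [SecondCountableTopology E] [SFinite (volume : Measure E)]

theorem lintegral_mul_sub_mul_le {u v : E → ℂ} {η : E → ENNReal} (hu : Measurable u)
    (hv : Measurable v) (hη : Measurable η) :
    ∫⁻ p : E × E, ‖u p.1‖ₑ * η (p.1 - p.2) * ‖v p.2‖ₑ ≤
      (∫⁻ d, η d) * (eLpNorm u 2 * eLpNorm v 2) := by
  have hm : Measurable fun p : E × E => ‖u p.1‖ₑ * η (p.1 - p.2) * ‖v p.2‖ₑ :=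
    ((hu.comp measurable_fst).enorm.mul (hη.comp (measurable_fst.sub measurable_snd))).mul
      (hv.comp measurable_snd).enorm
  have hm' : Measurable fun p : E × E => ‖u (p.2 + p.1)‖ₑ * η p.2 * ‖v p.1‖ₑ :=
    ((hu.comp (measurable_snd.add measurable_fst)).enorm.mul (hη.comp measurable_snd)).mul
      (hv.comp measurable_fst).enorm
  rw [Measure.volume_eq_prod, lintegral_prod_symm _ hm.aemeasurable]
  have hshift (w : E) : ∫⁻ z, ‖u z‖ₑ * η (z - w) * ‖v w‖ₑ =
      ∫⁻ d, ‖u (d + w)‖ₑ * η d * ‖v w‖ₑ := by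
    rw [← lintegral_add_right_eq_self _ w]
    simp only [add_sub_cancel_right]
  simp only [hshift]
  rw [lintegral_lintegral_swap hm'.aemeasurable, ← lintegral_mul_const _ hη]
  refine lintegral_mono fun d => ?_
  simp only [mul_comm _ (η d), mul_assoc (η d)]
  rw [lintegral_const_mul _ (by fun_prop)]
  gcongr
  simpa only [add_comm d] using lintegral_enorm_add_mul_enorm_le hu hv d

variable {H : Type*} [NormedAddCommGroup H] [InnerProductSpace ℂ H]

namespace IsTightFrame

variable {e : E → H} {κ : ℝ} (he : IsTightFrame e κ) {K : E × E → ℂ} {η : E → ℝ}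
include he

theorem lintegral_enorm_kernelForm_le (hη : Continuous η)
    (hK : ∀ p, ‖K p‖ ≤ η (p.1 - p.2)) (φ ψ : H) :
    ∫⁻ p : E × E, ‖⟪φ, e p.1⟫_ℂ * K p * ⟪e p.2, ψ⟫_ℂ‖ₑ ≤
      (∫⁻ d, ENNReal.ofReal (η d)) * ENNReal.ofReal (κ * ‖φ‖ * ‖ψ‖) := by
  have hle := lintegral_mul_sub_mul_le (u := fun z => ⟪e z, φ⟫_ℂ) (v := fun z => ⟪e z, ψ⟫_ℂ)
    (he.continuous.inner continuous_const).measurable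
    (he.continuous.inner continuous_const).measurable hη.measurable.ennreal_ofReal
  rw [he.eLpNorm_inner, he.eLpNorm_inner, ← ENNReal.ofReal_mul (by positivity)] at hle
  rw [show κ * ‖φ‖ * ‖ψ‖ = √κ * ‖φ‖ * (√κ * ‖ψ‖) by
    rw [mul_mul_mul_comm, Real.mul_self_sqrt he.pos.le, mul_assoc]]
  refine (lintegral_mono fun p => ?_).trans hle
  rw [enorm_mul, enorm_mul, ← enorm_norm ⟪φ, e p.1⟫_ℂ, norm_inner_symm, enorm_norm]
  gcongr
  rw [← ofReal_norm]
  exact ENNReal.ofReal_le_ofReal (hK p)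

theorem integrable_kernelForm (hη : Continuous η) (hηi : Integrable η)
    (hKm : AEStronglyMeasurable K) (hK : ∀ p, ‖K p‖ ≤ η (p.1 - p.2)) (φ ψ : H) :
    Integrable fun p : E × E => ⟪φ, e p.1⟫_ℂ * K p * ⟪e p.2, ψ⟫_ℂ := by
  have hc := he.continuous
  refine ⟨((continuous_const.inner (hc.comp continuous_fst)).aestronglyMeasurable.mul hKm).mul
    ((hc.comp continuous_snd).inner continuous_const).aestronglyMeasurable,
    (he.lintegral_enorm_kernelForm_le hη hK φ ψ).trans_lt
      (ENNReal.mul_lt_top ?_ ENNReal.ofReal_lt_top)⟩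
  exact hηi.lintegral_lt_top

theorem norm_kernelForm_le (hη : Continuous η) (hηi : Integrable η) (hη0 : ∀ d, 0 ≤ η d)
    (hK : ∀ p, ‖K p‖ ≤ η (p.1 - p.2)) (φ ψ : H) :
    ‖kernelForm e K φ ψ‖ ≤ (∫ d, η d) * κ * ‖φ‖ * ‖ψ‖ := by
  have h := (enorm_integral_le_lintegral_enorm _).trans
    (he.lintegral_enorm_kernelForm_le hη hK φ ψ)
  have hI : 0 ≤ ∫ d, η d := integral_nonneg hη0
  have hκ := he.pos
  rw [← ofReal_integral_eq_lintegral_ofReal hηi (Eventually.of_forall hη0),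
    ← ENNReal.ofReal_mul hI, ← ofReal_norm, ENNReal.ofReal_le_ofReal_iff (by positivity)] at h
  exact h.trans_eq (by ring)

theorem exists_inner_eq_kernelForm [CompleteSpace H] (hη : Continuous η) (hηi : Integrable η)
    (hη0 : ∀ d, 0 ≤ η d) (hKm : AEStronglyMeasurable K) (hK : ∀ p, ‖K p‖ ≤ η (p.1 - p.2)) :
    ∃ T : H →L[ℂ] H, ∀ φ ψ, ⟪φ, T ψ⟫_ℂ = kernelForm e K φ ψ := by
  have hi := he.integrable_kernelForm hη hηi hKm hK
  let Λ : H →ₗ⋆[ℂ] H →ₗ[ℂ] ℂ := LinearMap.mk₂'ₛₗ (starRingEnd ℂ) (RingHom.id ℂ)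
    (kernelForm e K)
    (fun φ φ' ψ => by
      simp only [kernelForm, ← integral_add (hi φ ψ) (hi φ' ψ), inner_add_left, add_mul])
    (fun c φ ψ => by
      simp only [kernelForm, smul_eq_mul, ← integral_const_mul, inner_smul_left, mul_assoc])
    (fun φ ψ ψ' => by
      simp only [kernelForm, ← integral_add (hi φ ψ) (hi φ ψ'), inner_add_right, mul_add])
    (fun c φ ψ => by
      simp only [kernelForm, RingHom.id_apply, smul_eq_mul, ← integral_const_mul,
        inner_smul_right, mul_left_comm c])
  let Λc : H →L⋆[ℂ] H →L[ℂ] ℂ :=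
    Λ.mkContinuous₂ ((∫ d, η d) * κ) (he.norm_kernelForm_le hη hηi hη0 hK)
  refine ⟨(InnerProductSpace.continuousLinearMapOfBilin Λc).adjoint, fun φ ψ => ?_⟩
  rw [ContinuousLinearMap.adjoint_inner_right,
    InnerProductSpace.continuousLinearMapOfBilin_apply]
  rfl

theorem opNorm_le_of_inner_eq_kernelForm (hη : Continuous η) (hηi : Integrable η)
    (hη0 : ∀ d, 0 ≤ η d) (hK : ∀ p, ‖K p‖ ≤ η (p.1 - p.2)) {T : H →L[ℂ] H}
    (hT : ∀ φ ψ, ⟪φ, T ψ⟫_ℂ = kernelForm e K φ ψ) : ‖T‖ ≤ (∫ d, η d) * κ := by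
  have hI : 0 ≤ ∫ d, η d := integral_nonneg hη0
  refine ContinuousLinearMap.opNorm_le_of_re_inner_le (mul_nonneg hI he.pos.le) fun ψ φ hψ hφ => ?_
  have h := he.norm_kernelForm_le hη hηi hη0 hK φ ψ
  rw [← hT, hψ, hφ, mul_one, mul_one] at h
  exact (RCLike.re_le_norm _).trans ((norm_inner_symm _ _).trans_le h)

theorem kernelForm_inner [CompleteSpace H] {T : H →L[ℂ] H} (hη : Continuous η)
    (hηi : Integrable η) (hT : ∀ z w, ‖⟪e z, T (e w)⟫_ℂ‖ ≤ η (z - w)) (φ ψ : H) :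
    kernelForm e (fun p => ⟪e p.1, T (e p.2)⟫_ℂ) φ ψ = κ ^ 2 * ⟪φ, T ψ⟫_ℂ :=
  he.kernelForm_inner_of_integrable <| he.integrable_kernelForm hη hηi
    ((he.continuous.comp continuous_fst).inner (T.continuous.comp
      (he.continuous.comp continuous_snd))).aestronglyMeasurable (fun p => hT p.1 p.2) φ ψ

end IsTightFrame

end SchurTest

section Compact

variable {H : Type*} [NormedAddCommGroup H] [InnerProductSpace ℂ H] [CompleteSpace H]

omit [CompleteSpace H] in
theorem isCompactOperator_rankOne (φ ψ : H) :
    IsCompactOperator (InnerProductSpace.rankOne ℂ φ ψ : H →L[ℂ] H) := by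
  rw [InnerProductSpace.rankOne_def']
  exact (isCompactOperator_of_locallyCompactSpace_dom (innerSL ℂ ψ)).clm_comp
    (ContinuousLinearMap.toSpanSingleton ℂ φ)

theorem isCompactOperator_integral {X : Type*} [MeasurableSpace X] {μ : Measure X}
    {F : X → H →L[ℂ] H} (hF : Integrable F μ) (h : ∀ x, IsCompactOperator (F x)) :
    IsCompactOperator (∫ x, F x ∂μ : H →L[ℂ] H) := by
  let S := compactOperator (RingHom.id ℂ) H H
  have hS : IsClosed (S : Set (H →L[ℂ] H)) := isClosed_setOfPred_isCompactOperator
  have : CompleteSpace S := hS.completeSpace_coe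
  let G : X → S := fun x => ⟨F x, h x⟩
  have hG : Integrable G μ :=
    hF.norm.mono' ((Topology.IsEmbedding.subtypeVal.aestronglyMeasurable_comp_iff (f := G)).1
      hF.aestronglyMeasurable) (Eventually.of_forall fun x => le_rfl)
  rw [show ∫ x, F x ∂μ = (∫ x, G x ∂μ : S) from S.subtypeL.integral_comp_comm hG]
  exact (∫ x, G x ∂μ : S).2

omit [CompleteSpace H] in
theorem exists_norm_comp_sub_le_of_isCompactOperator {T : H →L[ℂ] H} (hT : IsCompactOperator T)
    {ε : ℝ} (hε : 0 < ε) : ∃ U : Submodule ℂ H, ∃ _ : FiniteDimensional ℂ U,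
      ‖T - U.starProjection ∘L T‖ ≤ ε := by
  have hc := IsCompactOperator.isCompact_closure_image_closedBall (f := (T : H →ₗ[ℂ] H)) hT 1
  obtain ⟨t, htf, ht⟩ := Metric.totallyBounded_iff.1 hc.totallyBounded _ hε
  have : FiniteDimensional ℂ (Submodule.span ℂ t) := FiniteDimensional.span_of_finite ℂ htf
  refine ⟨Submodule.span ℂ t, this,
    ContinuousLinearMap.opNorm_le_of_unit_norm hε.le fun φ hφ => ?_⟩
  obtain ⟨y, hy, hTy⟩ := Set.mem_iUnion₂.1
    (ht (subset_closure (Set.mem_image_of_mem T (mem_closedBall_zero_iff.2 hφ.le))))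
  rw [sub_apply, ContinuousLinearMap.comp_apply, Submodule.starProjection_minimal]
  refine (ciInf_le ⟨0, ?_⟩ (⟨y, Submodule.subset_span hy⟩ : Submodule.span ℂ t)).trans ?_
  · rintro _ ⟨u, rfl⟩
    exact norm_nonneg _
  · exact (dist_eq_norm (T φ) y ▸ hTy.le)

theorem mem_of_isCompactOperator {M : Submodule ℂ (H →L[ℂ] H)}
    (hM : IsClosed (M : Set (H →L[ℂ] H))) (h : ∀ φ ψ, InnerProductSpace.rankOne ℂ φ ψ ∈ M)
    {T : H →L[ℂ] H} (hT : IsCompactOperator T) : T ∈ M := by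
  refine hM.closure_subset (Metric.mem_closure_iff.2 fun ε hε => ?_)
  obtain ⟨U, _, hU⟩ := exists_norm_comp_sub_le_of_isCompactOperator hT (half_pos hε)
  refine ⟨U.starProjection ∘L T, ?_, (dist_eq_norm _ _).trans_lt (hU.trans_lt (half_lt_self hε))⟩
  rw [(stdOrthonormalBasis ℂ U).starProjection_eq_sum_rankOne,
    ContinuousLinearMap.finsetSum_comp]
  refine M.sum_mem fun i _ => ?_
  rw [InnerProductSpace.rankOne_comp]
  exact h _ _

omit [CompleteSpace H] in
theorem continuous_rankOne_prod {X : Type*} [TopologicalSpace X] {e : X → H} (he : Continuous e) :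
    Continuous fun p : X × X => (InnerProductSpace.rankOne ℂ (e p.1) (e p.2) : H →L[ℂ] H) :=
  (ContinuousLinearMap.smulRightL ℂ H H).continuous₂.comp
    (((innerSL ℂ (E := H)).continuous.comp (he.comp continuous_snd)).prodMk
      (he.comp continuous_fst))

end Compact

section CompactKernel

/-- The change of variables `(z, w) ↦ ((z + w) / 2, z - w)` to the midpoint and the difference. -/
def midpointEquiv (E : Type*) [NormedAddCommGroup E] [NormedSpace ℝ E] : (E × E) ≃L[ℝ] E × E where
  toFun p := ((2⁻¹ : ℝ) • (p.1 + p.2), p.1 - p.2)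
  invFun q := (q.1 + (2⁻¹ : ℝ) • q.2, q.1 - (2⁻¹ : ℝ) • q.2)
  map_add' p q := by ext <;> simp only [Prod.fst_add, Prod.snd_add, Prod.mk_add_mk] <;> module
  map_smul' c p := by
    ext <;> simp only [Prod.smul_fst, Prod.smul_snd, Prod.smul_mk, RingHom.id_apply] <;> module
  left_inv p := by ext <;> module
  right_inv q := by ext <;> module

theorem midpointEquiv_apply {E : Type*} [NormedAddCommGroup E] [NormedSpace ℝ E] (p : E × E) :
    midpointEquiv E p = ((2⁻¹ : ℝ) • (p.1 + p.2), p.1 - p.2) := rfl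

variable {E : Type*} [NormedAddCommGroup E] [NormedSpace ℝ E] [FiniteDimensional ℝ E]
  [MeasureSpace E] [BorelSpace E]
  {H : Type*} [NormedAddCommGroup H] [InnerProductSpace ℂ H] [CompleteSpace H]
  {e : E → H} {K : E × E → ℂ} {a η : E → ℝ} {b A κ : ℝ}

theorem exists_isCompactOperator_inner_eq_kernelForm (he : Continuous e) (hb : ∀ z, ‖e z‖ ≤ b)
    (hK : Integrable K) :
    ∃ S : H →L[ℂ] H, IsCompactOperator S ∧ ∀ φ ψ, ⟪φ, S ψ⟫_ℂ = kernelForm e K φ ψ := by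
  let F : E × E → H →L[ℂ] H := fun p => K p • InnerProductSpace.rankOne ℂ (e p.1) (e p.2)
  have hF : Integrable F := by
    refine (hK.norm.mul_const (b * b)).mono'
      (hK.aestronglyMeasurable.smul (continuous_rankOne_prod he).aestronglyMeasurable)
      (Eventually.of_forall fun p => ?_)
    rw [norm_smul, InnerProductSpace.norm_rankOne]
    have hb0 := (norm_nonneg _).trans (hb 0)
    gcongr <;> exact hb _
  refine ⟨∫ p, F p, isCompactOperator_integral hF fun p =>
    (isCompactOperator_rankOne (e p.1) (e p.2)).smul (K p), fun φ ψ => ?_⟩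
  rw [ContinuousLinearMap.integral_apply hF, ← integral_inner (hF.apply_continuousLinearMap ψ)]
  refine integral_congr_ae (Eventually.of_forall fun p => ?_)
  simp only [F, smul_apply, InnerProductSpace.rankOne_apply, inner_smul_right]
  ring

variable [(volume : Measure E).IsAddHaarMeasure]

theorem integrable_indicator_midpoint (hKm : AEStronglyMeasurable K) (hη : Integrable η)
    (hK : ∀ p, ‖K p‖ ≤ η (p.1 - p.2)) (R : ℝ) :
    Integrable (((fun p : E × E => (2⁻¹ : ℝ) • (p.1 + p.2)) ⁻¹' Metric.closedBall 0 R).indicator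
      K) := by
  have hball : Integrable ((Metric.closedBall (0 : E) R).indicator fun _ => (1 : ℝ)) :=
    (integrable_indicator_iff Metric.isClosed_closedBall.measurableSet).2
      (integrableOn_const (isCompact_closedBall _ _).measure_lt_top.ne)
  refine ((integrable_comp_continuousLinearEquiv_iff (midpointEquiv E)).2
    (hball.mul_prod hη)).mono' (hKm.indicator
      (Metric.isClosed_closedBall.preimage (by fun_prop)).measurableSet)
    (Eventually.of_forall fun p => ?_)
  rw [midpointEquiv_apply]
  by_cases hp : (2⁻¹ : ℝ) • (p.1 + p.2) ∈ Metric.closedBall 0 R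
  · have hp' : p ∈ (fun p : E × E => (2⁻¹ : ℝ) • (p.1 + p.2)) ⁻¹' Metric.closedBall 0 R := hp
    rw [Set.indicator_of_mem hp', Set.indicator_of_mem hp, one_mul]
    exact hK p
  · have hp' : p ∉ (fun p : E × E => (2⁻¹ : ℝ) • (p.1 + p.2)) ⁻¹' Metric.closedBall 0 R := hp
    rw [Set.indicator_of_notMem hp', Set.indicator_of_notMem hp, norm_zero, zero_mul]

/-- The operator is the norm limit of its truncations to bounded midpoints. -/
theorem IsTightFrame.isCompactOperator_of_kernelForm (he : IsTightFrame e κ)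
    (hb : ∀ z, ‖e z‖ ≤ b) (hη : Continuous η) (hηi : Integrable η) (hη0 : ∀ d, 0 ≤ η d)
    (ha : ∀ c, a c ≤ A) (ha0 : Tendsto a (cocompact E) (𝓝 0)) (hKm : AEStronglyMeasurable K)
    (hK : ∀ p, ‖K p‖ ≤ a ((2⁻¹ : ℝ) • (p.1 + p.2)) * η (p.1 - p.2)) {T : H →L[ℂ] H}
    (hT : ∀ φ ψ, ⟪φ, T ψ⟫_ℂ = kernelForm e K φ ψ) : IsCompactOperator T := by
  refine (isClosed_setOfPred_isCompactOperator (σ₁₂ := RingHom.id ℂ) (M₁ := H)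
    (M₂ := H)).closure_subset (Metric.mem_closure_iff.2 fun ε hε => ?_)
  have hI : 0 ≤ (∫ d, η d) * κ := mul_nonneg (integral_nonneg hη0) he.pos.le
  obtain ⟨δ, hδ, hδε⟩ : ∃ δ : ℝ, 0 < δ ∧ δ * ((∫ d, η d) * κ) < ε :=
    ⟨ε / ((∫ d, η d) * κ + 1), by positivity, by
      rw [div_mul_eq_mul_div, div_lt_iff₀ (by positivity)]; nlinarith⟩
  obtain ⟨R, hR⟩ : ∃ R : ℝ, ∀ c, R < ‖c‖ → a c ≤ δ := by
    have h := ha0.eventually (gt_mem_nhds hδ)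
    rw [← Metric.cobounded_eq_cocompact, ← comap_norm_atTop] at h
    obtain ⟨R, hR⟩ := eventually_atTop.1 (eventually_comap.1 h)
    exact ⟨R, fun c hc => (hR ‖c‖ hc.le c rfl).le⟩
  let B : Set (E × E) := (fun p => (2⁻¹ : ℝ) • (p.1 + p.2)) ⁻¹' Metric.closedBall 0 R
  have hB : MeasurableSet B :=
    (Metric.isClosed_closedBall.preimage (by fun_prop)).measurableSet
  have hKA : ∀ p, ‖K p‖ ≤ A * η (p.1 - p.2) := fun p =>
    (hK p).trans (mul_le_mul_of_nonneg_right (ha _) (hη0 _))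
  have hAi : Integrable fun d => A * η d := hηi.const_mul A
  obtain ⟨S, hS, hSK⟩ := exists_isCompactOperator_inner_eq_kernelForm he.continuous hb
    (integrable_indicator_midpoint hKm hAi hKA R)
  have hfar : ∀ p, ‖Bᶜ.indicator K p‖ ≤ δ * η (p.1 - p.2) := fun p => by
    by_cases hp : p ∈ B
    · rw [Set.indicator_of_notMem (by simpa using hp), norm_zero]
      exact mul_nonneg hδ.le (hη0 _)
    · rw [Set.indicator_of_mem hp]
      exact (hK p).trans (mul_le_mul_of_nonneg_right
        (hR _ (not_le.1 (mt mem_closedBall_zero_iff.2 hp))) (hη0 _))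
  have hsub (φ ψ : H) : ⟪φ, (T - S) ψ⟫_ℂ = kernelForm e (Bᶜ.indicator K) φ ψ := by
    have hAη : Continuous fun d => A * η d := hη.const_mul A
    rw [sub_apply, inner_sub_right, hT, hSK, kernelForm, kernelForm,
      ← integral_sub (he.integrable_kernelForm hAη hAi hKm hKA φ ψ) (he.integrable_kernelForm hAη
        hAi (hKm.indicator hB) (fun p => (norm_indicator_le_norm_self _ _).trans (hKA p)) φ ψ),
      kernelForm, Set.indicator_compl]
    simp only [Pi.sub_apply, mul_sub, sub_mul]
  refine ⟨S, hS, (dist_eq_norm T S).trans_lt (lt_of_le_of_lt ?_ hδε)⟩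
  refine (he.opNorm_le_of_inner_eq_kernelForm (hη.const_mul δ) (hηi.const_mul δ)
    (fun d => mul_nonneg hδ.le (hη0 d)) hfar hsub).trans_eq ?_
  rw [integral_const_mul, mul_assoc]

end CompactKernel

section OrderFunction

variable {E : Type*} [NormedAddCommGroup E]

/-- The order function `(1 + ‖x‖²) ^ (m / 2)` of the symbol classes. -/
def orderFun (m : ℝ) (x : E) : ℝ := (1 + ‖x‖ ^ 2) ^ (m / 2)

theorem orderFun_pos (m : ℝ) (x : E) : 0 < orderFun m x := by unfold orderFun; positivity

@[simp] theorem orderFun_zero (x : E) : orderFun 0 x = 1 := by simp [orderFun]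

theorem orderFun_le_orderFun {m m' : ℝ} (h : m ≤ m') (x : E) : orderFun m x ≤ orderFun m' x :=
  Real.rpow_le_rpow_of_exponent_le (by simp) (by linarith)

theorem orderFun_add (m m' : ℝ) (x : E) : orderFun (m + m') x = orderFun m x * orderFun m' x := by
  rw [orderFun, add_div, Real.rpow_add (by positivity), orderFun, orderFun]

theorem tendsto_orderFun_cocompact [ProperSpace E] {m : ℝ} (hm : m < 0) :
    Tendsto (orderFun m : E → ℝ) (cocompact E) (𝓝 0) := by
  have h : Tendsto (fun x : E => 1 + ‖x‖ ^ 2) (cocompact E) atTop :=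
    tendsto_atTop_add_const_left _ _
      ((tendsto_pow_atTop two_ne_zero).comp tendsto_norm_cocompact_atTop)
  simpa only [neg_neg] using! (tendsto_rpow_neg_atTop (y := -(m / 2)) (by linarith)).comp h

theorem one_add_norm_sq_le (x y : E) :
    1 + ‖x‖ ^ 2 ≤ 2 * (1 + ‖y‖) ^ 2 * (1 + ‖x + y‖ ^ 2) := by
  have h : ‖x‖ ≤ ‖x + y‖ + ‖y‖ := by simpa using norm_sub_le (x + y) y
  have hsq : ‖x‖ ^ 2 ≤ 2 * (‖x + y‖ ^ 2 + ‖y‖ ^ 2) :=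
    (pow_le_pow_left₀ (norm_nonneg x) h 2).trans (add_sq_le)
  nlinarith [norm_nonneg y, mul_nonneg (norm_nonneg y) (sq_nonneg ‖x + y‖),
    mul_nonneg (sq_nonneg ‖y‖) (sq_nonneg ‖x + y‖)]

theorem exists_orderFun_add_le {m : ℝ} (hm : m ≤ 0) :
    ∃ (C : ℝ) (k : ℕ), 0 ≤ C ∧
      ∀ x y : E, orderFun m (x + y) ≤ C * (1 + ‖y‖) ^ k * orderFun m x := by
  refine ⟨2 ^ (-m / 2), ⌈-m⌉₊, by positivity, fun x y => ?_⟩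
  have hroot : ((1 + ‖y‖) ^ 2) ^ (-m / 2) ≤ (1 + ‖y‖) ^ ⌈-m⌉₊ := by
    rw [← Real.rpow_natCast, ← Real.rpow_natCast, ← Real.rpow_mul (by positivity)]
    refine Real.rpow_le_rpow_of_exponent_le (by simp) ?_
    push_cast
    linarith [Nat.le_ceil (-m)]
  have hxy : (2 * (1 + ‖y‖) ^ 2) ^ (m / 2) * orderFun m (x + y) ≤ orderFun m x := by
    rw [orderFun, ← Real.mul_rpow (by positivity) (by positivity)]
    exact Real.rpow_le_rpow_of_nonpos (by positivity) (one_add_norm_sq_le x y) (by linarith)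
  calc orderFun m (x + y)
      = (2 * (1 + ‖y‖) ^ 2) ^ (-m / 2) *
          ((2 * (1 + ‖y‖) ^ 2) ^ (m / 2) * orderFun m (x + y)) := by
        rw [← mul_assoc, ← Real.rpow_add (by positivity), neg_div, neg_add_cancel,
          Real.rpow_zero, one_mul]
    _ ≤ (2 * (1 + ‖y‖) ^ 2) ^ (-m / 2) * orderFun m x := by gcongr
    _ ≤ 2 ^ (-m / 2) * (1 + ‖y‖) ^ ⌈-m⌉₊ * orderFun m x := by
        rw [Real.mul_rpow two_pos.le (by positivity)]
        have := orderFun_pos m x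
        gcongr

theorem rpow_sq_half {r : ℝ} (hr : 0 ≤ r) (k : ℕ) : (r ^ 2) ^ ((k : ℝ) / 2) = r ^ k := by
  rw [← Real.rpow_natCast, ← Real.rpow_natCast, ← Real.rpow_mul hr]
  congr 1
  push_cast
  ring

theorem orderFun_neg (k : ℝ) (x : E) : orderFun (-k) x = (orderFun k x)⁻¹ := by
  rw [orderFun, neg_div, Real.rpow_neg (by positivity), orderFun]

theorem decay_le_orderFun (k : ℕ) (x : E) : decay k x ≤ orderFun (-k) x := by
  rw [decay, orderFun_neg, ← rpow_sq_half (by positivity)]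
  refine inv_anti₀ (orderFun_pos _ _) (Real.rpow_le_rpow (by positivity) ?_ (by positivity))
  nlinarith [norm_nonneg x]

theorem norm_pow_le_orderFun (k : ℕ) (x : E) : ‖x‖ ^ k ≤ orderFun k x := by
  rw [← rpow_sq_half (norm_nonneg x)]
  exact Real.rpow_le_rpow (by positivity) (by simp) (by positivity)

end OrderFunction

section PartialDerivatives

variable {E : Type*} [NormedAddCommGroup E] [InnerProductSpace ℝ E] [FiniteDimensional ℝ E]

/-- The derivative along the `i`-th vector of the standard orthonormal basis. -/
def partialDeriv (i : Fin (Module.finrank ℝ E)) (f : E → ℂ) (x : E) : ℂ :=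
  fderiv ℝ f x (stdOrthonormalBasis ℝ E i)

/-- The `i`-th coordinate in the standard orthonormal basis, as a complex-valued functional. -/
def coordFunctional (i : Fin (Module.finrank ℝ E)) : E →L[ℝ] ℂ :=
  Complex.ofRealCLM ∘L innerSL ℝ (stdOrthonormalBasis ℝ E i)

/-- The functions `A i` are the partial derivatives of the differentiable function `F`. -/
def HasPartialDerivs (F : E → ℂ) (A : Fin (Module.finrank ℝ E) → E → ℂ) : Prop :=
  ∀ x, HasFDerivAt F (∑ i, A i x • coordFunctional i) x

theorem norm_coordFunctional_le (i : Fin (Module.finrank ℝ E)) :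
    ‖coordFunctional (E := E) i‖ ≤ 1 := by
  refine ContinuousLinearMap.opNorm_le_bound _ zero_le_one fun x => ?_
  simpa [coordFunctional] using norm_inner_le_norm (𝕜 := ℝ) (stdOrthonormalBasis ℝ E i) x

theorem sum_smul_coordFunctional (D : E →L[ℝ] ℂ) :
    ∑ i, D (stdOrthonormalBasis ℝ E i) • coordFunctional i = D := by
  ext x
  conv_rhs => rw [← (stdOrthonormalBasis ℝ E).sum_repr x]
  simp [coordFunctional, OrthonormalBasis.repr_apply_apply, mul_comm]

theorem hasPartialDerivs_partialDeriv {f : E → ℂ} (hf : Differentiable ℝ f) :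
    HasPartialDerivs f fun i => partialDeriv i f := fun x =>
  (hf x).hasFDerivAt.congr_fderiv (sum_smul_coordFunctional _).symm

theorem contDiff_partialDeriv {f : E → ℂ} (hf : ContDiff ℝ ∞ f) (i) :
    ContDiff ℝ ∞ (partialDeriv i f) :=
  (hf.fderiv_right (m := ∞) le_rfl).clm_apply contDiff_const

theorem norm_iteratedFDeriv_partialDeriv_le {f : E → ℂ} (hf : ContDiff ℝ ∞ f) (i) (n : ℕ)
    (x : E) : ‖iteratedFDeriv ℝ n (partialDeriv i f) x‖ ≤ ‖iteratedFDeriv ℝ (n + 1) f x‖ := by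
  have hfd : ContDiff ℝ ∞ (fderiv ℝ f) := hf.fderiv_right (m := ∞) le_rfl
  have h := (ContinuousLinearMap.apply ℝ ℂ
    (stdOrthonormalBasis ℝ E i)).norm_iteratedFDeriv_comp_left
      (hfd.contDiffAt (x := x)) (n := n) (by exact_mod_cast le_top)
  rw [norm_iteratedFDeriv_fderiv] at h
  refine h.trans (mul_le_of_le_one_left (norm_nonneg _) ?_)
  refine ContinuousLinearMap.opNorm_le_bound _ zero_le_one fun D => ?_
  simpa using D.le_opNorm (stdOrthonormalBasis ℝ E i)

namespace HasPartialDerivs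

variable {F : E → ℂ} {A : Fin (Module.finrank ℝ E) → E → ℂ}

theorem continuous (hF : HasPartialDerivs F A) : Continuous F :=
  continuous_iff_continuousAt.2 fun x => (hF x).continuousAt

theorem contDiff_succ (hF : HasPartialDerivs F A) {n : ℕ} (hA : ∀ i, ContDiff ℝ n (A i)) :
    ContDiff ℝ (n + 1) F :=
  contDiff_succ_iff_hasFDerivAt.2
    ⟨_, ContDiff.sum fun i _ => (hA i).smul contDiff_const, hF⟩

theorem norm_iteratedFDeriv_succ_le (hF : HasPartialDerivs F A) {n : ℕ}
    (hA : ∀ i, ContDiff ℝ n (A i)) (x : E) :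
    ‖iteratedFDeriv ℝ (n + 1) F x‖ ≤ ∑ i, ‖iteratedFDeriv ℝ n (A i) x‖ := by
  have hfd : fderiv ℝ F = fun x => ∑ i, A i x • coordFunctional i := funext fun x => (hF x).fderiv
  have hsm (i) : ContDiff ℝ n (fun x => A i x • coordFunctional (E := E) i) :=
    (hA i).smul contDiff_const
  rw [← norm_iteratedFDeriv_fderiv, hfd, iteratedFDeriv_fun_sum_apply fun i _ => (hsm i).contDiffAt]
  refine (norm_sum_le _ _).trans (Finset.sum_le_sum fun i _ => ?_)
  have h := ((ContinuousLinearMap.id ℝ ℂ).smulRight (coordFunctional (E := E) i) :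
    ℂ →L[ℝ] E →L[ℝ] ℂ).norm_iteratedFDeriv_comp_left
      ((hA i).contDiffAt (x := x)) (n := n) le_rfl
  refine h.trans (mul_le_of_le_one_left (norm_nonneg _) ?_)
  refine ContinuousLinearMap.opNorm_le_bound _ zero_le_one fun a => ?_
  rw [ContinuousLinearMap.smulRight_apply, norm_smul, one_mul]
  exact mul_le_of_le_one_right (norm_nonneg _) (norm_coordFunctional_le i)

theorem integral {X : Type*} [MeasurableSpace X] {μ : Measure X} {F : X → E → ℂ}
    {A : X → Fin (Module.finrank ℝ E) → E → ℂ} {bound : Fin (Module.finrank ℝ E) → X → ℝ}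
    (hF : ∀ q, HasPartialDerivs (F q) (A q)) (hFi : ∀ x, Integrable (fun q => F q x) μ)
    (hAm : ∀ i x, AEStronglyMeasurable (fun q => A q i x) μ) (hb : ∀ i, Integrable (bound i) μ)
    (hA : ∀ q i x, ‖A q i x‖ ≤ bound i q) :
    HasPartialDerivs (fun x => ∫ q, F q x ∂μ) fun i x => ∫ q, A q i x ∂μ := by
  intro x
  have hAi (i) : Integrable (fun q => A q i x) μ :=
    (hb i).mono' (hAm i x) (Eventually.of_forall fun q => hA q i x)
  have h := hasFDerivAt_integral_of_dominated_of_fderiv_le (𝕜 := ℝ) (μ := μ)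
    (F := fun x q => F q x) (F' := fun x q => ∑ i, A q i x • coordFunctional i) (x₀ := x)
    (bound := fun q => ∑ i, bound i q) Filter.univ_mem
    (Eventually.of_forall fun x => (hFi x).aestronglyMeasurable) (hFi x)
    (Finset.aestronglyMeasurable_fun_sum _ fun i _ => (hAm i x).smul aestronglyMeasurable_const)
    (Eventually.of_forall fun q x _ => (norm_sum_le _ _).trans (Finset.sum_le_sum fun i _ => by
      rw [norm_smul]
      exact (mul_le_of_le_one_right (norm_nonneg _) (norm_coordFunctional_le i)).trans (hA q i x)))
    (integrable_finsetSum _ fun i _ => hb i) (Eventually.of_forall fun q x _ => hF q x)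
  refine h.congr_fderiv ?_
  rw [integral_finsetSum _ fun i _ => (hAi i).smul_const _]
  exact Finset.sum_congr rfl fun i _ => integral_smul_const _ _

end HasPartialDerivs
end PartialDerivatives

section SymbolClasses

variable {E : Type*} [NormedAddCommGroup E] [NormedSpace ℝ E] {m m' ρ : ℝ} {f g : E → ℂ}

theorem norm_iteratedFDeriv_const_mul (hf : ContDiff ℝ ∞ f) (a : ℂ) (n : ℕ) (x : E) :
    ‖iteratedFDeriv ℝ n (fun x => a * f x) x‖ = ‖a‖ * ‖iteratedFDeriv ℝ n f x‖ := by
  rw [← norm_smul, ← iteratedFDeriv_const_smul_apply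
    (hf.of_le (by exact_mod_cast le_top)).contDiffAt]
  rfl

theorem norm_iteratedFDeriv_add_le (hf : ContDiff ℝ ∞ f) (hg : ContDiff ℝ ∞ g) (n : ℕ) (x : E) :
    ‖iteratedFDeriv ℝ n (fun x => f x + g x) x‖ ≤
      ‖iteratedFDeriv ℝ n f x‖ + ‖iteratedFDeriv ℝ n g x‖ :=
  (congrArg norm (iteratedFDeriv_add_apply (hf.of_le (by exact_mod_cast le_top)).contDiffAt
    (hg.of_le (by exact_mod_cast le_top)).contDiffAt)).trans_le (norm_add_le _ _)

/-- The symbols of order `m` and type `ρ`: each derivative lowers the order by `ρ`. -/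
def IsSymbol (m ρ : ℝ) (f : E → ℂ) : Prop :=
  ContDiff ℝ ∞ f ∧
    ∀ n : ℕ, ∃ C : ℝ, ∀ x, ‖iteratedFDeriv ℝ n f x‖ ≤ C * orderFun (m - ρ * n) x

/-- The smooth functions that vanish at infinity together with all their derivatives. -/
def VanishesAtInfinity (f : E → ℂ) : Prop :=
  ContDiff ℝ ∞ f ∧ ∀ n : ℕ, Tendsto (fun x => ‖iteratedFDeriv ℝ n f x‖) (cocompact E) (𝓝 0)

namespace IsSymbol

theorem exists_norm_le (hf : IsSymbol m ρ f) (n : ℕ) :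
    ∃ C : ℝ, 0 ≤ C ∧ ∀ x, ‖iteratedFDeriv ℝ n f x‖ ≤ C * orderFun (m - ρ * n) x := by
  obtain ⟨C, hC⟩ := hf.2 n
  exact ⟨C, nonneg_of_mul_nonneg_left ((norm_nonneg _).trans (hC 0)) (orderFun_pos _ 0), hC⟩

theorem mono {ρ' : ℝ} (hf : IsSymbol m ρ f) (h : ∀ n : ℕ, m - ρ * n ≤ m' - ρ' * n) :
    IsSymbol m' ρ' f := by
  refine ⟨hf.1, fun n => ?_⟩
  obtain ⟨C, hC0, hC⟩ := hf.exists_norm_le n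
  exact ⟨C, fun x => (hC x).trans (mul_le_mul_of_nonneg_left (orderFun_le_orderFun (h n) x) hC0)⟩

theorem type_zero (hf : IsSymbol m ρ f) (hρ : 0 ≤ ρ) : IsSymbol m 0 f :=
  hf.mono fun n => by nlinarith [mul_nonneg hρ n.cast_nonneg]

theorem order_zero (hf : IsSymbol m ρ f) (hm : m ≤ 0) (hρ : 0 ≤ ρ) : IsSymbol 0 0 f :=
  hf.mono fun n => by nlinarith [mul_nonneg hρ n.cast_nonneg]

theorem exists_bound (hf : IsSymbol 0 0 f) : ∃ B : ℝ, ∀ x, ‖f x‖ ≤ B := by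
  obtain ⟨B, hB⟩ := hf.2 0
  exact ⟨B, fun x => by simpa using hB x⟩

theorem const_mul (hf : IsSymbol m ρ f) (a : ℂ) : IsSymbol m ρ fun x => a * f x := by
  refine ⟨contDiff_const.mul hf.1, fun n => ?_⟩
  obtain ⟨C, hC⟩ := hf.2 n
  refine ⟨‖a‖ * C, fun x => ?_⟩
  rw [norm_iteratedFDeriv_const_mul hf.1, mul_assoc]
  exact mul_le_mul_of_nonneg_left (hC x) (norm_nonneg a)

theorem add (hf : IsSymbol m ρ f) (hg : IsSymbol m ρ g) : IsSymbol m ρ fun x => f x + g x := by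
  refine ⟨hf.1.add hg.1, fun n => ?_⟩
  obtain ⟨C, hC⟩ := hf.2 n
  obtain ⟨C', hC'⟩ := hg.2 n
  refine ⟨C + C', fun x => (norm_iteratedFDeriv_add_le hf.1 hg.1 n x).trans ?_⟩
  rw [add_mul]
  exact add_le_add (hC x) (hC' x)

theorem partialDeriv {E : Type*} [NormedAddCommGroup E] [InnerProductSpace ℝ E]
    [FiniteDimensional ℝ E] {f : E → ℂ} (hf : IsSymbol m ρ f) (i) :
    IsSymbol (m - ρ) ρ (partialDeriv i f) := by
  refine ⟨contDiff_partialDeriv hf.1 i, fun n => ?_⟩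
  obtain ⟨C, hC⟩ := hf.2 (n + 1)
  refine ⟨C, fun x => (norm_iteratedFDeriv_partialDeriv_le hf.1 i n x).trans ((hC x).trans_eq ?_)⟩
  push_cast
  ring_nf

theorem vanishesAtInfinity [ProperSpace E] (hf : IsSymbol m ρ f) (hm : m < 0) (hρ : 0 ≤ ρ) :
    VanishesAtInfinity f := by
  refine ⟨hf.1, fun n => ?_⟩
  obtain ⟨C, hC⟩ := (hf.type_zero hρ).2 n
  refine squeeze_zero (fun _ => norm_nonneg _) hC ?_
  simpa using (tendsto_orderFun_cocompact (E := E) hm).const_mul C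

end IsSymbol

namespace VanishesAtInfinity

theorem tendsto (hf : VanishesAtInfinity f) : Tendsto f (cocompact E) (𝓝 0) := by
  simpa using tendsto_zero_iff_norm_tendsto_zero.2 (by simpa using hf.2 0)

theorem isSymbol (hf : VanishesAtInfinity f) : IsSymbol 0 0 f := by
  refine ⟨hf.1, fun n => ?_⟩
  have hc := hf.1.continuous_iteratedFDeriv (m := n) (by exact_mod_cast le_top)
  obtain ⟨K, hK, hKs⟩ := mem_cocompact.1 ((hf.2 n).eventually (gt_mem_nhds one_pos))
  obtain ⟨C, hC⟩ := hK.exists_bound_of_continuousOn hc.continuousOn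
  refine ⟨max C 1, fun x => ?_⟩
  rw [zero_mul, sub_zero, orderFun_zero, mul_one]
  by_cases hx : x ∈ K
  · exact (hC x hx).trans (le_max_left _ _)
  · exact (hKs hx).le.trans (le_max_right _ _)

theorem const_mul (hf : VanishesAtInfinity f) (a : ℂ) : VanishesAtInfinity fun x => a * f x := by
  refine ⟨contDiff_const.mul hf.1, fun n => ?_⟩
  simpa only [norm_iteratedFDeriv_const_mul hf.1, mul_zero] using (hf.2 n).const_mul ‖a‖

theorem add (hf : VanishesAtInfinity f) (hg : VanishesAtInfinity g) :
    VanishesAtInfinity fun x => f x + g x :=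
  ⟨hf.1.add hg.1, fun n => squeeze_zero (fun _ => norm_nonneg _)
    (norm_iteratedFDeriv_add_le hf.1 hg.1 n) (by simpa using (hf.2 n).add (hg.2 n))⟩

theorem partialDeriv {E : Type*} [NormedAddCommGroup E] [InnerProductSpace ℝ E]
    [FiniteDimensional ℝ E] {f : E → ℂ} (hf : VanishesAtInfinity f) (i) :
    VanishesAtInfinity (partialDeriv i f) :=
  ⟨contDiff_partialDeriv hf.1 i, fun n => squeeze_zero (fun _ => norm_nonneg _)
    (norm_iteratedFDeriv_partialDeriv_le hf.1 i n) (hf.2 (n + 1))⟩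

end VanishesAtInfinity

theorem isSymbol_schwartz (f : 𝓢(E, ℂ)) (m ρ : ℝ) : IsSymbol m ρ f := by
  refine ⟨f.smooth', fun n => ?_⟩
  obtain ⟨k, hk⟩ := exists_nat_ge (-(m - ρ * n))
  obtain ⟨C, hC0, hC⟩ := exists_norm_iteratedFDeriv_le_decay f k n
  refine ⟨C, fun x => (hC n le_rfl x).trans (mul_le_mul_of_nonneg_left ?_ hC0)⟩
  exact (decay_le_orderFun k x).trans (orderFun_le_orderFun (by linarith) x)

theorem exists_schwartz_eq_iff :
    (∃ F : 𝓢(E, ℂ), (F : E → ℂ) = f) ↔ ∀ k : ℕ, IsSymbol (-k) 0 f := by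
  refine ⟨?_, fun hf => ⟨⟨f, (hf 0).1, fun k n => ?_⟩, rfl⟩⟩
  · rintro ⟨F, rfl⟩ k
    exact isSymbol_schwartz F _ _
  obtain ⟨C, -, hC⟩ := (hf k).exists_norm_le n
  refine ⟨C, fun x => ?_⟩
  have hk := orderFun_pos (k : ℝ) x
  calc ‖x‖ ^ k * ‖iteratedFDeriv ℝ n f x‖ ≤ orderFun k x * (C * orderFun (-k - 0 * n) x) := by
        gcongr
        · exact norm_pow_le_orderFun k x
        · exact hC x
    _ = C := by
        rw [zero_mul, sub_zero, orderFun_neg, mul_left_comm, mul_inv_cancel₀ hk.ne', mul_one]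

end SymbolClasses

section WindowedFourier

theorem exists_decay_comp_le {E F : Type*} [NormedAddCommGroup E] [NormedSpace ℝ E]
    [FiniteDimensional ℝ E] [NormedAddCommGroup F] [NormedSpace ℝ F] {ℓ : E →L[ℝ] F}
    (hℓ : Function.Injective ℓ) (N : ℕ) :
    ∃ C : ℝ, 0 ≤ C ∧ ∀ x, decay N (ℓ x) ≤ C * decay N x := by
  obtain ⟨K, -, hK⟩ := LinearMap.exists_antilipschitzWith (ℓ : E →ₗ[ℝ] F)
    (LinearMap.ker_eq_bot.2 hℓ)
  refine ⟨(K + 1) ^ N, by positivity, fun x => ?_⟩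
  have hx : ‖x‖ ≤ K * ‖ℓ x‖ := by simpa using hK.le_mul_dist x 0
  unfold decay
  rw [← div_eq_mul_inv, le_div_iff₀ (by positivity), ← inv_pow, ← mul_pow]
  refine pow_le_pow_left₀ (by positivity) ?_ N
  rw [inv_mul_le_iff₀ (by positivity)]
  nlinarith [norm_nonneg (ℓ x), K.coe_nonneg]

theorem one_add_norm_pow_mul_decay {E : Type*} [NormedAddCommGroup E] (k N : ℕ) (y : E) :
    (1 + ‖y‖) ^ k * decay (k + N) y = decay N y := by
  rw [decay_add, ← mul_assoc, decay, mul_inv_cancel₀ (by positivity), one_mul]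

theorem IsSymbol.exists_norm_iteratedFDeriv_le {E : Type*} [NormedAddCommGroup E]
    [NormedSpace ℝ E] {f : E → ℂ} {m : ℝ} (hf : IsSymbol m 0 f) (N : ℕ) :
    ∃ C : ℝ, 0 ≤ C ∧ ∀ j ≤ N, ∀ x, ‖iteratedFDeriv ℝ j f x‖ ≤ C * orderFun m x := by
  choose C hC0 hC using hf.exists_norm_le
  simp only [zero_mul, sub_zero] at hC
  refine ⟨∑ i ∈ Finset.range (N + 1), C i, Finset.sum_nonneg fun i _ => hC0 i,
    fun j hj x => (hC j x).trans (mul_le_mul_of_nonneg_right ?_ (orderFun_pos m x).le)⟩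
  exact Finset.single_le_sum (fun i _ => hC0 i) (Finset.mem_range.2 (Nat.lt_succ_of_le hj))

theorem tendsto_comp_add_right_cocompact {E : Type*} [NormedAddCommGroup E] {u : E → ℝ}
    (hu : Tendsto u (cocompact E) (𝓝 0)) (y : E) :
    Tendsto (fun c => u (c + y)) (cocompact E) (𝓝 0) :=
  hu.comp (Homeomorph.addRight y).isClosedEmbedding.tendsto_cocompact

instance {E : Type*} [NormedAddCommGroup E] [ProperSpace E] :
    (cocompact E).IsCountablyGenerated := by
  rw [← Metric.cobounded_eq_cocompact, ← comap_norm_atTop]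
  infer_instance

variable {E : Type*} [NormedAddCommGroup E] [InnerProductSpace ℝ E]

theorem exists_norm_iteratedFDeriv_translate_mul_le {f : E → ℂ} {m : ℝ} (hm : m ≤ 0)
    (hf : IsSymbol m 0 f) (Φ : 𝓢(E, ℂ)) (k N : ℕ) :
    ∃ C : ℝ, 0 ≤ C ∧ ∀ c, ∀ j ≤ N, ∀ y,
      ‖iteratedFDeriv ℝ j (fun y => f (c + y) * Φ y) y‖ ≤ C * orderFun m c * decay k y := by
  obtain ⟨Cf, hCf0, hCf⟩ := hf.exists_norm_iteratedFDeriv_le N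
  obtain ⟨Cw, l, hCw0, hCw⟩ := exists_orderFun_add_le (E := E) hm
  obtain ⟨CΦ, hCΦ0, hCΦ⟩ := exists_norm_iteratedFDeriv_le_decay Φ (l + k) N
  refine ⟨2 ^ N * (Cf * Cw * CΦ), by positivity, fun c j hj y => ?_⟩
  have hw := (orderFun_pos m c).le
  have hd := decay_nonneg k y
  have hterm (i : ℕ) (hi : i ∈ Finset.range (j + 1)) :
      (j.choose i : ℝ) * ‖iteratedFDeriv ℝ i (fun y => f (c + y)) y‖ *
        ‖iteratedFDeriv ℝ (j - i) Φ y‖ ≤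
      (j.choose i : ℝ) * (Cf * Cw * CΦ * orderFun m c * decay k y) := by
    rw [iteratedFDeriv_comp_add_left, mul_assoc]
    have hi' : i ≤ N := (Nat.lt_succ_iff.1 (Finset.mem_range.1 hi)).trans hj
    refine mul_le_mul_of_nonneg_left ?_ (by positivity)
    calc ‖iteratedFDeriv ℝ i f (c + y)‖ * ‖iteratedFDeriv ℝ (j - i) Φ y‖
        ≤ (Cf * (Cw * (1 + ‖y‖) ^ l * orderFun m c)) * (CΦ * decay (l + k) y) := by
          gcongr
          · exact (hCf i hi' _).trans (mul_le_mul_of_nonneg_left (hCw c y) hCf0)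
          · exact hCΦ _ ((Nat.sub_le j i).trans hj) y
      _ = Cf * Cw * CΦ * orderFun m c * decay k y := by
          rw [← one_add_norm_pow_mul_decay l k y]; ring
  have hmul := norm_iteratedFDeriv_mul_le (𝕜 := ℝ) (f := fun y => f (c + y)) (g := Φ)
    (N := j) ((hf.1.of_le (by exact_mod_cast le_top)).comp (contDiff_const.add contDiff_id))
    (Φ.smooth j) y (n := j) le_rfl
  calc _ ≤ _ := hmul
    _ ≤ ∑ i ∈ Finset.range (j + 1), (j.choose i : ℝ) *
          (Cf * Cw * CΦ * orderFun m c * decay k y) := Finset.sum_le_sum hterm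
    _ = 2 ^ j * (Cf * Cw * CΦ * orderFun m c * decay k y) := by
        rw [← Finset.sum_mul, ← Nat.cast_sum, Nat.sum_range_choose, Nat.cast_pow, Nat.cast_ofNat]
    _ ≤ 2 ^ N * (Cf * Cw * CΦ * orderFun m c * decay k y) := by gcongr; norm_num
    _ = 2 ^ N * (Cf * Cw * CΦ) * orderFun m c * decay k y := by ring

variable [MeasurableSpace E] [BorelSpace E] [FiniteDimensional ℝ E]
  (σ : E →L[ℝ] E →L[ℝ] ℝ) (Φ : 𝓢(E, ℂ)) {f : E → ℂ}

/-- The Fourier transform of `f`, seen through the window `Φ` at the point `c`, at the frequency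
`σ(·, d)`. -/
def windowedFourier (f : E → ℂ) (c d : E) : ℂ := ∫ y, f (c + y) * phase (σ y d) * Φ y

/-- The average of `|f|` over the window `|Φ|` at the point `c`. -/
def windowAverage (f : E → ℂ) (c : E) : ℝ := ∫ y, ‖f (c + y)‖ * ‖Φ y‖

theorem norm_windowedFourier_le_windowAverage (c d : E) :
    ‖windowedFourier σ Φ f c d‖ ≤ windowAverage Φ f c := by
  refine (norm_integral_le_integral_norm _).trans_eq ?_
  simp only [norm_mul, norm_phase, mul_one, windowAverage]

theorem windowAverage_nonneg (c : E) : 0 ≤ windowAverage Φ f c :=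
  integral_nonneg fun y => by positivity

variable {σ Φ} in
theorem exists_norm_windowedFourier_le (hσ : Function.Injective σ.flip) {m : ℝ} (hm : m ≤ 0)
    (hf : IsSymbol m 0 f) (N : ℕ) :
    ∃ C : ℝ, 0 ≤ C ∧ ∀ c d, ‖windowedFourier σ Φ f c d‖ ≤ C * (orderFun m c * decay N d) := by
  obtain ⟨C, hC0, hC⟩ := exists_norm_integral_phase_mul_le (E := E) N
  obtain ⟨B, hB0, hB⟩ :=
    exists_norm_iteratedFDeriv_translate_mul_le hm hf Φ (Module.finrank ℝ E + 1) N
  obtain ⟨D, hD0, hD⟩ := exists_decay_comp_le hσ N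
  refine ⟨C * B * D, by positivity, fun c d => ?_⟩
  have hsmooth : ContDiff ℝ N fun y => f (c + y) * Φ y :=
    ((hf.1.of_le (by exact_mod_cast le_top)).comp (contDiff_const.add contDiff_id)).mul (Φ.smooth N)
  have hw := (orderFun_pos m c).le
  have h : windowedFourier σ Φ f c d = ∫ y, phase (σ.flip d y) * (f (c + y) * Φ y) := by
    refine integral_congr_ae (Eventually.of_forall fun y => ?_)
    simp only [ContinuousLinearMap.flip_apply]
    ring
  calc ‖windowedFourier σ Φ f c d‖ ≤ C * (B * orderFun m c) * decay N (σ.flip d) :=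
        h ▸ hC _ _ hsmooth (fun j hj y => hB c j hj y) (σ.flip d)
    _ ≤ C * (B * orderFun m c) * (D * decay N d) := by gcongr; exact hD d
    _ = C * B * D * (orderFun m c * decay N d) := by ring

theorem integrable_translate_mul {f : E → ℂ} (hf : Continuous f) {B : ℝ} (hB : ∀ x, ‖f x‖ ≤ B)
    (c d : E) : Integrable fun y => f (c + y) * phase (σ y d) * Φ y := by
  have hσ := σ.continuous₂
  have hΦ := Φ.continuous
  refine (Φ.integrable.norm.const_mul B).mono' (Continuous.aestronglyMeasurable (by fun_prop))
    (Eventually.of_forall fun y => ?_)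
  rw [norm_mul, norm_mul, norm_phase, mul_one]
  exact mul_le_mul_of_nonneg_right (hB _) (norm_nonneg _)

variable {σ Φ}

theorem continuous_windowedFourier (hf : IsSymbol 0 0 f) :
    Continuous fun p : E × E => windowedFourier σ Φ f p.1 p.2 := by
  obtain ⟨B, hB⟩ := hf.exists_bound
  have hfc := hf.1.continuous
  refine continuous_of_dominated (bound := fun y => B * ‖Φ y‖)
    (fun p => (integrable_translate_mul σ Φ hfc hB p.1 p.2).aestronglyMeasurable)
    (fun p => Eventually.of_forall fun y => ?_) (Φ.integrable.norm.const_mul B)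
    (Eventually.of_forall fun y => by fun_prop)
  rw [norm_mul, norm_mul, norm_phase, mul_one]
  exact mul_le_mul_of_nonneg_right (hB _) (norm_nonneg _)

theorem hasPartialDerivs_windowedFourier (hf : IsSymbol 0 0 f) (d : E) :
    HasPartialDerivs (fun c => windowedFourier σ Φ f c d)
      fun i c => windowedFourier σ Φ (partialDeriv i f) c d := by
  have hpartial (i) : IsSymbol 0 0 (partialDeriv i f) := by simpa using hf.partialDeriv i
  obtain ⟨B, hB⟩ := hf.exists_bound
  choose B' hB' using fun i => (hpartial i).exists_bound
  refine HasPartialDerivs.integral (bound := fun i y => B' i * ‖Φ y‖) (fun y c => ?_)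
    (fun c => integrable_translate_mul σ Φ hf.1.continuous hB c d)
    (fun i c => (integrable_translate_mul σ Φ (hpartial i).1.continuous (hB' i) c
      d).aestronglyMeasurable) (fun i => Φ.integrable.norm.const_mul (B' i)) fun y i c => ?_
  · have h := (hasFDerivAt_comp_add_right y).2
      (hasPartialDerivs_partialDeriv (hf.1.differentiable (by simp)) (c + y))
    refine ((h.mul_const (phase (σ y d))).mul_const (Φ y)).congr_fderiv ?_
    simp only [Finset.smul_sum, smul_smul]
    exact Finset.sum_congr rfl fun i _ => by congr 1; ring
  · rw [norm_mul, norm_mul, norm_phase, mul_one]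
    exact mul_le_mul_of_nonneg_right (hB' i _) (norm_nonneg _)

theorem tendsto_windowAverage (hf : VanishesAtInfinity f) :
    Tendsto (windowAverage Φ f) (cocompact E) (𝓝 0) := by
  obtain ⟨B, hB⟩ := hf.isSymbol.exists_bound
  have hfc := hf.1.continuous
  have hΦ := Φ.continuous
  rw [← integral_zero E ℝ]
  refine tendsto_integral_filter_of_dominated_convergence (fun y => B * ‖Φ y‖)
    (Eventually.of_forall fun c => Continuous.aestronglyMeasurable (by fun_prop))
    (Eventually.of_forall fun c => Eventually.of_forall fun y => ?_)
    (Φ.integrable.norm.const_mul B) (Eventually.of_forall fun y => ?_)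
  · rw [norm_mul, norm_norm, norm_norm]
    exact mul_le_mul_of_nonneg_right (hB _) (norm_nonneg _)
  · simpa using (tendsto_comp_add_right_cocompact
      (u := fun c => ‖f c‖) (by simpa using hf.tendsto.norm) y).mul_const ‖Φ y‖

end WindowedFourier

section Moyal

variable {E : Type*} [NormedAddCommGroup E] [InnerProductSpace ℝ E] [FiniteDimensional ℝ E]
  [MeasurableSpace E] [BorelSpace E] (σ : E →L[ℝ] E →L[ℝ] ℝ) (Φ : 𝓢(E, ℂ)) (f g : E → ℂ)

/-- The integrand of the Moyal product, in the variables `((c, d), e)`: for the symbols of two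
operators, `c` and `d` are the midpoint and the difference of the outer coherent states of the
composite, and `e` is the difference of the coherent states of the left factor. -/
def moyalIntegrand (x : E) (q : (E × E) × E) : ℂ :=
  phase (σ q.1.1 q.1.2 - σ q.2 q.1.2 / 2) * Φ q.1.1 *
    (windowedFourier σ Φ f (x + (q.1.1 + (2⁻¹ : ℝ) • (q.1.2 - q.2))) q.2 *
      windowedFourier σ Φ g (x + (q.1.1 - (2⁻¹ : ℝ) • q.2)) (q.1.2 - q.2))

/-- The Moyal product, up to normalization: the symbol of a product of operators as a function of
the symbols of the factors. -/
def moyal (x : E) : ℂ := ∫ q : (E × E) × E, moyalIntegrand σ Φ f g x q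

/-- An integrable function dominating `moyalIntegrand`. -/
def moyalBound (q : (E × E) × E) : ℝ :=
  decay (Module.finrank ℝ E + 1) q.1.1 * decay (Module.finrank ℝ E + 1) q.1.2 *
    decay (Module.finrank ℝ E + 1) q.2

theorem integrable_moyalBound : Integrable (moyalBound (E := E)) := by
  have h : Integrable (decay (Module.finrank ℝ E + 1) : E → ℝ) := integrable_decay
  exact (h.mul_prod h).mul_prod h

variable {σ Φ f g}

theorem exists_norm_windowedFourier_translate_le (hσ : Function.Injective σ.flip) {m : ℝ}
    (hm : m ≤ 0) (hf : IsSymbol m 0 f) :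
    ∃ k : ℕ, ∀ N : ℕ, ∃ C : ℝ, 0 ≤ C ∧ ∀ x c u d : E,
      ‖windowedFourier σ Φ f (x + (c + (2⁻¹ : ℝ) • u)) d‖ ≤
        C * orderFun m x * (((1 + ‖c‖) * (1 + ‖u‖)) ^ k * decay N d) := by
  obtain ⟨W, k, hW0, hW⟩ := exists_orderFun_add_le (E := E) hm
  refine ⟨k, fun N => ?_⟩
  obtain ⟨C, hC0, hC⟩ := exists_norm_windowedFourier_le hσ (Φ := Φ) hm hf N
  refine ⟨C * W, by positivity, fun x c u d => (hC _ d).trans ?_⟩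
  have hhalf : 1 + ‖(2⁻¹ : ℝ) • u‖ ≤ 1 + ‖u‖ := by
    rw [norm_smul]
    norm_num
    linarith [norm_nonneg u]
  have hshift : 1 + ‖c + (2⁻¹ : ℝ) • u‖ ≤ (1 + ‖c‖) * (1 + ‖u‖) :=
    (one_add_norm_add_le c _).trans (mul_le_mul_of_nonneg_left hhalf (by positivity))
  have hx := (orderFun_pos m x).le
  have hd := decay_nonneg N d
  calc C * (orderFun m (x + (c + (2⁻¹ : ℝ) • u)) * decay N d)
      ≤ C * (W * (1 + ‖c + (2⁻¹ : ℝ) • u‖) ^ k * orderFun m x * decay N d) := by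
        gcongr
        exact hW x _
    _ ≤ C * (W * ((1 + ‖c‖) * (1 + ‖u‖)) ^ k * orderFun m x * decay N d) := by gcongr
    _ = C * W * orderFun m x * (((1 + ‖c‖) * (1 + ‖u‖)) ^ k * decay N d) := by ring

theorem decay_double_mul_decay_double_le {F : Type*} [NormedAddCommGroup F] (s : ℕ) (d e : F) :
    decay (s + s) e * decay (s + s) (d - e) ≤ decay s d * decay s e := by
  have h : decay s e * decay s (d - e) ≤ decay s d := by
    simpa using decay_mul_decay_le s e (d - e)
  have he := decay_nonneg s e
  have hd := decay_nonneg s d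
  have := decay_nonneg s (d - e)
  rw [decay_add, decay_add]
  calc decay s e * decay s e * (decay s (d - e) * decay s (d - e))
      = (decay s e * decay s (d - e)) * (decay s e * decay s (d - e)) := by ring
    _ ≤ decay s d * (decay s e * 1) := by
        gcongr
        exact decay_le_one s _
    _ = decay s d * decay s e := by ring

theorem decay_mul_weights_le {F : Type*} [NormedAddCommGroup F] (k₁ k₂ s : ℕ) (c d e : F) :
    decay (k₁ + (k₂ + s)) c *
        ((((1 + ‖c‖) * (1 + ‖d - e‖)) ^ k₁ * decay (k₂ + (s + s)) e) *
          (((1 + ‖c‖) * (1 + ‖e‖)) ^ k₂ * decay (k₁ + (s + s)) (d - e))) ≤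
      decay s c * decay s d * decay s e := by
  calc _ = ((1 + ‖c‖) ^ k₂ * ((1 + ‖c‖) ^ k₁ * decay (k₁ + (k₂ + s)) c)) *
          (((1 + ‖e‖) ^ k₂ * decay (k₂ + (s + s)) e) *
            ((1 + ‖d - e‖) ^ k₁ * decay (k₁ + (s + s)) (d - e))) := by
        rw [mul_pow, mul_pow]; ring
    _ = decay s c * (decay (s + s) e * decay (s + s) (d - e)) := by
        simp only [one_add_norm_pow_mul_decay]
    _ ≤ decay s c * (decay s d * decay s e) :=
        mul_le_mul_of_nonneg_left (decay_double_mul_decay_double_le s d e) (decay_nonneg s c)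
    _ = decay s c * decay s d * decay s e := by ring

theorem exists_norm_moyalIntegrand_le (hσ : Function.Injective σ.flip) {m₁ m₂ : ℝ}
    (hm₁ : m₁ ≤ 0) (hm₂ : m₂ ≤ 0) (hf : IsSymbol m₁ 0 f) (hg : IsSymbol m₂ 0 g) :
    ∃ C : ℝ, 0 ≤ C ∧ ∀ x q,
      ‖moyalIntegrand σ Φ f g x q‖ ≤ C * orderFun (m₁ + m₂) x * moyalBound q := by
  set s := Module.finrank ℝ E + 1 with hs
  obtain ⟨k₁, h₁⟩ := exists_norm_windowedFourier_translate_le (Φ := Φ) hσ hm₁ hf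
  obtain ⟨k₂, h₂⟩ := exists_norm_windowedFourier_translate_le (Φ := Φ) hσ hm₂ hg
  obtain ⟨C₁, hC₁0, hC₁⟩ := h₁ (k₂ + (s + s))
  obtain ⟨C₂, hC₂0, hC₂⟩ := h₂ (k₁ + (s + s))
  obtain ⟨C₀, hC₀0, hC₀⟩ := exists_norm_le_decay Φ (k₁ + (k₂ + s))
  refine ⟨C₀ * C₁ * C₂, by positivity, ?_⟩
  rintro x ⟨⟨c, d⟩, e⟩
  have hw₁ := (orderFun_pos m₁ x).le
  have hw₂ := (orderFun_pos m₂ x).le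
  have hc := decay_nonneg (k₁ + (k₂ + s)) c
  have he := decay_nonneg (k₂ + (s + s)) e
  have := decay_nonneg (k₁ + (s + s)) (d - e)
  have hgx : ‖windowedFourier σ Φ g (x + (c - (2⁻¹ : ℝ) • e)) (d - e)‖ ≤
      C₂ * orderFun m₂ x * (((1 + ‖c‖) * (1 + ‖e‖)) ^ k₂ * decay (k₁ + (s + s)) (d - e)) := by
    simpa only [smul_neg, ← sub_eq_add_neg, norm_neg] using hC₂ x c (-e) (d - e)
  simp only [moyalIntegrand, moyalBound, ← hs]
  rw [norm_mul, norm_mul, norm_mul, norm_phase, one_mul, orderFun_add]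
  calc _ ≤ C₀ * decay (k₁ + (k₂ + s)) c *
        ((C₁ * orderFun m₁ x * (((1 + ‖c‖) * (1 + ‖d - e‖)) ^ k₁ * decay (k₂ + (s + s)) e)) *
        (C₂ * orderFun m₂ x *
          (((1 + ‖c‖) * (1 + ‖e‖)) ^ k₂ * decay (k₁ + (s + s)) (d - e)))) := by
        gcongr
        · exact hC₀ c
        · exact hC₁ x c (d - e) e
    _ = C₀ * C₁ * C₂ * (orderFun m₁ x * orderFun m₂ x) * (decay (k₁ + (k₂ + s)) c *
        ((((1 + ‖c‖) * (1 + ‖d - e‖)) ^ k₁ * decay (k₂ + (s + s)) e) *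
          (((1 + ‖c‖) * (1 + ‖e‖)) ^ k₂ * decay (k₁ + (s + s)) (d - e)))) := by ring
    _ ≤ C₀ * C₁ * C₂ * (orderFun m₁ x * orderFun m₂ x) * (decay s c * decay s d * decay s e) :=
        mul_le_mul_of_nonneg_left (decay_mul_weights_le k₁ k₂ s c d e) (by positivity)

theorem continuous_moyalIntegrand (hf : IsSymbol 0 0 f) (hg : IsSymbol 0 0 g) (x : E) :
    Continuous (moyalIntegrand σ Φ f g x) := by
  have hΦ := Φ.continuous
  have hσ := σ.continuous₂
  have hcf := (continuous_windowedFourier (σ := σ) (Φ := Φ) hf).comp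
    (by fun_prop : Continuous fun q : (E × E) × E =>
      (x + (q.1.1 + (2⁻¹ : ℝ) • (q.1.2 - q.2)), q.2))
  have hcg := (continuous_windowedFourier (σ := σ) (Φ := Φ) hg).comp
    (by fun_prop : Continuous fun q : (E × E) × E =>
      (x + (q.1.1 - (2⁻¹ : ℝ) • q.2), q.1.2 - q.2))
  have hphase : Continuous fun q : (E × E) × E => σ q.1.1 q.1.2 - σ q.2 q.1.2 / 2 := by fun_prop
  exact ((continuous_phase.comp hphase).mul (hΦ.comp (by fun_prop))).mul (hcf.mul hcg)

theorem integrable_moyalIntegrand (hσ : Function.Injective σ.flip) (hf : IsSymbol 0 0 f)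
    (hg : IsSymbol 0 0 g) (x : E) : Integrable (moyalIntegrand σ Φ f g x) := by
  obtain ⟨C, -, h⟩ := exists_norm_moyalIntegrand_le (Φ := Φ) hσ le_rfl le_rfl hf hg
  exact (integrable_moyalBound.const_mul _).mono'
    (continuous_moyalIntegrand hf hg x).aestronglyMeasurable (Eventually.of_forall (h x))

theorem exists_norm_moyal_le (hσ : Function.Injective σ.flip) {m₁ m₂ : ℝ} (hm₁ : m₁ ≤ 0)
    (hm₂ : m₂ ≤ 0) (hf : IsSymbol m₁ 0 f) (hg : IsSymbol m₂ 0 g) :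
    ∃ C : ℝ, ∀ x, ‖moyal σ Φ f g x‖ ≤ C * orderFun (m₁ + m₂) x := by
  obtain ⟨C, -, h⟩ := exists_norm_moyalIntegrand_le (Φ := Φ) hσ hm₁ hm₂ hf hg
  refine ⟨C * ∫ q : (E × E) × E, moyalBound q, fun x => ?_⟩
  refine (norm_integral_le_of_norm_le (integrable_moyalBound.const_mul _)
    (Eventually.of_forall (h x))).trans_eq ?_
  rw [integral_const_mul]
  ring

theorem hasPartialDerivs_moyalIntegrand (hf : IsSymbol 0 0 f) (hg : IsSymbol 0 0 g)
    (q : (E × E) × E) :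
    HasPartialDerivs (fun x => moyalIntegrand σ Φ f g x q) fun i x =>
      moyalIntegrand σ Φ (partialDeriv i f) g x q +
        moyalIntegrand σ Φ f (partialDeriv i g) x q := by
  intro x
  have hf' := (hasFDerivAt_comp_add_right (q.1.1 + (2⁻¹ : ℝ) • (q.1.2 - q.2))).2
    (hasPartialDerivs_windowedFourier (σ := σ) (Φ := Φ) hf q.2
      (x + (q.1.1 + (2⁻¹ : ℝ) • (q.1.2 - q.2))))
  have hg' := (hasFDerivAt_comp_add_right (q.1.1 - (2⁻¹ : ℝ) • q.2)).2
    (hasPartialDerivs_windowedFourier (σ := σ) (Φ := Φ) hg (q.1.2 - q.2)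
      (x + (q.1.1 - (2⁻¹ : ℝ) • q.2)))
  refine ((hf'.mul hg').const_mul
    (phase (σ q.1.1 q.1.2 - σ q.2 q.1.2 / 2) * Φ q.1.1)).congr_fderiv ?_
  simp only [Finset.smul_sum, ← Finset.sum_add_distrib, smul_smul, moyalIntegrand]
  refine Finset.sum_congr rfl fun i _ => ?_
  ext u
  simp only [smul_apply, add_apply, smul_eq_mul]
  ring

theorem hasPartialDerivs_moyal (hσ : Function.Injective σ.flip) (hf : IsSymbol 0 0 f)
    (hg : IsSymbol 0 0 g) :
    HasPartialDerivs (moyal σ Φ f g) fun i x =>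
      moyal σ Φ (partialDeriv i f) g x + moyal σ Φ f (partialDeriv i g) x := by
  have hf' (i) : IsSymbol 0 0 (partialDeriv i f) := by simpa using hf.partialDeriv i
  have hg' (i) : IsSymbol 0 0 (partialDeriv i g) := by simpa using hg.partialDeriv i
  choose C _ hC using fun i =>
    exists_norm_moyalIntegrand_le (Φ := Φ) hσ le_rfl le_rfl (hf' i) hg
  choose C' _ hC' using fun i =>
    exists_norm_moyalIntegrand_le (Φ := Φ) hσ le_rfl le_rfl hf (hg' i)
  simp only [add_zero, orderFun_zero, mul_one] at hC hC'
  have h := HasPartialDerivs.integral (hasPartialDerivs_moyalIntegrand (σ := σ) (Φ := Φ) hf hg)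
    (integrable_moyalIntegrand hσ hf hg)
    (fun i x => ((continuous_moyalIntegrand (hf' i) hg x).add
      (continuous_moyalIntegrand hf (hg' i) x)).aestronglyMeasurable)
    (fun i => (integrable_moyalBound.const_mul (C i)).add (integrable_moyalBound.const_mul (C' i)))
    (fun q i x => (norm_add_le _ _).trans (add_le_add (hC i x q) (hC' i x q)))
  intro x
  refine (h x).congr_fderiv (Finset.sum_congr rfl fun i _ => ?_)
  exact congrArg (· • coordFunctional i) (integral_add (integrable_moyalIntegrand hσ (hf' i) hg x)
    (integrable_moyalIntegrand hσ hf (hg' i) x))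

theorem contDiff_moyal (hσ : Function.Injective σ.flip) (hf : IsSymbol 0 0 f)
    (hg : IsSymbol 0 0 g) : ContDiff ℝ ∞ (moyal σ Φ f g) := by
  refine contDiff_infty.2 fun n => ?_
  induction n generalizing f g with
  | zero => exact contDiff_zero.2 (hasPartialDerivs_moyal hσ hf hg).continuous
  | succ n ih =>
    exact (hasPartialDerivs_moyal hσ hf hg).contDiff_succ fun i =>
      (ih (by simpa using hf.partialDeriv i) hg).add (ih hf (by simpa using hg.partialDeriv i))

theorem norm_iteratedFDeriv_succ_moyal_le (hσ : Function.Injective σ.flip) (hf : IsSymbol 0 0 f)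
    (hg : IsSymbol 0 0 g) (n : ℕ) (x : E) :
    ‖iteratedFDeriv ℝ (n + 1) (moyal σ Φ f g) x‖ ≤
      ∑ i, (‖iteratedFDeriv ℝ n (moyal σ Φ (partialDeriv i f) g) x‖ +
        ‖iteratedFDeriv ℝ n (moyal σ Φ f (partialDeriv i g)) x‖) := by
  have hf' (i) : ContDiff ℝ ∞ (moyal σ Φ (partialDeriv i f) g) :=
    contDiff_moyal hσ (by simpa using hf.partialDeriv i) hg
  have hg' (i) : ContDiff ℝ ∞ (moyal σ Φ f (partialDeriv i g)) :=
    contDiff_moyal hσ hf (by simpa using hg.partialDeriv i)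
  exact ((hasPartialDerivs_moyal hσ hf hg).norm_iteratedFDeriv_succ_le
    (fun i => ((hf' i).add (hg' i)).of_le (by exact_mod_cast le_top)) x).trans
    (Finset.sum_le_sum fun i _ => norm_iteratedFDeriv_add_le (hf' i) (hg' i) n x)

theorem exists_norm_iteratedFDeriv_moyal_le (hσ : Function.Injective σ.flip) {ρ : ℝ}
    (hρ : 0 ≤ ρ) (n : ℕ) {m₁ m₂ : ℝ} (hm₁ : m₁ ≤ 0) (hm₂ : m₂ ≤ 0) (hf : IsSymbol m₁ ρ f)
    (hg : IsSymbol m₂ ρ g) :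
    ∃ C : ℝ, ∀ x,
      ‖iteratedFDeriv ℝ n (moyal σ Φ f g) x‖ ≤ C * orderFun (m₁ + m₂ - ρ * n) x := by
  induction n generalizing m₁ m₂ f g with
  | zero =>
    simpa using exists_norm_moyal_le hσ hm₁ hm₂ (hf.type_zero hρ) (hg.type_zero hρ)
  | succ n ih =>
    choose C hC using fun i => ih (m₁ := m₁ - ρ) (by linarith) hm₂ (hf.partialDeriv i) hg
    choose C' hC' using fun i => ih (m₂ := m₂ - ρ) hm₁ (by linarith) hf (hg.partialDeriv i)
    refine ⟨∑ i, (C i + C' i), fun x => (norm_iteratedFDeriv_succ_moyal_le hσ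
      (hf.order_zero hm₁ hρ) (hg.order_zero hm₂ hρ) n x).trans ?_⟩
    rw [Finset.sum_mul]
    refine Finset.sum_le_sum fun i _ => ?_
    have horder₁ : m₁ - ρ + m₂ - ρ * n = m₁ + m₂ - ρ * (n + 1 : ℕ) := by push_cast; ring
    have horder₂ : m₁ + (m₂ - ρ) - ρ * n = m₁ + m₂ - ρ * (n + 1 : ℕ) := by push_cast; ring
    rw [add_mul]
    exact add_le_add (horder₁ ▸ hC i x) (horder₂ ▸ hC' i x)

theorem IsSymbol.moyal (hσ : Function.Injective σ.flip) {ρ m₁ m₂ : ℝ} (hρ : 0 ≤ ρ)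
    (hm₁ : m₁ ≤ 0) (hm₂ : m₂ ≤ 0) (hf : IsSymbol m₁ ρ f) (hg : IsSymbol m₂ ρ g) :
    IsSymbol (m₁ + m₂) ρ (moyal σ Φ f g) :=
  ⟨contDiff_moyal hσ (hf.order_zero hm₁ hρ) (hg.order_zero hm₂ hρ),
    fun n => exists_norm_iteratedFDeriv_moyal_le hσ hρ n hm₁ hm₂ hf hg⟩

theorem exists_schwartz_eq_moyal (hσ : Function.Injective σ.flip) (f g : 𝓢(E, ℂ)) :
    ∃ F : 𝓢(E, ℂ), (F : E → ℂ) = moyal σ Φ f g := by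
  refine exists_schwartz_eq_iff.2 fun k => ?_
  simpa using (isSymbol_schwartz f (-k) 0).moyal hσ le_rfl (by simp) le_rfl
    (isSymbol_schwartz g 0 0)

theorem tendsto_moyalIntegrand (hσ : Function.Injective σ.flip) (hf : VanishesAtInfinity f)
    (hg : IsSymbol 0 0 g) (q : (E × E) × E) :
    Tendsto (fun x => moyalIntegrand σ Φ f g x q) (cocompact E) (𝓝 0) := by
  obtain ⟨C, -, hC⟩ := exists_norm_windowedFourier_le (Φ := Φ) hσ le_rfl hg 0
  have h := tendsto_comp_add_right_cocompact (tendsto_windowAverage (Φ := Φ) hf)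
    (q.1.1 + (2⁻¹ : ℝ) • (q.1.2 - q.2))
  refine squeeze_zero_norm (a := fun x => ‖Φ q.1.1‖ *
    (windowAverage Φ f (x + (q.1.1 + (2⁻¹ : ℝ) • (q.1.2 - q.2))) * C)) (fun x => ?_)
    (by simpa using (h.mul_const C).const_mul ‖Φ q.1.1‖)
  rw [moyalIntegrand, norm_mul, norm_mul, norm_mul, norm_phase, one_mul]
  refine mul_le_mul_of_nonneg_left (mul_le_mul (norm_windowedFourier_le_windowAverage σ Φ _ _) ?_
    (norm_nonneg _) (windowAverage_nonneg Φ _)) (norm_nonneg _)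
  simpa [decay] using hC (x + (q.1.1 - (2⁻¹ : ℝ) • q.2)) (q.1.2 - q.2)

theorem tendsto_moyal (hσ : Function.Injective σ.flip) (hf : VanishesAtInfinity f)
    (hg : IsSymbol 0 0 g) : Tendsto (moyal σ Φ f g) (cocompact E) (𝓝 0) := by
  obtain ⟨C, -, hC⟩ := exists_norm_moyalIntegrand_le (Φ := Φ) hσ le_rfl le_rfl hf.isSymbol hg
  simp only [add_zero, orderFun_zero, mul_one] at hC
  rw [← integral_zero ((E × E) × E) ℂ]
  exact tendsto_integral_filter_of_dominated_convergence (fun q => C * moyalBound q)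
    (Eventually.of_forall fun x =>
      (continuous_moyalIntegrand hf.isSymbol hg x).aestronglyMeasurable)
    (Eventually.of_forall fun x => Eventually.of_forall (hC x)) (integrable_moyalBound.const_mul C)
    (Eventually.of_forall (tendsto_moyalIntegrand hσ hf hg))

theorem VanishesAtInfinity.moyal (hσ : Function.Injective σ.flip) (hf : VanishesAtInfinity f)
    (hg : VanishesAtInfinity g) : VanishesAtInfinity (moyal σ Φ f g) := by
  refine ⟨contDiff_moyal hσ hf.isSymbol hg.isSymbol, fun n => ?_⟩
  induction n generalizing f g with
  | zero => simpa using (tendsto_moyal hσ hf hg.isSymbol).norm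
  | succ n ih =>
    refine squeeze_zero (fun _ => norm_nonneg _)
      (norm_iteratedFDeriv_succ_moyal_le hσ hf.isSymbol hg.isSymbol n) ?_
    simpa using tendsto_finsetSum Finset.univ fun i _ =>
      (ih (hf.partialDeriv i) hg).add (ih hf (hg.partialDeriv i))

end Moyal

section Quantizer

variable {E : Type*} [NormedAddCommGroup E] [InnerProductSpace ℝ E]

/-- A symplectic form: an alternating bilinear form that is nondegenerate. -/
structure IsSymplectic (σ : E →L[ℝ] E →L[ℝ] ℝ) : Prop where
  self_eq_zero (x : E) : σ x x = 0
  injective_flip : Function.Injective σ.flip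

theorem IsSymplectic.swap {σ : E →L[ℝ] E →L[ℝ] ℝ} (hσ : IsSymplectic σ) (x y : E) :
    σ y x = -σ x y := by
  have h := hσ.self_eq_zero (x + y)
  simp only [map_add, add_apply, hσ.self_eq_zero, zero_add, add_zero] at h
  linarith

variable (σ : E →L[ℝ] E →L[ℝ] ℝ) (Φ : 𝓢(E, ℂ)) (f : E → ℂ)

/-- The cross-Wigner function of the coherent states at `z` and `w`: the profile `Φ`
centred at the midpoint of `z` and `w` and modulated with their difference. -/
def crossSymbol (z w x : E) : ℂ :=
  phase (σ x (z - w) + σ z w / 2) * Φ (x - (2⁻¹ : ℝ) • (z + w))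

theorem norm_crossSymbol (z w x : E) :
    ‖crossSymbol σ Φ z w x‖ = ‖Φ (x - (2⁻¹ : ℝ) • (z + w))‖ := by
  rw [crossSymbol, norm_mul, norm_phase, one_mul]

theorem continuous_crossSymbol :
    Continuous fun p : (E × E) × E => crossSymbol σ Φ p.1.1 p.1.2 p.2 := by
  have hσ := σ.continuous₂
  have hΦ := Φ.continuous
  unfold crossSymbol
  fun_prop

theorem exists_schwartz_eq_crossSymbol (z w : E) :
    ∃ F : 𝓢(E, ℂ), (F : E → ℂ) = crossSymbol σ Φ z w := by
  refine ⟨phase (σ z w / 2) • SchwartzMap.smulLeftCLM ℂ (fun x => phase (σ.flip (z - w) x))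
    (SchwartzMap.compSubConstCLM ℂ ((2⁻¹ : ℝ) • (z + w)) Φ), funext fun x => ?_⟩
  rw [smul_apply, SchwartzMap.smulLeftCLM_apply_apply
    (hasTemperateGrowth_phase_comp _), SchwartzMap.compSubConstCLM_apply, crossSymbol, phase_add,
    ContinuousLinearMap.flip_apply, smul_eq_mul, smul_eq_mul]
  ring

variable [FiniteDimensional ℝ E] [MeasurableSpace E] [BorelSpace E]

/-- The kernel, in the frame of coherent states, of the Weyl quantization of `f`. -/
def symbolKernel (z w : E) : ℂ := ∫ x, f x * crossSymbol σ Φ z w x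

variable {σ Φ f}

theorem symbolKernel_const_mul (a : ℂ) (z w : E) :
    symbolKernel σ Φ (fun x => a * f x) z w = a * symbolKernel σ Φ f z w := by
  simp only [symbolKernel, mul_assoc, integral_const_mul]

theorem symbolKernel_eq (hσ : IsSymplectic σ) (z w : E) :
    symbolKernel σ Φ f z w =
      phase (-(σ z w / 2)) * windowedFourier σ Φ f ((2⁻¹ : ℝ) • (z + w)) (z - w) := by
  rw [symbolKernel, windowedFourier, ← integral_const_mul,
    ← integral_add_left_eq_self _ ((2⁻¹ : ℝ) • (z + w))]
  refine integral_congr_ae (Eventually.of_forall fun y => ?_)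
  have hphase : σ ((2⁻¹ : ℝ) • (z + w) + y) (z - w) + σ z w / 2 = -(σ z w / 2) + σ y (z - w) := by
    simp only [map_add, map_sub, map_smul, add_apply, smul_apply, hσ.self_eq_zero, hσ.swap z w,
      smul_eq_mul]
    ring
  simp only [crossSymbol, add_sub_cancel_left, hphase, phase_add]
  ring

theorem norm_symbolKernel (hσ : IsSymplectic σ) (z w : E) :
    ‖symbolKernel σ Φ f z w‖ = ‖windowedFourier σ Φ f ((2⁻¹ : ℝ) • (z + w)) (z - w)‖ := by
  rw [symbolKernel_eq hσ, norm_mul, norm_phase, one_mul]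

theorem exists_norm_symbolKernel_le (hσ : IsSymplectic σ) (hf : IsSymbol 0 0 f) (N : ℕ) :
    ∃ C : ℝ, 0 ≤ C ∧ ∀ z w, ‖symbolKernel σ Φ f z w‖ ≤ C * decay N (z - w) := by
  obtain ⟨C, hC0, hC⟩ := exists_norm_windowedFourier_le (Φ := Φ) hσ.injective_flip le_rfl hf N
  refine ⟨C, hC0, fun z w => ?_⟩
  simpa [norm_symbolKernel hσ] using hC ((2⁻¹ : ℝ) • (z + w)) (z - w)

theorem continuous_symbolKernel (hσ : IsSymplectic σ) (hf : IsSymbol 0 0 f) :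
    Continuous fun p : E × E => symbolKernel σ Φ f p.1 p.2 := by
  have hσc := σ.continuous₂
  have hw := (continuous_windowedFourier (σ := σ) (Φ := Φ) hf).comp
    (by fun_prop : Continuous fun p : E × E => ((2⁻¹ : ℝ) • (p.1 + p.2), p.1 - p.2))
  simp only [symbolKernel_eq hσ]
  exact Continuous.mul (by fun_prop) hw

theorem integrable_mul_comp_sub {X : Type*} [MeasurableSpace X] {μ : Measure X} [SFinite μ]
    {t : X → E} (ht : Measurable t) {a : X → ℝ} (ha : Integrable a μ) {b : E → ℝ}
    (hb : Integrable b) :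
    Integrable (fun p : X × E => a p.1 * b (p.2 - t p.1)) (μ.prod volume) := by
  have hshear : MeasurePreserving (fun p : X × E => (p.1, p.2 - t p.1)) (μ.prod volume)
      (μ.prod volume) :=
    (MeasurePreserving.id μ).skew_product (g := fun x y => y - t x)
      (measurable_snd.sub (ht.comp measurable_fst))
      (Eventually.of_forall fun x => (measurePreserving_sub_right volume (t x)).map_eq)
  exact hshear.integrable_comp_of_integrable (ha.mul_prod hb)

variable {H : Type*} [NormedAddCommGroup H] [InnerProductSpace ℂ H]

variable (σ Φ) in
/-- A Stratonovich–Weyl quantizer `Δ` together with the tight frame `e` of coherent states in which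
it is represented: the matrix elements of `Δ x` are the cross-Wigner functions, and these satisfy
the orthogonality relations. -/
structure IsQuantizer (e : E → H) (Δ : E → H →L[ℂ] H) (κ γ : ℝ) : Prop
    extends IsTightFrame e κ where
  symplectic : IsSymplectic σ
  even (x : E) : Φ (-x) = Φ x
  exists_norm_le : ∃ b, ∀ z, ‖e z‖ ≤ b
  integrable_inner (z : E) : Integrable fun w => ⟪e w, e z⟫_ℂ
  inner_apply (x z w : E) : ⟪e z, Δ x (e w)⟫_ℂ = crossSymbol σ Φ z w x
  orthogonality_pos : 0 < γ
  integral_crossSymbol_mul_crossSymbol (z w a b : E) :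
    ∫ x, crossSymbol σ Φ z w x * crossSymbol σ Φ a b x = γ * (⟪e z, e b⟫_ℂ * ⟪e a, e w⟫_ℂ)

variable (σ Φ) in
/-- `T` has Weyl symbol `f`, up to the normalization of the quantizer. -/
def HasSymbol (e : E → H) (f : E → ℂ) (T : H →L[ℂ] H) : Prop :=
  ∀ z w, ⟪e z, T (e w)⟫_ℂ = symbolKernel σ Φ f z w

theorem HasSymbol.const_smul {e : E → H} {T : H →L[ℂ] H} (hT : HasSymbol σ Φ e f T) (a : ℂ) :
    HasSymbol σ Φ e (fun x => a * f x) (a • T) := fun z w => by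
  rw [smul_apply, inner_smul_right, hT, symbolKernel_const_mul]

theorem integrable_mul_crossSymbol (hf : IsSymbol 0 0 f) (z w : E) :
    Integrable fun x => f x * crossSymbol σ Φ z w x := by
  obtain ⟨B, hB⟩ := hf.exists_bound
  obtain ⟨F, hF⟩ := exists_schwartz_eq_crossSymbol σ Φ z w
  rw [← hF]
  exact F.integrable.bdd_mul hf.1.continuous.aestronglyMeasurable (Eventually.of_forall hB)

theorem HasSymbol.add {e : E → H} {g : E → ℂ} {S T : H →L[ℂ] H} (hf : IsSymbol 0 0 f)
    (hg : IsSymbol 0 0 g) (hS : HasSymbol σ Φ e f S) (hT : HasSymbol σ Φ e g T) :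
    HasSymbol σ Φ e (fun x => f x + g x) (S + T) := fun z w => by
  simp only [symbolKernel, add_mul]
  rw [integral_add (integrable_mul_crossSymbol hf z w) (integrable_mul_crossSymbol hg z w),
    add_apply, inner_add_right, hS, hT, symbolKernel, symbolKernel]

namespace IsQuantizer

variable {e : E → H} {Δ : E → H →L[ℂ] H} {κ γ : ℝ}
  (he : IsQuantizer σ Φ e Δ κ γ) {φ ψ : H}
include he

theorem integrable_kernelForm_mul_crossSymbol (hf : Continuous f) {B : ℝ} (hB : ∀ x, ‖f x‖ ≤ B)
    (hφ : Integrable fun z => ⟪e z, φ⟫_ℂ) (hψ : Integrable fun z => ⟪e z, ψ⟫_ℂ) :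
    Integrable fun p : (E × E) × E =>
      ⟪φ, e p.1.1⟫_ℂ * (f p.2 * crossSymbol σ Φ p.1.1 p.1.2 p.2) * ⟪e p.1.2, ψ⟫_ℂ := by
  have hc := he.continuous
  have hΦ := continuous_crossSymbol σ Φ
  have hbound := (integrable_mul_comp_sub (t := fun p : E × E => (2⁻¹ : ℝ) • (p.1 + p.2))
    (by fun_prop) (hφ.norm.mul_prod hψ.norm) Φ.integrable.norm).const_mul B
  refine hbound.mono' (Continuous.aestronglyMeasurable (by fun_prop))
    (Eventually.of_forall fun p => ?_)
  simp only [norm_mul, norm_crossSymbol, norm_inner_symm φ]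
  calc _ = ‖f p.2‖ * (‖⟪e p.1.1, φ⟫_ℂ‖ * ‖⟪e p.1.2, ψ⟫_ℂ‖ *
        ‖Φ (p.2 - (2⁻¹ : ℝ) • (p.1.1 + p.1.2))‖) := by ring
    _ ≤ _ := mul_le_mul_of_nonneg_right (hB p.2) (by positivity)

variable [CompleteSpace H]

theorem kernelForm_crossSymbol (hφ : Integrable fun z => ⟪e z, φ⟫_ℂ)
    (hψ : Integrable fun z => ⟪e z, ψ⟫_ℂ) (x : E) :
    kernelForm e (fun p => crossSymbol σ Φ p.1 p.2 x) φ ψ = κ ^ 2 * ⟪φ, Δ x ψ⟫_ℂ := by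
  have hc := he.continuous
  obtain ⟨C, hC⟩ : ∃ C, ∀ y, ‖Φ y‖ ≤ C := ⟨_, SchwartzMap.norm_le_seminorm ℝ Φ⟩
  simp only [← he.inner_apply]
  refine he.kernelForm_inner_of_integrable <| ((hφ.norm.mul_prod hψ.norm).const_mul C).mono'
    (Continuous.aestronglyMeasurable (by fun_prop)) (Eventually.of_forall fun p => ?_)
  rw [norm_mul, norm_mul, norm_inner_symm φ, he.inner_apply, norm_crossSymbol]
  calc _ = ‖Φ (x - (2⁻¹ : ℝ) • (p.1 + p.2))‖ * (‖⟪e p.1, φ⟫_ℂ‖ * ‖⟪e p.2, ψ⟫_ℂ‖) := by ring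
    _ ≤ _ := mul_le_mul_of_nonneg_right (hC _) (by positivity)

theorem integral_kernelForm_mul_crossSymbol (hφ : Integrable fun z => ⟪e z, φ⟫_ℂ)
    (hψ : Integrable fun z => ⟪e z, ψ⟫_ℂ) (x : E) :
    ∫ p : E × E, ⟪φ, e p.1⟫_ℂ * (f x * crossSymbol σ Φ p.1 p.2 x) * ⟪e p.2, ψ⟫_ℂ =
      κ ^ 2 * (f x * ⟪φ, Δ x ψ⟫_ℂ) := by
  rw [mul_left_comm, ← he.kernelForm_crossSymbol hφ hψ, kernelForm, ← integral_const_mul]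
  simp only [mul_left_comm _ (f x), mul_assoc]

theorem integrable_mul_inner (hf : IsSymbol 0 0 f) (hφ : Integrable fun z => ⟪e z, φ⟫_ℂ)
    (hψ : Integrable fun z => ⟪e z, ψ⟫_ℂ) : Integrable fun x => f x * ⟪φ, Δ x ψ⟫_ℂ := by
  obtain ⟨B, hB⟩ := hf.exists_bound
  have h := (he.integrable_kernelForm_mul_crossSymbol hf.1.continuous hB hφ hψ).integral_prod_right
  simp only [he.integral_kernelForm_mul_crossSymbol hφ hψ] at h
  exact (integrable_const_mul_iff (pow_ne_zero 2 he.ofReal_ne_zero).isUnit _).1 h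

theorem sq_mul_integral_mul_inner (hf : IsSymbol 0 0 f) (hφ : Integrable fun z => ⟪e z, φ⟫_ℂ)
    (hψ : Integrable fun z => ⟪e z, ψ⟫_ℂ) :
    κ ^ 2 * ∫ x, f x * ⟪φ, Δ x ψ⟫_ℂ =
      kernelForm e (fun p => symbolKernel σ Φ f p.1 p.2) φ ψ := by
  obtain ⟨B, hB⟩ := hf.exists_bound
  have hint := he.integrable_kernelForm_mul_crossSymbol hf.1.continuous hB hφ hψ
  rw [Measure.volume_eq_prod] at hint
  rw [← integral_const_mul]
  simp only [← he.integral_kernelForm_mul_crossSymbol hφ hψ]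
  rw [← integral_prod_symm _ hint, integral_prod _ hint, kernelForm]
  simp only [integral_mul_const, integral_const_mul, symbolKernel]

theorem exists_hasSymbol (hf : IsSymbol 0 0 f) : ∃ T, HasSymbol σ Φ e f T := by
  obtain ⟨C, hC0, hC⟩ := exists_norm_symbolKernel_le (Φ := Φ) he.symplectic hf
    (Module.finrank ℝ E + 1)
  obtain ⟨T, hT⟩ := he.exists_inner_eq_kernelForm ((continuous_decay _).const_mul C)
    (integrable_decay.const_mul C) (fun d => mul_nonneg hC0 (decay_nonneg _ d))
    (continuous_symbolKernel he.symplectic hf).aestronglyMeasurable fun p => hC p.1 p.2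
  refine ⟨((κ : ℂ) ^ 2)⁻¹ • T, fun z w => ?_⟩
  rw [smul_apply, inner_smul_right, hT, ← he.sq_mul_integral_mul_inner hf
    (he.integrable_inner z) (he.integrable_inner w),
    inv_mul_cancel_left₀ (pow_ne_zero 2 he.ofReal_ne_zero)]
  simp only [he.inner_apply, symbolKernel]

theorem hasSymbol_unique {S T : H →L[ℂ] H} (hS : HasSymbol σ Φ e f S)
    (hT : HasSymbol σ Φ e f T) : S = T :=
  he.ext_inner_inner fun z w => (hS z w).trans (hT z w).symm

theorem kernelForm_symbolKernel (hf : IsSymbol 0 0 f) {T : H →L[ℂ] H}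
    (hT : HasSymbol σ Φ e f T) (φ ψ : H) :
    kernelForm e (fun p => symbolKernel σ Φ f p.1 p.2) φ ψ = κ ^ 2 * ⟪φ, T ψ⟫_ℂ := by
  obtain ⟨C, -, hC⟩ := exists_norm_symbolKernel_le (Φ := Φ) he.symplectic hf
    (Module.finrank ℝ E + 1)
  simp only [← hT _ _] at hC ⊢
  exact he.kernelForm_inner ((continuous_decay _).const_mul C) (integrable_decay.const_mul C) hC φ ψ

theorem inner_eq_integral (hf : IsSymbol 0 0 f) {T : H →L[ℂ] H} (hT : HasSymbol σ Φ e f T)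
    (hφ : Integrable fun z => ⟪e z, φ⟫_ℂ) (hψ : Integrable fun z => ⟪e z, ψ⟫_ℂ) :
    ⟪φ, T ψ⟫_ℂ = ∫ x, f x * ⟪φ, Δ x ψ⟫_ℂ :=
  mul_left_cancel₀ (pow_ne_zero 2 he.ofReal_ne_zero)
    ((he.kernelForm_symbolKernel hf hT φ ψ).symm.trans
      (he.sq_mul_integral_mul_inner hf hφ hψ).symm)

end IsQuantizer

end Quantizer

section SymbolProduct

variable {E : Type*} [NormedAddCommGroup E] [InnerProductSpace ℝ E] [FiniteDimensional ℝ E]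
  [MeasurableSpace E] [BorelSpace E] {σ : E →L[ℝ] E →L[ℝ] ℝ} {Φ : 𝓢(E, ℂ)} {f g : E → ℂ}
  {H : Type*} [NormedAddCommGroup H] [InnerProductSpace ℂ H]

variable (σ Φ) in
/-- The Weyl symbol of an operator, up to normalization. -/
def operatorSymbol (e : E → H) (T : H →L[ℂ] H) (x : E) : ℂ :=
  ∫ p : E × E, ⟪e p.1, T (e p.2)⟫_ℂ * crossSymbol σ Φ p.2 p.1 x

theorem moyalIntegrand_eq (hσ : IsSymplectic σ) (hΦ : ∀ x, Φ (-x) = Φ x) (x c d e : E) :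
    moyalIntegrand σ Φ f g x ((c, d), e) =
      symbolKernel σ Φ f (x + (c + (2⁻¹ : ℝ) • d)) (x + (c + (2⁻¹ : ℝ) • d) - e) *
        symbolKernel σ Φ g (x + (c + (2⁻¹ : ℝ) • d) - e) (x + (c - (2⁻¹ : ℝ) • d)) *
        crossSymbol σ Φ (x + (c - (2⁻¹ : ℝ) • d)) (x + (c + (2⁻¹ : ℝ) • d)) x := by
  set z := x + (c + (2⁻¹ : ℝ) • d) with hz
  set w := x + (c - (2⁻¹ : ℝ) • d) with hw
  have hzy : (2⁻¹ : ℝ) • (z + (z - e)) = x + (c + (2⁻¹ : ℝ) • (d - e)) := by module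
  have hyw : (2⁻¹ : ℝ) • (z - e + w) = x + (c - (2⁻¹ : ℝ) • e) := by module
  have hwz : x - (2⁻¹ : ℝ) • (w + z) = -c := by module
  have hd : z - e - w = d - e := by module
  have hphase : σ c d - σ e d / 2 =
      -(σ z (z - e) / 2) + -(σ (z - e) w / 2) + (σ x (w - z) + σ w z / 2) := by
    simp only [hz, hw, map_add, map_sub, map_smul, add_apply, sub_apply, smul_apply,
      hσ.self_eq_zero, smul_eq_mul, hσ.swap x c, hσ.swap x d, hσ.swap x e, hσ.swap c d,
      hσ.swap c e, hσ.swap d e]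
    ring
  rw [symbolKernel_eq hσ, symbolKernel_eq hσ, crossSymbol, moyalIntegrand, hzy, hyw, hwz, hΦ, hd,
    sub_sub_cancel, hphase, phase_add, phase_add]
  ring

namespace IsQuantizer

variable {e : E → H} {Δ : E → H →L[ℂ] H} {κ γ : ℝ} (he : IsQuantizer σ Φ e Δ κ γ)
  {S T : H →L[ℂ] H}
include he

theorem integrable_inner_mul_crossSymbol_mul_crossSymbol {η : E → ℝ} (hη : Integrable η)
    (hT : ∀ z w, ‖⟪e z, T (e w)⟫_ℂ‖ ≤ η (z - w)) (a b : E) :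
    Integrable fun p : (E × E) × E => ⟪e p.1.1, T (e p.1.2)⟫_ℂ *
      (crossSymbol σ Φ p.1.2 p.1.1 p.2 * crossSymbol σ Φ a b p.2) := by
  set N := Module.finrank ℝ E + 1
  set m := (2⁻¹ : ℝ) • (a + b) with hm
  obtain ⟨C, hC0, hC⟩ := exists_norm_le_decay Φ (N + N)
  have hcross := continuous_crossSymbol σ Φ
  have hc := he.continuous
  have hdecay : Integrable (decay N : E → ℝ) := integrable_decay
  have hcent : Integrable fun p : E × E =>
      decay N ((2⁻¹ : ℝ) • (p.1 + p.2) - m) * η (p.1 - p.2) :=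
    (integrable_comp_continuousLinearEquiv_iff (midpointEquiv E)).2
      ((hdecay.comp_sub_right m).mul_prod hη)
  have hbound := (hcent.mul_prod (hdecay.comp_sub_right m)).const_mul (C * C)
  have hmeas : Continuous fun p : (E × E) × E => ⟪e p.1.1, T (e p.1.2)⟫_ℂ *
      (crossSymbol σ Φ p.1.2 p.1.1 p.2 * crossSymbol σ Φ a b p.2) :=
    Continuous.mul (by fun_prop) <|
      (hcross.comp (by fun_prop : Continuous fun p : (E × E) × E => (p.1.swap, p.2))).mul
        (hcross.comp (by fun_prop : Continuous fun p : (E × E) × E => ((a, b), p.2)))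
  refine hbound.mono' hmeas.aestronglyMeasurable (Eventually.of_forall fun p => ?_)
  set c := (2⁻¹ : ℝ) • (p.1.1 + p.1.2) with hcdef
  have hsplit : decay N (p.2 - c) * decay N (p.2 - m) ≤ decay N (c - m) := by
    have h := decay_mul_decay_le N (c - p.2) (p.2 - m)
    rwa [sub_add_sub_cancel, ← neg_sub, decay_neg] at h
  have h₁ := decay_nonneg N (p.2 - c)
  have h₂ := decay_nonneg N (p.2 - m)
  have h₃ := (norm_nonneg _).trans (hT p.1.1 p.1.2)
  rw [norm_mul, norm_mul, norm_crossSymbol, norm_crossSymbol, add_comm p.1.2, ← hm, ← hcdef]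
  calc _ ≤ η (p.1.1 - p.1.2) * (C * (decay N (p.2 - c) * decay N (p.2 - c)) *
        (C * (decay N (p.2 - m) * decay N (p.2 - m)))) := by
        simp only [decay_add] at hC
        gcongr
        exacts [hT _ _, hC _, hC _]
    _ = C * C * η (p.1.1 - p.1.2) * (decay N (p.2 - c) * decay N (p.2 - m)) *
        (decay N (p.2 - c) * decay N (p.2 - m)) := by ring
    _ ≤ C * C * η (p.1.1 - p.1.2) * decay N (c - m) * (1 * decay N (p.2 - m)) := by
        have h₄ := decay_nonneg N (c - m)
        gcongr
        exact decay_le_one N _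
    _ = C * C * (decay N (c - m) * η (p.1.1 - p.1.2) * decay N (p.2 - m)) := by ring

variable [CompleteSpace H]

theorem symbolKernel_operatorSymbol {η : E → ℝ} (hηc : Continuous η) (hη : Integrable η)
    (hT : ∀ z w, ‖⟪e z, T (e w)⟫_ℂ‖ ≤ η (z - w)) (a b : E) :
    symbolKernel σ Φ (operatorSymbol σ Φ e T) a b = γ * (κ ^ 2 * ⟪e a, T (e b)⟫_ℂ) := by
  have hint := he.integrable_inner_mul_crossSymbol_mul_crossSymbol hη hT a b
  rw [Measure.volume_eq_prod] at hint
  have hsymm := (integral_prod_symm _ hint).symm.trans (integral_prod _ hint)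
  simp only [integral_const_mul, he.integral_crossSymbol_mul_crossSymbol] at hsymm
  rw [← he.kernelForm_inner hηc hη hT, kernelForm, ← integral_const_mul]
  simp only [symbolKernel, operatorSymbol, ← integral_mul_const, mul_assoc]
  refine hsymm.trans (integral_congr_ae (Eventually.of_forall fun p => ?_))
  ring

theorem norm_inner_mul_le {A B : ℝ} {s : ℕ} (hs : Integrable (decay s : E → ℝ))
    (hS : ∀ z w, ‖⟪e z, S (e w)⟫_ℂ‖ ≤ A * decay (s + s) (z - w))
    (hT : ∀ z w, ‖⟪e z, T (e w)⟫_ℂ‖ ≤ B * decay (s + s) (z - w)) (hA : 0 ≤ A) (hB : 0 ≤ B)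
    (z w : E) :
    ‖⟪e z, (S * T) (e w)⟫_ℂ‖ ≤ κ⁻¹ * (A * B * ∫ y : E, decay s y) * decay s (z - w) := by
  have hκ := he.pos
  have hbound : ‖(κ : ℂ) * ⟪e z, (S * T) (e w)⟫_ℂ‖ ≤
      ∫ y, A * B * decay s (z - w) * decay s (z - y) := by
    rw [← he.integral_inner_mul_inner_comp]
    refine norm_integral_le_of_norm_le ((hs.comp_sub_left z).const_mul _)
      (Eventually.of_forall fun y => ?_)
    have h := decay_double_mul_decay_double_le s (z - w) (z - y)
    rw [sub_sub_sub_cancel_left] at h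
    rw [norm_mul]
    calc _ ≤ (A * decay (s + s) (z - y)) * (B * decay (s + s) (y - w)) :=
          mul_le_mul (hS z y) (hT y w) (norm_nonneg _) (mul_nonneg hA (decay_nonneg _ _))
      _ = A * B * (decay (s + s) (z - y) * decay (s + s) (y - w)) := by ring
      _ ≤ A * B * (decay s (z - w) * decay s (z - y)) := by gcongr
      _ = _ := by ring
  rw [integral_const_mul, integral_sub_left_eq_self (fun y : E => decay s y), norm_mul,
    Complex.norm_real, Real.norm_of_nonneg hκ.le] at hbound
  calc _ = κ⁻¹ * (κ * ‖⟪e z, (S * T) (e w)⟫_ℂ‖) := (inv_mul_cancel_left₀ hκ.ne' _).symm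
    _ ≤ κ⁻¹ * (A * B * decay s (z - w) * ∫ y : E, decay s y) := by gcongr
    _ = _ := by ring

theorem moyal_eq_operatorSymbol (hf : IsSymbol 0 0 f) (hg : IsSymbol 0 0 g)
    (hS : HasSymbol σ Φ e f S) (hT : HasSymbol σ Φ e g T) (x : E) :
    moyal σ Φ f g x =
      jacobian (midpointEquiv E).symm * (κ * operatorSymbol σ Φ e (S * T) x) := by
  let K : E × E → ℂ := fun q => ⟪e q.1, (S * T) (e q.2)⟫_ℂ * crossSymbol σ Φ q.2 q.1 x
  have hinner (p : E × E) : ∫ y, moyalIntegrand σ Φ f g x (p, y) =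
      κ * K ((x, x) + (midpointEquiv E).symm p) := by
    obtain ⟨c, d⟩ := p
    simp only [moyalIntegrand_eq he.symplectic he.even, ← hS _ _, ← hT _ _]
    rw [integral_mul_const, integral_sub_left_eq_self
      (fun y => ⟪e (x + (c + (2⁻¹ : ℝ) • d)), S (e y)⟫_ℂ *
        ⟪e y, T (e (x + (c - (2⁻¹ : ℝ) • d)))⟫_ℂ),
      he.integral_inner_mul_inner_comp, mul_assoc]
    rfl
  rw [moyal, Measure.volume_eq_prod,
    integral_prod _ (integrable_moyalIntegrand he.symplectic.injective_flip hf hg x)]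
  simp only [hinner]
  rw [integral_const_mul, integral_comp_continuousLinearEquiv
    (midpointEquiv E).symm (fun q => K ((x, x) + q)), integral_add_left_eq_self K, mul_left_comm]
  rfl

theorem exists_hasSymbol_mul : ∃ a : ℂ, ∀ {f g : E → ℂ} {S T : H →L[ℂ] H}, IsSymbol 0 0 f →
    IsSymbol 0 0 g → HasSymbol σ Φ e f S → HasSymbol σ Φ e g T →
      HasSymbol σ Φ e (fun x => a * moyal σ Φ f g x) (S * T) := by
  have hκ := he.ofReal_ne_zero
  have hγ : (γ : ℂ) ≠ 0 := by exact_mod_cast he.orthogonality_pos.ne'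
  have hJ : (jacobian (midpointEquiv E).symm : ℂ) ≠ 0 := by
    exact_mod_cast (jacobian_pos (midpointEquiv E).symm).ne'
  refine ⟨(jacobian (midpointEquiv E).symm * κ * (γ * κ ^ 2))⁻¹,
    fun {f g S T} hf hg hS hT z w => ?_⟩
  set s := Module.finrank ℝ E + 1
  obtain ⟨A, hA0, hA⟩ := exists_norm_symbolKernel_le (Φ := Φ) he.symplectic hf (s + s)
  obtain ⟨B, hB0, hB⟩ := exists_norm_symbolKernel_le (Φ := Φ) he.symplectic hg (s + s)
  simp only [← hS _ _] at hA
  simp only [← hT _ _] at hB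
  simp only [he.moyal_eq_operatorSymbol hf hg hS hT, symbolKernel_const_mul]
  rw [he.symbolKernel_operatorSymbol ((continuous_decay _).const_mul _)
    (integrable_decay.const_mul _) (he.norm_inner_mul_le integrable_decay hA hB hA0 hB0)]
  field_simp

end IsQuantizer

end SymbolProduct

section CompactSymbol

variable {E : Type*} [NormedAddCommGroup E] [InnerProductSpace ℝ E] [FiniteDimensional ℝ E]
  [MeasurableSpace E] [BorelSpace E] {σ : E →L[ℝ] E →L[ℝ] ℝ} {Φ : 𝓢(E, ℂ)} {f : E → ℂ}
  {H : Type*} [NormedAddCommGroup H] [InnerProductSpace ℂ H]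

theorem windowAverage_le {B : ℝ} (hB : ∀ x, ‖f x‖ ≤ B) (c : E) :
    windowAverage Φ f c ≤ B * ∫ y, ‖Φ y‖ := by
  rw [← integral_const_mul]
  exact integral_mono_of_nonneg (Eventually.of_forall fun y => by positivity)
    (Φ.integrable.norm.const_mul B)
    (Eventually.of_forall fun y => mul_le_mul_of_nonneg_right (hB _) (norm_nonneg _))

theorem exists_norm_symbolKernel_le_sqrt (hσ : IsSymplectic σ) (hf : IsSymbol 0 0 f) (s : ℕ) :
    ∃ C : ℝ, 0 ≤ C ∧ ∀ z w, ‖symbolKernel σ Φ f z w‖ ≤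
      √(C * windowAverage Φ f ((2⁻¹ : ℝ) • (z + w))) * decay s (z - w) := by
  obtain ⟨C, hC0, hC⟩ := exists_norm_symbolKernel_le (Φ := Φ) hσ hf (s + s)
  refine ⟨C, hC0, fun z w => ?_⟩
  have havg := (norm_symbolKernel (Φ := Φ) (f := f) hσ z w).trans_le
    (norm_windowedFourier_le_windowAverage σ Φ _ _)
  have hA := windowAverage_nonneg (f := f) Φ ((2⁻¹ : ℝ) • (z + w))
  refine abs_le_of_sq_le_sq' ?_ (mul_nonneg (Real.sqrt_nonneg _) (decay_nonneg _ _)) |>.2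
  rw [mul_pow, Real.sq_sqrt (mul_nonneg hC0 hA), sq, sq (decay _ _), ← decay_add]
  calc _ ≤ (C * decay (s + s) (z - w)) * windowAverage Φ f ((2⁻¹ : ℝ) • (z + w)) :=
        mul_le_mul (hC z w) havg (norm_nonneg _) ((norm_nonneg _).trans (hC z w))
    _ = _ := by ring

namespace IsQuantizer

variable {e : E → H} {Δ : E → H →L[ℂ] H} {κ γ : ℝ} (he : IsQuantizer σ Φ e Δ κ γ)
include he

theorem hasSymbol_rankOne (z w : E) :
    HasSymbol σ Φ e (fun x => (γ : ℂ)⁻¹ * crossSymbol σ Φ w z x)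
      (InnerProductSpace.rankOne ℂ (e z) (e w)) := fun a b => by
  have hγ : (γ : ℂ) ≠ 0 := by exact_mod_cast he.orthogonality_pos.ne'
  rw [symbolKernel_const_mul, symbolKernel, he.integral_crossSymbol_mul_crossSymbol,
    inv_mul_cancel_left₀ hγ, InnerProductSpace.rankOne_apply, inner_smul_right]

variable [CompleteSpace H]

theorem isCompactOperator_of_hasSymbol (hf : VanishesAtInfinity f) {T : H →L[ℂ] H}
    (hT : HasSymbol σ Φ e f T) : IsCompactOperator T := by
  obtain ⟨b, hb⟩ := he.exists_norm_le
  obtain ⟨B, hB⟩ := hf.isSymbol.exists_bound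
  obtain ⟨C, hC0, hC⟩ := exists_norm_symbolKernel_le_sqrt (Φ := Φ) he.symplectic hf.isSymbol
    (Module.finrank ℝ E + 1)
  have hvanish := (Real.continuous_sqrt.tendsto' _ _ Real.sqrt_zero).comp
    (mul_zero C ▸ (tendsto_windowAverage (Φ := Φ) hf).const_mul C)
  have hcompact : IsCompactOperator ((κ : ℂ) ^ 2 • T) :=
    he.isCompactOperator_of_kernelForm hb (continuous_decay _) integrable_decay (decay_nonneg _)
      (fun c => Real.sqrt_le_sqrt (mul_le_mul_of_nonneg_left (windowAverage_le hB c) hC0)) hvanish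
      (continuous_symbolKernel he.symplectic hf.isSymbol).aestronglyMeasurable
      (fun p => hC p.1 p.2) fun φ ψ => by
        rw [smul_apply, inner_smul_right, he.kernelForm_symbolKernel hf.isSymbol hT]
  have h := hcompact.smul ((κ : ℂ) ^ 2)⁻¹
  rwa [← FunLike.coe_smul, inv_smul_smul₀ (pow_ne_zero 2 he.ofReal_ne_zero)] at h

end IsQuantizer

end CompactSymbol

section SymbolAlgebra

variable {E : Type*} [NormedAddCommGroup E] [InnerProductSpace ℝ E] [FiniteDimensional ℝ E]
  [MeasurableSpace E] [BorelSpace E]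

/-- A class of symbols vanishing at infinity that contains the Schwartz functions and is closed
under linear combinations and the Moyal product. -/
structure IsMoyalAlgebra (σ : E →L[ℝ] E →L[ℝ] ℝ) (Φ : 𝓢(E, ℂ)) (F : Set (E → ℂ)) : Prop where
  schwartz_mem (f : 𝓢(E, ℂ)) : (f : E → ℂ) ∈ F
  vanishesAtInfinity {f : E → ℂ} : f ∈ F → VanishesAtInfinity f
  const_mul_mem {f : E → ℂ} (a : ℂ) : f ∈ F → (fun x => a * f x) ∈ F
  add_mem {f g : E → ℂ} : f ∈ F → g ∈ F → (fun x => f x + g x) ∈ F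
  moyal_mem {f g : E → ℂ} : f ∈ F → g ∈ F → moyal σ Φ f g ∈ F

variable {σ : E →L[ℝ] E →L[ℝ] ℝ} {Φ : 𝓢(E, ℂ)}

theorem isMoyalAlgebra_isSymbol (hσ : Function.Injective σ.flip) {m ρ : ℝ} (hm : m < 0)
    (hρ : 0 ≤ ρ) : IsMoyalAlgebra σ Φ {f | IsSymbol m ρ f} where
  schwartz_mem f := isSymbol_schwartz f m ρ
  vanishesAtInfinity hf := hf.vanishesAtInfinity hm hρ
  const_mul_mem a hf := hf.const_mul a
  add_mem hf hg := hf.add hg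
  moyal_mem hf hg := (hf.moyal hσ hρ hm.le hm.le hg).mono fun n => by linarith

theorem isMoyalAlgebra_vanishesAtInfinity (hσ : Function.Injective σ.flip) :
    IsMoyalAlgebra σ Φ {f | VanishesAtInfinity f} where
  schwartz_mem f := (isSymbol_schwartz f (-1) 0).vanishesAtInfinity neg_one_lt_zero le_rfl
  vanishesAtInfinity hf := hf
  const_mul_mem a hf := hf.const_mul a
  add_mem hf hg := hf.add hg
  moyal_mem hf hg := hf.moyal hσ hg

theorem isMoyalAlgebra_schwartz (hσ : Function.Injective σ.flip) :
    IsMoyalAlgebra σ Φ (Set.range fun f : 𝓢(E, ℂ) => (f : E → ℂ)) where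
  schwartz_mem f := ⟨f, rfl⟩
  vanishesAtInfinity := by
    rintro _ ⟨f, rfl⟩
    exact (isSymbol_schwartz f (-1) 0).vanishesAtInfinity neg_one_lt_zero le_rfl
  const_mul_mem := by
    rintro _ a ⟨f, rfl⟩
    exact ⟨a • f, rfl⟩
  add_mem := by
    rintro _ _ ⟨f, rfl⟩ ⟨g, rfl⟩
    exact ⟨f + g, rfl⟩
  moyal_mem := by
    rintro _ _ ⟨f, rfl⟩ ⟨g, rfl⟩
    exact exists_schwartz_eq_moyal hσ f g

namespace IsQuantizer

variable {F : Set (E → ℂ)} {H : Type*} [NormedAddCommGroup H] [InnerProductSpace ℂ H]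
  [CompleteSpace H] {e : E → H} {Δ : E → H →L[ℂ] H} {κ γ : ℝ} (he : IsQuantizer σ Φ e Δ κ γ)
  (hF : IsMoyalAlgebra σ Φ F)

/-- The algebra of the operators whose Weyl symbols lie in the class `F`. -/
def operatorAlgebra : NonUnitalSubalgebra ℂ (H →L[ℂ] H) where
  carrier := {T | ∃ f ∈ F, HasSymbol σ Φ e f T}
  zero_mem' := ⟨_, hF.schwartz_mem 0, fun z w => by simp [symbolKernel]⟩
  add_mem' := by
    rintro _ _ ⟨f, hf, hS⟩ ⟨g, hg, hT⟩
    exact ⟨_, hF.add_mem hf hg,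
      hS.add (hF.vanishesAtInfinity hf).isSymbol (hF.vanishesAtInfinity hg).isSymbol hT⟩
  smul_mem' := by
    rintro a _ ⟨f, hf, hT⟩
    exact ⟨_, hF.const_mul_mem a hf, hT.const_smul a⟩
  mul_mem' := by
    rintro _ _ ⟨f, hf, hS⟩ ⟨g, hg, hT⟩
    obtain ⟨a, ha⟩ := he.exists_hasSymbol_mul
    exact ⟨_, hF.const_mul_mem a (hF.moyal_mem hf hg),
      ha (hF.vanishesAtInfinity hf).isSymbol (hF.vanishesAtInfinity hg).isSymbol hS hT⟩

theorem isCompactOperator_of_mem_operatorAlgebra {T : H →L[ℂ] H}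
    (hT : T ∈ he.operatorAlgebra hF) : IsCompactOperator T := by
  obtain ⟨f, hf, hT⟩ := hT
  exact he.isCompactOperator_of_hasSymbol (hF.vanishesAtInfinity hf) hT

theorem mem_closure_operatorAlgebra {T : H →L[ℂ] H} (hT : IsCompactOperator T) :
    T ∈ closure (he.operatorAlgebra hF : Set (H →L[ℂ] H)) := by
  have hclosed : IsClosed
      ((he.operatorAlgebra hF).toSubmodule.topologicalClosure : Set (H →L[ℂ] H)) :=
    Submodule.isClosed_topologicalClosure _
  refine mem_of_isCompactOperator hclosed (he.rankOne_mem_of_isClosed hclosed fun z w => ?_) hT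
  obtain ⟨f, hf⟩ := exists_schwartz_eq_crossSymbol σ Φ w z
  exact Submodule.le_topologicalClosure _
    ⟨_, hF.const_mul_mem _ (hf ▸ hF.schwartz_mem f), he.hasSymbol_rankOne z w⟩

end IsQuantizer

end SymbolAlgebra

section FourierNormalization

variable {V : Type*} [NormedAddCommGroup V] [InnerProductSpace ℝ V] [FiniteDimensional ℝ V]
  [MeasurableSpace V] [BorelSpace V]

/-- The Fourier transform `p ↦ ∫ e^{i⟪p, u⟫} F(u) du`, in the normalization in which translations
by `p` in momentum space act by the phases `e^{i⟪p, u⟫}`. -/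
def angularFourier (F : V → ℂ) (p : V) : ℂ := ∫ u, phase ⟪p, u⟫_ℝ * F u

theorem angularFourier_eq_fourier (F : V → ℂ) (p : V) :
    angularFourier F p = 𝓕 F (-(2 * Real.pi)⁻¹ • p) := by
  rw [angularFourier, neg_smul]
  convert integral_phase_mul_eq_fourier F (InnerProductSpace.toDual ℝ V p) using 4
  · rfl
  · rw [LinearIsometryEquiv.symm_apply_apply]

theorem integral_comp_neg_two_pi_inv_smul (G : V → ℂ) :
    ∫ p, G (-(2 * Real.pi)⁻¹ • p) = ((2 * Real.pi) ^ Module.finrank ℝ V : ℝ) * ∫ p, G p := by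
  rw [Measure.integral_comp_smul, abs_inv, abs_pow, abs_neg, abs_of_pos (by positivity), inv_pow,
    inv_inv, Complex.real_smul]

theorem integral_angularFourier_mul_conj (F G : 𝓢(V, ℂ)) :
    ∫ p, angularFourier F p * starRingEnd ℂ (angularFourier G p) =
      ((2 * Real.pi) ^ Module.finrank ℝ V : ℝ) * ∫ u, F u * starRingEnd ℂ (G u) := by
  simp_rw [angularFourier_eq_fourier]
  rw [integral_comp_neg_two_pi_inv_smul fun p => 𝓕 (F : V → ℂ) p * starRingEnd ℂ (𝓕 (G : V → ℂ) p)]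
  simp only [← SchwartzMap.fourier_coe, ← RCLike.inner_apply]
  rw [SchwartzMap.integral_inner_fourier_fourier]

theorem integral_phase_mul_angularFourier (F : 𝓢(V, ℂ)) (x : V) :
    ∫ p, phase (-⟪p, x⟫_ℝ) * angularFourier F p =
      ((2 * Real.pi) ^ Module.finrank ℝ V : ℝ) * F x := by
  let G (ξ : V) : ℂ :=
    Complex.exp (((2 * Real.pi * ⟪ξ, x⟫_ℝ : ℝ) : ℂ) * Complex.I) • 𝓕 (F : V → ℂ) ξ
  have hG (p : V) : phase (-⟪p, x⟫_ℝ) * angularFourier F p = G (-(2 * Real.pi)⁻¹ • p) := by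
    simp only [G, angularFourier_eq_fourier, smul_eq_mul, phase, mul_comm Complex.I,
      real_inner_smul_left]
    congr 4
    field_simp
  simp_rw [hG]
  rw [integral_comp_neg_two_pi_inv_smul, ← Real.fourierInv_eq', ← SchwartzMap.fourier_coe,
    ← SchwartzMap.fourierInv_coe, FourierTransform.fourierInv_fourier_eq]

end FourierNormalization

section HeisenbergTranslations

variable {V : Type*} [NormedAddCommGroup V] [InnerProductSpace ℝ V]

variable (V) in
/-- The symplectic form `(q, p), (q', p') ↦ ⟪p, q'⟫ - ⟪p', q⟫` of the phase space `V × V`. -/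
def symplecticForm : (V × V) →L[ℝ] (V × V) →L[ℝ] ℝ :=
  let pairing : (V × V) →L[ℝ] (V × V) →L[ℝ] ℝ :=
    (innerSL ℝ : V →L[ℝ] V →L[ℝ] ℝ).bilinearComp (.snd ℝ V V) (.fst ℝ V V)
  pairing - pairing.flip

theorem symplecticForm_apply (v w : V × V) :
    symplecticForm V v w = ⟪v.2, w.1⟫_ℝ - ⟪w.2, v.1⟫_ℝ := rfl

theorem symplecticForm_self (v : V × V) : symplecticForm V v v = 0 := by
  rw [symplecticForm_apply, sub_self]

theorem injective_symplecticForm_flip : Function.Injective (symplecticForm V).flip := by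
  refine (injective_iff_map_eq_zero _).2 fun w hw => ?_
  have h (v : V × V) : ⟪v.2, w.1⟫_ℝ - ⟪w.2, v.1⟫_ℝ = 0 := by
    simpa [symplecticForm_apply] using congr($hw v)
  exact Prod.ext (by simpa using h (0, w.1)) (by simpa using h (w.2, 0))

/-- The Heisenberg translation by `(q, p)` in phase space. -/
def weylShift (v : V × V) : 𝓢(V, ℂ) →L[ℂ] 𝓢(V, ℂ) :=
  phase (-(⟪v.2, v.1⟫_ℝ / 2)) • (SchwartzMap.smulLeftCLM ℂ fun u => phase (innerSL ℝ v.2 u)) ∘L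
    SchwartzMap.compSubConstCLM ℂ v.1

theorem weylShift_apply (v : V × V) (ψ : 𝓢(V, ℂ)) (u : V) :
    weylShift v ψ u = phase (⟪v.2, u⟫_ℝ - ⟪v.2, v.1⟫_ℝ / 2) * ψ (u - v.1) := by
  rw [weylShift, smul_apply, ContinuousLinearMap.comp_apply, smul_apply,
    SchwartzMap.smulLeftCLM_apply_apply (hasTemperateGrowth_phase_comp _),
    SchwartzMap.compSubConstCLM_apply, smul_eq_mul, smul_eq_mul, ← mul_assoc, ← phase_add,
    innerSL_apply_apply, neg_add_eq_sub]

theorem weylShift_zero (ψ : 𝓢(V, ℂ)) : weylShift 0 ψ = ψ := by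
  ext u; simp [weylShift_apply]

theorem weylShift_weylShift (v w : V × V) (ψ : 𝓢(V, ℂ)) :
    weylShift v (weylShift w ψ) = phase (symplecticForm V v w / 2) • weylShift (v + w) ψ := by
  ext u
  simp only [weylShift_apply, smul_apply, smul_eq_mul, Prod.fst_add, Prod.snd_add, sub_sub,
    ← mul_assoc, ← phase_add]
  congr 2
  simp only [symplecticForm_apply, inner_add_left, inner_add_right, inner_sub_right]
  ring

theorem weylShift_neg_weylShift (v : V × V) (ψ : 𝓢(V, ℂ)) :
    weylShift (-v) (weylShift v ψ) = ψ := by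
  rw [weylShift_weylShift, map_neg, neg_apply, symplecticForm_self, neg_zero, zero_div, phase_zero,
    one_smul, neg_add_cancel, weylShift_zero]

/-- The parity operator. -/
def reflect : 𝓢(V, ℂ) →L[ℂ] 𝓢(V, ℂ) :=
  SchwartzMap.compCLMOfContinuousLinearEquiv ℂ (ContinuousLinearEquiv.neg ℝ)

theorem reflect_apply (ψ : 𝓢(V, ℂ)) (u : V) : reflect ψ u = ψ (-u) := rfl

theorem reflect_reflect (ψ : 𝓢(V, ℂ)) : reflect (reflect ψ) = ψ := by
  ext u; simp only [reflect_apply, neg_neg]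

theorem reflect_weylShift (v : V × V) (ψ : 𝓢(V, ℂ)) :
    reflect (weylShift v ψ) = weylShift (-v) (reflect ψ) := by
  ext u
  simp only [weylShift_apply, reflect_apply, Prod.fst_neg, Prod.snd_neg, inner_neg_left,
    inner_neg_right, neg_neg]
  congr 2
  abel

variable [FiniteDimensional ℝ V] [MeasurableSpace V] [BorelSpace V]

/-- The embedding of the Schwartz space into `L²`. -/
def toL2 : 𝓢(V, ℂ) →L[ℂ] Lp ℂ 2 (volume : Measure V) := SchwartzMap.toLpCLM ℂ ℂ 2 volume

theorem inner_toL2_toL2 (φ ψ : 𝓢(V, ℂ)) :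
    ⟪toL2 φ, toL2 ψ⟫_ℂ = ∫ u, starRingEnd ℂ (φ u) * ψ u := by
  refine (SchwartzMap.inner_toL2_toL2_eq φ ψ volume).trans ?_
  simp only [RCLike.inner_apply, mul_comm]

theorem inner_weylShift_weylShift (v : V × V) (φ ψ : 𝓢(V, ℂ)) :
    ⟪toL2 (weylShift v φ), toL2 (weylShift v ψ)⟫_ℂ = ⟪toL2 φ, toL2 ψ⟫_ℂ := by
  rw [inner_toL2_toL2, inner_toL2_toL2,
    ← integral_sub_right_eq_self (fun u => starRingEnd ℂ (φ u) * ψ u) v.1]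
  refine integral_congr_ae (Eventually.of_forall fun u => ?_)
  simp only [weylShift_apply, map_mul, conj_phase]
  rw [mul_mul_mul_comm, ← phase_add, neg_add_cancel, phase_zero, one_mul]

theorem norm_weylShift (v : V × V) (ψ : 𝓢(V, ℂ)) : ‖toL2 (weylShift v ψ)‖ = ‖toL2 ψ‖ := by
  simp only [@norm_eq_sqrt_re_inner ℂ, inner_weylShift_weylShift]

theorem inner_weylShift_right (v : V × V) (φ ψ : 𝓢(V, ℂ)) :
    ⟪toL2 φ, toL2 (weylShift v ψ)⟫_ℂ = ⟪toL2 (weylShift (-v) φ), toL2 ψ⟫_ℂ := by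
  rw [← inner_weylShift_weylShift (-v) φ, weylShift_neg_weylShift]

theorem inner_reflect_right (φ ψ : 𝓢(V, ℂ)) :
    ⟪toL2 φ, toL2 (reflect ψ)⟫_ℂ = ⟪toL2 (reflect φ), toL2 ψ⟫_ℂ := by
  rw [inner_toL2_toL2, inner_toL2_toL2, ← integral_neg_eq_self]
  simp only [reflect_apply, neg_neg]

theorem norm_reflect (ψ : 𝓢(V, ℂ)) : ‖toL2 (reflect ψ)‖ = ‖toL2 ψ‖ := by
  simp only [@norm_eq_sqrt_re_inner ℂ, inner_reflect_right, reflect_reflect]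

end HeisenbergTranslations

section Ambiguity

variable {V : Type*} [NormedAddCommGroup V] [InnerProductSpace ℝ V]

/-- The complex conjugate of a Schwartz function. -/
def conjSchwartz (φ : 𝓢(V, ℂ)) : 𝓢(V, ℂ) :=
  SchwartzMap.postcompCLM (𝕜 := ℝ) (Complex.conjCLE : ℂ →L[ℝ] ℂ) φ

theorem conjSchwartz_apply (φ : 𝓢(V, ℂ)) (u : V) : conjSchwartz φ u = starRingEnd ℂ (φ u) := rfl

/-- The correlation density `u ↦ conj (φ u) ψ (u - q)` of `φ` and a translate of `ψ`. -/
def correlation (φ ψ : 𝓢(V, ℂ)) (q : V) : 𝓢(V, ℂ) :=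
  SchwartzMap.pairing (𝕜 := ℝ) (ContinuousLinearMap.mul ℝ ℂ) (conjSchwartz φ)
    (SchwartzMap.compSubConstCLM ℝ q ψ)

theorem correlation_apply (φ ψ : 𝓢(V, ℂ)) (q u : V) :
    correlation φ ψ q u = starRingEnd ℂ (φ u) * ψ (u - q) := rfl

variable [FiniteDimensional ℝ V] [MeasurableSpace V] [BorelSpace V]

/-- The ambiguity function, or Fourier-Wigner transform, of two Schwartz functions: the matrix
coefficient of the Heisenberg translations. -/
def ambiguity (φ ψ : 𝓢(V, ℂ)) (v : V × V) : ℂ := ⟪toL2 φ, toL2 (weylShift v ψ)⟫_ℂ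

theorem ambiguity_eq_integral (φ ψ : 𝓢(V, ℂ)) (v : V × V) :
    ambiguity φ ψ v =
      ∫ u, starRingEnd ℂ (φ u) * (phase (⟪v.2, u⟫_ℝ - ⟪v.2, v.1⟫_ℝ / 2) * ψ (u - v.1)) := by
  simp only [ambiguity, inner_toL2_toL2, weylShift_apply]

theorem ambiguity_eq_angularFourier (φ ψ : 𝓢(V, ℂ)) (v : V × V) :
    ambiguity φ ψ v =
      phase (-(⟪v.2, v.1⟫_ℝ / 2)) * angularFourier (correlation φ ψ v.1) v.2 := by
  rw [ambiguity_eq_integral, angularFourier, ← integral_const_mul]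
  refine integral_congr_ae (Eventually.of_forall fun u => ?_)
  simp only [correlation_apply, sub_eq_add_neg, phase_add]
  ring

theorem ambiguity_eq_windowedFourier (φ ψ : 𝓢(V, ℂ)) (v : V × V) :
    ambiguity φ ψ v =
      phase (-(⟪v.2, v.1⟫_ℝ / 2)) * windowedFourier (innerSL ℝ) (conjSchwartz φ) ψ (-v.1) v.2 := by
  have hpair (u : V) : (innerSL ℝ : V →L[ℝ] V →L[ℝ] ℝ) u v.2 = ⟪v.2, u⟫_ℝ := real_inner_comm _ _
  rw [ambiguity_eq_angularFourier, angularFourier, windowedFourier]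
  congr 1
  refine integral_congr_ae (Eventually.of_forall fun u => ?_)
  simp only [correlation_apply, conjSchwartz_apply, hpair, neg_add_eq_sub]
  ring

theorem norm_ambiguity_le (φ ψ : 𝓢(V, ℂ)) (v : V × V) :
    ‖ambiguity φ ψ v‖ ≤ ‖toL2 φ‖ * ‖toL2 ψ‖ := by
  rw [← norm_weylShift v ψ]
  exact norm_inner_le_norm _ _

theorem conj_ambiguity (φ ψ : 𝓢(V, ℂ)) (v : V × V) :
    starRingEnd ℂ (ambiguity φ ψ v) = ambiguity ψ φ (-v) := by
  rw [ambiguity, ambiguity, inner_conj_symm, inner_weylShift_right, neg_neg]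

theorem continuous_ambiguity (φ ψ : 𝓢(V, ℂ)) : Continuous (ambiguity φ ψ) := by
  have hW := continuous_windowedFourier (σ := innerSL ℝ) (Φ := conjSchwartz φ)
    (isSymbol_schwartz ψ 0 0)
  rw [funext (ambiguity_eq_windowedFourier φ ψ)]
  have hphase : Continuous fun v : V × V => phase (-(⟪v.2, v.1⟫_ℝ / 2)) := by fun_prop
  have hneg : Continuous fun v : V × V => (-v.1, v.2) := by fun_prop
  have hcomp := hW.comp hneg
  exact hphase.mul hcomp

theorem integrable_ambiguity (φ ψ : 𝓢(V, ℂ)) : Integrable (ambiguity φ ψ) := by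
  have hinj : Function.Injective (innerSL ℝ : V →L[ℝ] V →L[ℝ] ℝ).flip := fun x y h =>
    ext_inner_left ℝ fun u => congr($h u)
  obtain ⟨C, -, hC⟩ := exists_norm_windowedFourier_le (Φ := conjSchwartz φ) hinj
    (neg_nonpos.2 (by positivity))
    (isSymbol_schwartz ψ (-(Module.finrank ℝ V + 1 : ℝ)) 0) (Module.finrank ℝ V + 1)
  have horder : Integrable (orderFun (-(Module.finrank ℝ V + 1 : ℝ)) : V → ℝ) :=
    integrable_rpow_neg_one_add_norm_sq (by linarith)
  refine ((horder.mul_prod integrable_decay).const_mul C).mono'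
    (continuous_ambiguity φ ψ).aestronglyMeasurable (Eventually.of_forall fun v => ?_)
  rw [ambiguity_eq_windowedFourier, norm_mul, norm_phase, one_mul]
  simpa only [orderFun, norm_neg] using hC (-v.1) v.2

theorem integrable_ambiguity_mul_conj_ambiguity (φ ψ β α : 𝓢(V, ℂ)) :
    Integrable fun v => ambiguity φ ψ v * starRingEnd ℂ (ambiguity β α v) :=
  (integrable_ambiguity φ ψ).mul_bdd
    (Complex.continuous_conj.comp (continuous_ambiguity β α)).aestronglyMeasurable
    (Eventually.of_forall fun v => by simpa using norm_ambiguity_le β α v)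

theorem integral_ambiguity_mul_conj_momentum (φ ψ β α : 𝓢(V, ℂ)) (q : V) :
    ∫ p, ambiguity φ ψ (q, p) * starRingEnd ℂ (ambiguity β α (q, p)) =
      ((2 * Real.pi) ^ Module.finrank ℝ V : ℝ) *
        ∫ u, (starRingEnd ℂ (φ u) * β u) * (starRingEnd ℂ (α (u - q)) * ψ (u - q)) := by
  have hphase (p : V) : ambiguity φ ψ (q, p) * starRingEnd ℂ (ambiguity β α (q, p)) =
      angularFourier (correlation φ ψ q) p *
        starRingEnd ℂ (angularFourier (correlation β α q) p) := by
    rw [ambiguity_eq_angularFourier, ambiguity_eq_angularFourier, map_mul, mul_mul_mul_comm,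
      conj_phase, ← phase_add, add_neg_cancel, phase_zero, one_mul]
  simp_rw [hphase]
  rw [integral_angularFourier_mul_conj]
  simp only [correlation_apply, map_mul, Complex.conj_conj]
  congr! 3 with u
  ring

theorem integrable_mul_translate {F G : V → ℂ} (hF : Integrable F) (hG : Integrable G) :
    Integrable (fun v : V × V => F v.2 * G (v.2 - v.1)) := by
  simpa [Measure.volume_eq_prod] using
    hF.convolution_integrand (ContinuousLinearMap.mul ℝ ℂ) hG.comp_neg

theorem integrable_conj_mul (φ ψ : 𝓢(V, ℂ)) :
    Integrable fun u => starRingEnd ℂ (φ u) * ψ u :=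
  (correlation φ ψ 0).integrable.congr
    (Eventually.of_forall fun u => by simp only [correlation_apply, sub_zero])

/-- Moyal's orthogonality relations for the Heisenberg translations. -/
theorem integral_ambiguity_mul_conj_ambiguity (φ ψ β α : 𝓢(V, ℂ)) :
    ∫ v, ambiguity φ ψ v * starRingEnd ℂ (ambiguity β α v) =
      ((2 * Real.pi) ^ Module.finrank ℝ V : ℝ) *
        (⟪toL2 φ, toL2 β⟫_ℂ * ⟪toL2 α, toL2 ψ⟫_ℂ) := by
  rw [Measure.volume_eq_prod, integral_prod _ (integrable_ambiguity_mul_conj_ambiguity φ ψ β α)]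
  simp_rw [integral_ambiguity_mul_conj_momentum]
  rw [integral_const_mul, integral_integral_swap
    (integrable_mul_translate (integrable_conj_mul φ β) (integrable_conj_mul α ψ))]
  have htranslate (u : V) : ∫ q, starRingEnd ℂ (α (u - q)) * ψ (u - q) =
      ∫ w, starRingEnd ℂ (α w) * ψ w :=
    integral_sub_left_eq_self (fun w => starRingEnd ℂ (α w) * ψ w) volume u
  simp_rw [integral_const_mul, htranslate]
  rw [integral_mul_const, inner_toL2_toL2, inner_toL2_toL2]

theorem integral_ambiguity_mul_phase_momentum (φ ψ : 𝓢(V, ℂ)) (q : V) (w : V × V) :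
    ∫ p, ambiguity φ ψ (q, p) * phase (-symplecticForm V (q, p) w) =
      ((2 * Real.pi) ^ Module.finrank ℝ V : ℝ) *
        (phase ⟪w.2, q⟫_ℝ * correlation φ ψ q (w.1 + (2⁻¹ : ℝ) • q)) := by
  rw [mul_left_comm, ← integral_phase_mul_angularFourier, ← integral_const_mul]
  refine integral_congr_ae (Eventually.of_forall fun p => ?_)
  simp only [ambiguity_eq_angularFourier]
  rw [mul_right_comm, ← mul_assoc, ← phase_add, ← phase_add]
  congr 2
  simp only [symplecticForm_apply, inner_add_right, inner_smul_right]
  ring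

/-- The symplectic Fourier transform of an ambiguity function is a Wigner function. -/
theorem integral_ambiguity_mul_phase_symplecticForm (φ ψ : 𝓢(V, ℂ)) (w : V × V) :
    ∫ v, ambiguity φ ψ v * phase (-symplecticForm V v w) =
      ((4 * Real.pi) ^ Module.finrank ℝ V : ℝ) * ambiguity φ (reflect ψ) ((2 : ℝ) • w) := by
  have hint : Integrable fun v => ambiguity φ ψ v * phase (-symplecticForm V v w) :=
    (integrable_ambiguity φ ψ).mul_bdd (Continuous.aestronglyMeasurable (by
      have hσ := (symplecticForm V).continuous₂
      fun_prop)) (Eventually.of_forall fun v => (norm_phase _).le)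
  rw [Measure.volume_eq_prod, integral_prod _ hint]
  simp_rw [integral_ambiguity_mul_phase_momentum]
  let H (t : V) : ℂ :=
    starRingEnd ℂ (φ (w.1 + t)) * weylShift ((2 : ℝ) • w) (reflect ψ) (w.1 + t)
  have hH (q : V) : phase ⟪w.2, q⟫_ℝ * correlation φ ψ q (w.1 + (2⁻¹ : ℝ) • q) =
      H ((2⁻¹ : ℝ) • q) := by
    simp only [H, correlation_apply, weylShift_apply, reflect_apply, Prod.smul_fst, Prod.smul_snd]
    rw [mul_left_comm]
    congr 3
    · simp only [real_inner_smul_left, real_inner_smul_right, inner_add_right]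
      ring
    · module
  simp_rw [hH]
  rw [integral_const_mul, Measure.integral_comp_smul,
    integral_add_left_eq_self (fun u => starRingEnd ℂ (φ u) *
      weylShift ((2 : ℝ) • w) (reflect ψ) u) w.1, ambiguity, inner_toL2_toL2, Complex.real_smul,
    ← mul_assoc, ← Complex.ofReal_mul, abs_of_pos (by positivity), inv_pow, inv_inv, ← mul_pow]
  ring_nf

end Ambiguity

section Gaussian

variable {E : Type*} [NormedAddCommGroup E] [NormedSpace ℝ E]

theorem exists_norm_iteratedFDeriv_exp_neg_le {Q : E → ℝ} (hQ : Q.HasTemperateGrowth) (n : ℕ) :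
    ∃ (k : ℕ) (C : ℝ), 0 ≤ C ∧ ∀ x, ‖iteratedFDeriv ℝ n (fun y => Real.exp (-Q y)) x‖ ≤
      C * ((1 + ‖x‖) ^ k * Real.exp (-Q x)) := by
  obtain ⟨k, C, hC0, hC⟩ := hQ.neg.norm_iteratedFDeriv_le_uniform n
  refine ⟨k * n, n.factorial * (1 + C) ^ n, by positivity, fun x => ?_⟩
  have hone : 1 ≤ (1 + C) * (1 + ‖x‖) ^ k :=
    one_le_mul_of_one_le_of_one_le (by linarith) (one_le_pow₀ (by linarith [norm_nonneg x]))
  have hexp (i : ℕ) (_ : i ≤ n) : ‖iteratedFDeriv ℝ i Real.exp (-Q x)‖ ≤ Real.exp (-Q x) := by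
    rw [norm_iteratedFDeriv_eq_norm_iteratedDeriv, iteratedDeriv_eq_iterate, Real.iter_deriv_exp,
      Real.norm_eq_abs, Real.abs_exp]
  have hQn (i : ℕ) (hi : 1 ≤ i) (hin : i ≤ n) :
      ‖iteratedFDeriv ℝ i (-Q) x‖ ≤ ((1 + C) * (1 + ‖x‖) ^ k) ^ i :=
    calc _ ≤ C * (1 + ‖x‖) ^ k := hC i hin x
      _ ≤ (1 + C) * (1 + ‖x‖) ^ k := by gcongr; linarith
      _ ≤ _ := le_self_pow₀ hone (by lia)
  calc _ ≤ n.factorial * Real.exp (-Q x) * ((1 + C) * (1 + ‖x‖) ^ k) ^ n :=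
        norm_iteratedFDeriv_comp_le Real.contDiff_exp hQ.neg.1 (mod_cast le_top) x hexp hQn
    _ = _ := by rw [mul_pow, ← pow_mul]; ring

theorem one_add_pow_mul_exp_neg_le {c r t : ℝ} (hc : 0 < c) (hr : 0 ≤ r) (h : c * r ≤ 1 + t)
    (k : ℕ) : (1 + r) ^ k * Real.exp (-t) ≤ k.factorial * Real.exp (c + 1) / c ^ k := by
  have hpow := Real.pow_div_factorial_le_exp (c * (1 + r)) (by positivity) k
  have hexp : Real.exp (c * (1 + r)) ≤ Real.exp (c + 1) * Real.exp t := by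
    rw [← Real.exp_add]
    exact Real.exp_le_exp.2 (by linarith)
  have hle := hpow.trans hexp
  rw [div_le_iff₀ (by positivity), mul_pow] at hle
  rw [Real.exp_neg, ← div_eq_mul_inv, div_le_div_iff₀ (by positivity) (by positivity)]
  linarith

/-- The Schwartz function `exp (-Q)`, for `Q` of temperate growth growing at least linearly. -/
def expNeg (Q : E → ℝ) (hQ : Q.HasTemperateGrowth) (h : ∃ c > 0, ∀ x, c * ‖x‖ ≤ 1 + Q x) :
    𝓢(E, ℝ) where
  toFun x := Real.exp (-Q x)
  smooth' := hQ.1.neg.exp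
  decay' k n := by
    obtain ⟨c, hc, hQc⟩ := h
    obtain ⟨l, C, hC0, hC⟩ := exists_norm_iteratedFDeriv_exp_neg_le hQ n
    refine ⟨C * ((k + l).factorial * Real.exp (c + 1) / c ^ (k + l)), fun x => ?_⟩
    calc _ ≤ (1 + ‖x‖) ^ k * (C * ((1 + ‖x‖) ^ l * Real.exp (-Q x))) := by
          gcongr
          · linarith
          · exact hC x
      _ = C * ((1 + ‖x‖) ^ (k + l) * Real.exp (-Q x)) := by ring
      _ ≤ _ := by gcongr; exact one_add_pow_mul_exp_neg_le hc (norm_nonneg x) (hQc x) (k + l)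

end Gaussian

section GroundState

variable {V : Type*} [NormedAddCommGroup V] [InnerProductSpace ℝ V]

variable (V) in
/-- The Gaussian `exp (-‖u‖² / 2)`, the ground state of the harmonic oscillator. -/
def groundState : 𝓢(V, ℂ) :=
  SchwartzMap.postcompCLM Complex.ofRealCLM <| expNeg (fun u : V => ‖u‖ ^ 2 * 2⁻¹)
    ((Function.hasTemperateGrowth_norm_sq V).mul (.const 2⁻¹))
    ⟨1, one_pos, fun u => by nlinarith [sq_nonneg (‖u‖ - 1)]⟩

theorem groundState_apply (u : V) : groundState V u = Real.exp (-(‖u‖ ^ 2 * 2⁻¹)) := rfl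

theorem reflect_groundState : reflect (groundState V) = groundState V := by
  ext u
  simp only [reflect_apply, groundState_apply, norm_neg]

theorem groundState_ne_zero : groundState V ≠ 0 := fun h => by
  simpa [groundState_apply] using congr($h 0)

theorem hasTemperateGrowth_norm_sq_add_norm_sq :
    Function.HasTemperateGrowth fun v : V × V => ‖v.1‖ ^ 2 + ‖v.2‖ ^ 2 :=
  ((Function.hasTemperateGrowth_norm_sq V).comp
    (ContinuousLinearMap.fst ℝ V V).hasTemperateGrowth).add
    ((Function.hasTemperateGrowth_norm_sq V).comp
      (ContinuousLinearMap.snd ℝ V V).hasTemperateGrowth)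

variable (V) in
/-- The Gaussian on phase space that is, up to normalization, the Wigner function of
`groundState V`. -/
def groundWigner : 𝓢(V × V, ℂ) :=
  ((Real.pi : ℂ) ^ (Module.finrank ℝ V / 2 : ℂ)) • (SchwartzMap.postcompCLM Complex.ofRealCLM <|
    expNeg (fun v : V × V => ‖v.1‖ ^ 2 + ‖v.2‖ ^ 2) hasTemperateGrowth_norm_sq_add_norm_sq
      ⟨1, one_pos, fun v => by
        rcases max_cases ‖v.1‖ ‖v.2‖ with ⟨h, _⟩ | ⟨h, _⟩ <;> rw [Prod.norm_def, h] <;>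
          nlinarith [sq_nonneg (‖v.1‖ - 1), sq_nonneg (‖v.2‖ - 1)]⟩)

theorem groundWigner_apply (v : V × V) :
    groundWigner V v = (Real.pi : ℂ) ^ (Module.finrank ℝ V / 2 : ℂ) *
      Real.exp (-(‖v.1‖ ^ 2 + ‖v.2‖ ^ 2)) := rfl

theorem groundWigner_neg (v : V × V) : groundWigner V (-v) = groundWigner V v := by
  simp only [groundWigner_apply, Prod.fst_neg, Prod.snd_neg, norm_neg]

theorem conj_groundState_mul_weylShift_groundState (v : V × V) (u : V) :
    starRingEnd ℂ (groundState V (u + v.1)) *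
        weylShift ((2 : ℝ) • v) (groundState V) (u + v.1) =
      Real.exp (-‖v.1‖ ^ 2) *
        Complex.exp (-1 * (‖u‖ : ℂ) ^ 2 + 2 * Complex.I * (⟪v.2, u⟫_ℝ : ℝ)) := by
  have hmod : -(‖u + v.1‖ ^ 2 * 2⁻¹) + -(‖u + v.1 - (2 : ℝ) • v.1‖ ^ 2 * 2⁻¹) =
      -‖v.1‖ ^ 2 + -1 * ‖u‖ ^ 2 := by
    rw [show u + v.1 - (2 : ℝ) • v.1 = u - v.1 by module]
    linarith [parallelogram_law_with_norm ℝ u v.1, sq ‖u + v.1‖, sq ‖u - v.1‖, sq ‖u‖, sq ‖v.1‖]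
  have harg : ⟪(2 : ℝ) • v.2, u + v.1⟫_ℝ - ⟪(2 : ℝ) • v.2, (2 : ℝ) • v.1⟫_ℝ / 2 =
      2 * ⟪v.2, u⟫_ℝ := by
    simp only [real_inner_smul_left, real_inner_smul_right, inner_add_right]
    ring
  have hexp : (Real.exp (-(‖u + v.1‖ ^ 2 * 2⁻¹)) : ℂ) *
      Real.exp (-(‖u + v.1 - (2 : ℝ) • v.1‖ ^ 2 * 2⁻¹)) =
      Real.exp (-‖v.1‖ ^ 2) * Complex.exp (-1 * (‖u‖ : ℂ) ^ 2) := by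
    rw [← Complex.ofReal_mul, ← Real.exp_add, hmod, Real.exp_add]
    push_cast
    rfl
  simp only [weylShift_apply, groundState_apply, Complex.conj_ofReal, Prod.smul_fst, Prod.smul_snd,
    harg]
  rw [mul_left_comm, hexp, Complex.exp_add, phase, Complex.ofReal_mul, Complex.ofReal_ofNat]
  ring_nf

variable [FiniteDimensional ℝ V] [MeasurableSpace V] [BorelSpace V]

theorem ambiguity_groundState_groundState (v : V × V) :
    ambiguity (groundState V) (groundState V) ((2 : ℝ) • v) = groundWigner V v := by
  rw [ambiguity, inner_toL2_toL2, ← integral_add_right_eq_self _ v.1]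
  simp_rw [conj_groundState_mul_weylShift_groundState]
  rw [integral_const_mul, GaussianFourier.integral_cexp_neg_mul_sq_norm_add (by simp),
    groundWigner_apply, div_one, mul_left_comm, Complex.ofReal_exp, ← Complex.exp_add, mul_pow,
    Complex.I_sq]
  push_cast
  ring_nf

end GroundState

section CoherentStates

theorem continuous_of_norm_eq_of_continuous_inner {X H : Type*} [TopologicalSpace X]
    [NormedAddCommGroup H] [InnerProductSpace ℂ H] {e : X → H} {r : ℝ} (hr : ∀ z, ‖e z‖ = r)
    (he : ∀ w, Continuous fun z => ⟪e z, e w⟫_ℂ) : Continuous e := by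
  refine continuous_iff_continuousAt.2 fun w => tendsto_iff_norm_sub_tendsto_zero.2 ?_
  have hsq (z : X) : ‖e z - e w‖ = √(r ^ 2 - 2 * RCLike.re ⟪e z, e w⟫_ℂ + r ^ 2) := by
    rw [← Real.sqrt_sq (norm_nonneg _), @norm_sub_sq ℂ, hr, hr]
  have hcont : Continuous fun z => ‖e z - e w‖ := by
    simp_rw [hsq]
    have hre := RCLike.continuous_re.comp (he w)
    exact ((continuous_const.sub (hre.const_mul 2)).add continuous_const).sqrt
  simpa using hcont.tendsto w

variable {V : Type*} [NormedAddCommGroup V] [InnerProductSpace ℝ V]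

/-- The coherent state at the point `v` of phase space. -/
def coherentState (v : V × V) : 𝓢(V, ℂ) := weylShift v (groundState V)

variable [FiniteDimensional ℝ V] [MeasurableSpace V] [BorelSpace V]

theorem denseRange_toL2 : DenseRange (toL2 : 𝓢(V, ℂ) → Lp ℂ 2 (volume : Measure V)) :=
  SchwartzMap.denseRange_toLpCLM (by simp)

theorem toL2_groundState_ne_zero : toL2 (groundState V) ≠ 0 := fun h =>
  groundState_ne_zero <| SchwartzMap.injective_toLp 2 volume <|
    h.trans (map_zero toL2).symm

theorem norm_coherentState (v : V × V) :
    ‖toL2 (coherentState v)‖ = ‖toL2 (groundState V)‖ :=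
  norm_weylShift v _

theorem inner_toL2_coherentState (ψ : 𝓢(V, ℂ)) (v : V × V) :
    ⟪toL2 ψ, toL2 (coherentState v)⟫_ℂ = ambiguity ψ (groundState V) v := rfl

theorem inner_coherentState_toL2 (ψ : 𝓢(V, ℂ)) (v : V × V) :
    ⟪toL2 (coherentState v), toL2 ψ⟫_ℂ =
      starRingEnd ℂ (ambiguity ψ (groundState V) v) := by
  rw [← inner_toL2_coherentState, inner_conj_symm]

theorem integrable_inner_coherentState (ψ : 𝓢(V, ℂ)) :
    Integrable fun v : V × V => ⟪toL2 (coherentState v), toL2 ψ⟫_ℂ := by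
  simp_rw [inner_coherentState_toL2]
  exact (Complex.conjCLE : ℂ →L[ℝ] ℂ).integrable_comp (integrable_ambiguity ψ (groundState V))

theorem continuous_coherentState : Continuous fun v : V × V => toL2 (coherentState v) := by
  refine continuous_of_norm_eq_of_continuous_inner norm_coherentState fun w => ?_
  simp_rw [inner_coherentState_toL2]
  exact Complex.continuous_conj.comp (continuous_ambiguity _ _)

theorem integral_inner_coherentState_mul_inner_coherentState (φ ψ : 𝓢(V, ℂ)) :
    ∫ v : V × V, ⟪toL2 φ, toL2 (coherentState v)⟫_ℂ * ⟪toL2 (coherentState v), toL2 ψ⟫_ℂ =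
      ((2 * Real.pi) ^ Module.finrank ℝ V * ‖toL2 (groundState V)‖ ^ 2 : ℝ) *
        ⟪toL2 φ, toL2 ψ⟫_ℂ := by
  simp_rw [inner_coherentState_toL2, inner_toL2_coherentState]
  have hnorm : ⟪toL2 (groundState V), toL2 (groundState V)⟫_ℂ =
      (‖toL2 (groundState V)‖ ^ 2 : ℝ) := by
    rw [inner_self_eq_norm_sq_to_K, Complex.ofReal_pow]
    rfl
  rw [integral_ambiguity_mul_conj_ambiguity, hnorm, Complex.ofReal_mul]
  ring

end CoherentStates

section DisplacedParity

variable {V : Type*} [NormedAddCommGroup V] [InnerProductSpace ℝ V] [FiniteDimensional ℝ V]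
  [MeasurableSpace V] [BorelSpace V]

/-- The parity operator at the point `v` of phase space. -/
def displacedParity (v : V × V) :
    Lp ℂ 2 (volume : Measure V) →L[ℂ] Lp ℂ 2 (volume : Measure V) :=
  (toL2 ∘L weylShift ((2 : ℝ) • v) ∘L reflect).toLinearMap.extendOfNorm toL2.toLinearMap

theorem displacedParity_toL2 (v : V × V) (ψ : 𝓢(V, ℂ)) :
    displacedParity v (toL2 ψ) = toL2 (weylShift ((2 : ℝ) • v) (reflect ψ)) :=
  LinearMap.extendOfNorm_eq denseRange_toL2 ⟨1, fun φ => by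
    rw [one_mul]
    exact ((norm_weylShift _ _).trans (norm_reflect φ)).le⟩ ψ

theorem inner_displacedParity (v : V × V) (φ ψ : 𝓢(V, ℂ)) :
    ⟪toL2 φ, displacedParity v (toL2 ψ)⟫_ℂ = ambiguity φ (reflect ψ) ((2 : ℝ) • v) := by
  rw [displacedParity_toL2, ambiguity]

theorem conj_inner_displacedParity (v : V × V) (φ ψ : 𝓢(V, ℂ)) :
    starRingEnd ℂ ⟪toL2 φ, displacedParity v (toL2 ψ)⟫_ℂ =
      ⟪toL2 ψ, displacedParity v (toL2 φ)⟫_ℂ := by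
  rw [inner_displacedParity, conj_ambiguity, ambiguity, ← inner_reflect_right, reflect_weylShift,
    neg_neg, displacedParity_toL2]

theorem inner_coherentState_displacedParity (x v w : V × V) :
    ⟪toL2 (coherentState v), displacedParity x (toL2 (coherentState w))⟫_ℂ =
      phase (symplecticForm V x (v - w) + symplecticForm V v w / 2) *
        groundWigner V (x - (2⁻¹ : ℝ) • (v + w)) := by
  have hmid : -v + (2 : ℝ) • x + -w = (2 : ℝ) • (x - (2⁻¹ : ℝ) • (v + w)) := by module
  rw [displacedParity_toL2, coherentState, ← neg_neg v, ← inner_weylShift_right, coherentState,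
    reflect_weylShift, reflect_groundState, neg_neg, weylShift_weylShift, toL2.map_smul,
    inner_smul_right, weylShift_weylShift, toL2.map_smul, inner_smul_right, hmid,
    ← ambiguity, ambiguity_groundState_groundState, ← mul_assoc, ← phase_add]
  congr 2
  simp only [symplecticForm_apply, Prod.fst_add, Prod.snd_add, Prod.fst_sub, Prod.snd_sub,
    Prod.fst_neg, Prod.snd_neg, Prod.smul_fst, Prod.smul_snd, inner_add_left, inner_add_right,
    inner_sub_left, inner_sub_right, inner_neg_left, inner_neg_right, real_inner_smul_left,
    real_inner_smul_right]
  ring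

theorem integral_inner_displacedParity_mul_inner_displacedParity (φ ψ α β : 𝓢(V, ℂ)) :
    ∫ v, ⟪toL2 φ, displacedParity v (toL2 ψ)⟫_ℂ *
        ⟪toL2 α, displacedParity v (toL2 β)⟫_ℂ =
      ((Real.pi / 2) ^ Module.finrank ℝ V : ℝ) *
        (⟪toL2 φ, toL2 β⟫_ℂ * ⟪toL2 α, toL2 ψ⟫_ℂ) := by
  simp_rw [← conj_inner_displacedParity _ β α, inner_displacedParity]
  rw [Measure.integral_comp_smul volume
    (fun v => ambiguity φ (reflect ψ) v * starRingEnd ℂ (ambiguity β (reflect α) v)),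
    integral_ambiguity_mul_conj_ambiguity, ← inner_reflect_right, reflect_reflect,
    Complex.real_smul, Module.finrank_prod, ← mul_assoc, ← Complex.ofReal_mul]
  congr 2
  rw [abs_of_pos (by positivity), ← two_mul, pow_mul, ← inv_pow, ← mul_pow]
  ring_nf

end DisplacedParity

section PhaseSpaceQuantizer

variable {E V : Type*} [NormedAddCommGroup E] [InnerProductSpace ℝ E] [NormedAddCommGroup V]
  [InnerProductSpace ℝ V]

/-- The canonical symplectic form in the phase-space coordinates `L`. -/
def coordinateForm (L : E ≃L[ℝ] V × V) : E →L[ℝ] E →L[ℝ] ℝ :=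
  (symplecticForm V).bilinearComp (L : E →L[ℝ] V × V) (L : E →L[ℝ] V × V)

theorem isSymplectic_coordinateForm (L : E ≃L[ℝ] V × V) : IsSymplectic (coordinateForm L) where
  self_eq_zero x := symplecticForm_self (L x)
  injective_flip x y h := L.injective <| injective_symplecticForm_flip <|
    ContinuousLinearMap.ext fun v => by simpa [coordinateForm] using congr($h (L.symm v))

variable [FiniteDimensional ℝ V]

/-- The Wigner function of the ground state in the phase-space coordinates `L`. -/
def coordinateWigner (L : E ≃L[ℝ] V × V) : 𝓢(E, ℂ) :=
  SchwartzMap.compCLMOfContinuousLinearEquiv ℂ L (groundWigner V)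

variable [MeasurableSpace V] [BorelSpace V] (L : E ≃L[ℝ] V × V)

theorem inner_coherentState_displacedParity_coordinates (x z w : E) :
    ⟪toL2 (coherentState (L z)), displacedParity (L x) (toL2 (coherentState (L w)))⟫_ℂ =
      crossSymbol (coordinateForm L) (coordinateWigner L) z w x := by
  rw [inner_coherentState_displacedParity, crossSymbol]
  simp [coordinateForm, coordinateWigner]

variable [FiniteDimensional ℝ E] [MeasurableSpace E] [BorelSpace E]

theorem integrable_inner_coherentState_coordinates (ψ : 𝓢(V, ℂ)) :
    Integrable fun z => ⟪toL2 (coherentState (L z)), toL2 ψ⟫_ℂ :=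
  (integrable_comp_continuousLinearEquiv_iff L).2 (integrable_inner_coherentState ψ)

theorem memLp_inner_coherentState_coordinates (ψ : 𝓢(V, ℂ)) :
    MemLp (fun z => ⟪toL2 (coherentState (L z)), toL2 ψ⟫_ℂ) 2 := by
  have hint := integrable_inner_coherentState_coordinates L ψ
  rw [memLp_two_iff_integrable_sq_norm hint.aestronglyMeasurable]
  simp_rw [sq]
  refine hint.norm.mul_bdd (c := ‖toL2 (groundState V)‖ * ‖toL2 ψ‖)
    hint.aestronglyMeasurable.norm (Eventually.of_forall fun z => ?_)
  rw [norm_norm, ← norm_coherentState (L z)]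
  exact norm_inner_le_norm _ _

theorem isTightFrame_coherentState :
    IsTightFrame (fun z => toL2 (coherentState (L z)))
      (jacobian L * ((2 * Real.pi) ^ Module.finrank ℝ V * ‖toL2 (groundState V)‖ ^ 2)) := by
  have hnorm : 0 < ‖toL2 (groundState V)‖ := norm_pos_iff.2 toL2_groundState_ne_zero
  have hjac := jacobian_pos L
  refine .of_denseRange denseRange_toL2 (continuous_coherentState.comp L.continuous)
    (by positivity) (memLp_inner_coherentState_coordinates L) fun φ ψ => ?_
  rw [integral_comp_continuousLinearEquiv L fun v =>
    ⟪toL2 φ, toL2 (coherentState v)⟫_ℂ * ⟪toL2 (coherentState v), toL2 ψ⟫_ℂ,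
    integral_inner_coherentState_mul_inner_coherentState, ← mul_assoc, ← Complex.ofReal_mul]

theorem isQuantizer_displacedParity :
    IsQuantizer (coordinateForm L) (coordinateWigner L) (fun z => toL2 (coherentState (L z)))
      (fun x => displacedParity (L x))
      (jacobian L * ((2 * Real.pi) ^ Module.finrank ℝ V * ‖toL2 (groundState V)‖ ^ 2))
      (jacobian L * (Real.pi / 2) ^ Module.finrank ℝ V) where
  toIsTightFrame := isTightFrame_coherentState L
  symplectic := isSymplectic_coordinateForm L
  even x := by simp [coordinateWigner, groundWigner_neg]
  exists_norm_le := ⟨_, fun z => (norm_coherentState (L z)).le⟩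
  integrable_inner z := integrable_inner_coherentState_coordinates L _
  inner_apply := inner_coherentState_displacedParity_coordinates L
  orthogonality_pos := mul_pos (jacobian_pos L) (by positivity)
  integral_crossSymbol_mul_crossSymbol z w a b := by
    simp_rw [← inner_coherentState_displacedParity_coordinates]
    rw [integral_comp_continuousLinearEquiv L fun v =>
      ⟪toL2 (coherentState (L z)), displacedParity v (toL2 (coherentState (L w)))⟫_ℂ *
        ⟪toL2 (coherentState (L a)), displacedParity v (toL2 (coherentState (L b)))⟫_ℂ,
      integral_inner_displacedParity_mul_inner_displacedParity, ← mul_assoc,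
      ← Complex.ofReal_mul]

end PhaseSpaceQuantizer

section WeylOperators

variable {θ₁₂ θ₃₄ : ℝ} (h₁₂ : θ₁₂ ≠ 0) (h₃₄ : θ₃₄ ≠ 0)

/-- The position and momentum components of a point of `ℝ⁴`; dividing by the noncommutativity
parameters makes the coordinate operators canonical. -/
def phaseEquiv : R4 ≃L[ℝ] R2 × R2 :=
  LinearEquiv.toContinuousLinearEquiv
    { toFun := fun x => (!₂[x 0, x 2], !₂[x 1 / θ₁₂, x 3 / θ₃₄])
      invFun := fun v => !₂[v.1 0, θ₁₂ * v.2 0, v.1 1, θ₃₄ * v.2 1]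
      map_add' := fun x y => by
        ext i <;> fin_cases i <;> simp [add_div]
      map_smul' := fun c x => by
        ext i <;> fin_cases i <;> simp [mul_div_assoc]
      left_inv := fun x => by
        ext i
        fin_cases i <;> simp [mul_div_cancel₀, h₁₂, h₃₄]
      right_inv := fun v => by
        ext i
        · fin_cases i <;> simp
        · fin_cases i <;> simp [h₁₂, h₃₄] }

theorem phaseEquiv_apply (x : R4) :
    phaseEquiv h₁₂ h₃₄ x = (!₂[x 0, x 2], !₂[x 1 / θ₁₂, x 3 / θ₃₄]) := rfl

/-- The phase-space displacement effected by `exp (i k·x̂)`. -/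
def frequencyEquiv : R4 ≃L[ℝ] R2 × R2 :=
  LinearEquiv.toContinuousLinearEquiv
    { toFun := fun k => (!₂[-(θ₁₂ * k 1), -(θ₃₄ * k 3)], !₂[k 0, k 2])
      invFun := fun v => !₂[v.2 0, -(v.1 0 / θ₁₂), v.2 1, -(v.1 1 / θ₃₄)]
      map_add' := fun x y => by
        ext i <;> fin_cases i <;> simp [mul_add, add_comm]
      map_smul' := fun c x => by
        ext i <;> fin_cases i <;> simp [mul_left_comm]
      left_inv := fun x => by
        ext i
        fin_cases i <;> simp [neg_div, h₁₂, h₃₄]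
      right_inv := fun v => by
        ext i
        · fin_cases i <;> simp [mul_div_cancel₀, h₁₂, h₃₄]
        · fin_cases i <;> simp }

theorem frequencyEquiv_apply (k : R4) :
    frequencyEquiv h₁₂ h₃₄ k = (!₂[-(θ₁₂ * k 1), -(θ₃₄ * k 3)], !₂[k 0, k 2]) := rfl

theorem expXHat_eq_weylShift (k : R4) (ψ : 𝓢(R2, ℂ)) (u : R2) :
    expXHat θ₁₂ θ₃₄ k ψ u = weylShift (frequencyEquiv h₁₂ h₃₄ k) ψ u := by
  rw [expXHat, weylShift_apply, ← phase, ← phase, ← phase_add, frequencyEquiv_apply]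
  congr 2
  · simp only [PiLp.inner_apply, RCLike.inner_apply, Real.ringHom_apply, Fin.sum_univ_two,
      Matrix.cons_val_zero, Matrix.cons_val_one, Matrix.cons_val_fin_one]
    ring
  · ext i
    fin_cases i <;> simp

theorem symplecticForm_frequencyEquiv_phaseEquiv (k x : R4) :
    symplecticForm R2 (frequencyEquiv h₁₂ h₃₄ k) (phaseEquiv h₁₂ h₃₄ x) = ∑ j, k j * x j := by
  simp only [symplecticForm_apply, frequencyEquiv_apply, phaseEquiv_apply, PiLp.inner_apply,
    RCLike.inner_apply, Real.ringHom_apply, Fin.sum_univ_two, Fin.sum_univ_four,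
    Matrix.cons_val_zero, Matrix.cons_val_one, Matrix.cons_val_fin_one]
  field_simp
  ring

/-- The constant relating `Δ̂(x)` to the parity operator at the point `x` of phase space. -/
def quantizerScale : ℂ :=
  ((2 * Real.pi)⁻¹ ^ 4 * (jacobian (frequencyEquiv h₁₂ h₃₄) * (4 * Real.pi) ^ 2) : ℝ)

theorem quantizerScale_ne_zero : quantizerScale h₁₂ h₃₄ ≠ 0 := by
  have hjac := jacobian_pos (frequencyEquiv h₁₂ h₃₄)
  exact Complex.ofReal_ne_zero.2 (by positivity)

theorem deltaHat_eq_inner_displacedParity (φ ψ : 𝓢(R2, ℂ)) (x : R4) :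
    deltaHat θ₁₂ θ₃₄ φ ψ x = quantizerScale h₁₂ h₃₄ *
      ⟪toL2 φ, displacedParity (phaseEquiv h₁₂ h₃₄ x) (toL2 ψ)⟫_ℂ := by
  let G (v : R2 × R2) : ℂ :=
    ambiguity φ ψ v * phase (-symplecticForm R2 v (phaseEquiv h₁₂ h₃₄ x))
  have hG (k : R4) : (∫ u : R2, starRingEnd ℂ (φ u) * expXHat θ₁₂ θ₃₄ k ψ u) *
      Complex.exp (-Complex.I * (∑ j, k j * x j : ℝ)) = G (frequencyEquiv h₁₂ h₃₄ k) := by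
    simp only [G, expXHat_eq_weylShift h₁₂ h₃₄, symplecticForm_frequencyEquiv_phaseEquiv,
      ambiguity, inner_toL2_toL2, phase, neg_mul, Complex.ofReal_neg, mul_neg]
  have hint : ∫ v, G v = _ := integral_ambiguity_mul_phase_symplecticForm φ ψ _
  rw [deltaHat, funext hG, integral_comp_continuousLinearEquiv, hint, inner_displacedParity,
    quantizerScale, finrank_euclideanSpace_fin]
  push_cast
  ring

theorem isWeylOperator_iff_hasSymbol {f : R4 → ℂ} (hf : IsSymbol 0 0 f) (T : L2 →L[ℂ] L2) :
    IsWeylOperator θ₁₂ θ₃₄ f T ↔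
      HasSymbol (coordinateForm (phaseEquiv h₁₂ h₃₄)) (coordinateWigner (phaseEquiv h₁₂ h₃₄))
        (fun z => toL2 (coherentState (phaseEquiv h₁₂ h₃₄ z)))
        (fun x => quantizerScale h₁₂ h₃₄ * f x) T := by
  have hΔ (φ ψ : 𝓢(R2, ℂ)) (x : R4) : f x * deltaHat θ₁₂ θ₃₄ φ ψ x =
      quantizerScale h₁₂ h₃₄ * f x *
        ⟪toL2 φ, displacedParity (phaseEquiv h₁₂ h₃₄ x) (toL2 ψ)⟫_ℂ := by
    rw [deltaHat_eq_inner_displacedParity h₁₂ h₃₄, mul_left_comm, mul_assoc]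
  simp only [IsWeylOperator, hΔ]
  refine ⟨fun h z w => ?_, fun h φ ψ => ?_⟩
  · refine (h _ _).2.trans ?_
    simp only [inner_coherentState_displacedParity_coordinates, symbolKernel]
  · have he := isQuantizer_displacedParity (phaseEquiv h₁₂ h₃₄)
    have hφ := integrable_inner_coherentState_coordinates (phaseEquiv h₁₂ h₃₄) φ
    have hψ := integrable_inner_coherentState_coordinates (phaseEquiv h₁₂ h₃₄) ψ
    have hsymbol := hf.const_mul (quantizerScale h₁₂ h₃₄)
    exact ⟨he.integrable_mul_inner hsymbol hφ hψ, he.inner_eq_integral hsymbol h hφ hψ⟩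

section MoyalAlgebra

variable {F : Set (R4 → ℂ)} (hF : IsMoyalAlgebra (coordinateForm (phaseEquiv h₁₂ h₃₄))
  (coordinateWigner (phaseEquiv h₁₂ h₃₄)) F)
include hF

theorem existsUnique_isWeylOperator {f : R4 → ℂ} (hf : f ∈ F) :
    ∃! T, IsWeylOperator θ₁₂ θ₃₄ f T := by
  have he := isQuantizer_displacedParity (phaseEquiv h₁₂ h₃₄)
  have hsymbol := (hF.vanishesAtInfinity hf).isSymbol
  simp only [isWeylOperator_iff_hasSymbol h₁₂ h₃₄ hsymbol]
  obtain ⟨T, hT⟩ := he.exists_hasSymbol (hsymbol.const_mul (quantizerScale h₁₂ h₃₄))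
  exact ⟨T, hT, fun S hS => he.hasSymbol_unique hS hT⟩

theorem coe_operatorAlgebra_eq_weylImage :
    ((isQuantizer_displacedParity (phaseEquiv h₁₂ h₃₄)).operatorAlgebra hF :
      Set (L2 →L[ℂ] L2)) = weylImage θ₁₂ θ₃₄ F := by
  ext T
  constructor
  · rintro ⟨f, hf, hT⟩
    have hg := hF.const_mul_mem (quantizerScale h₁₂ h₃₄)⁻¹ hf
    refine ⟨_, hg, (isWeylOperator_iff_hasSymbol h₁₂ h₃₄
      (hF.vanishesAtInfinity hg).isSymbol T).2 ?_⟩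
    simpa only [mul_inv_cancel_left₀ (quantizerScale_ne_zero h₁₂ h₃₄)] using hT
  · rintro ⟨f, hf, hT⟩
    exact ⟨_, hF.const_mul_mem _ hf, (isWeylOperator_iff_hasSymbol h₁₂ h₃₄
      (hF.vanishesAtInfinity hf).isSymbol T).1 hT⟩

theorem isNormDenseSubalgebra_weylImage : IsNormDenseSubalgebra (weylImage θ₁₂ θ₃₄ F) := by
  rw [← coe_operatorAlgebra_eq_weylImage h₁₂ h₃₄ hF]
  exact ⟨⟨_, rfl⟩, fun _ => IsQuantizer.isCompactOperator_of_mem_operatorAlgebra _ hF,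
    fun _ => IsQuantizer.mem_closure_operatorAlgebra _ hF⟩

theorem existsUnique_isWeylOperator_and_isNormDenseSubalgebra :
    (∀ f ∈ F, ∃! T, IsWeylOperator θ₁₂ θ₃₄ f T) ∧
      IsNormDenseSubalgebra (weylImage θ₁₂ θ₃₄ F) :=
  ⟨fun _ => existsUnique_isWeylOperator h₁₂ h₃₄ hF, isNormDenseSubalgebra_weylImage h₁₂ h₃₄ hF⟩

end MoyalAlgebra

end WeylOperators

end WeylQuantization

end

open WeylQuantization in
theorem lemma1_general (θ₁₂ θ₃₄ : ℝ) (h₁₂ : θ₁₂ ≠ 0) (h₃₄ : θ₃₄ ≠ 0) :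
    ((∀ f ∈ schwartzClass, ∃! T, IsWeylOperator θ₁₂ θ₃₄ f T) ∧
      IsNormDenseSubalgebra (weylImage θ₁₂ θ₃₄ schwartzClass)) ∧
    (∀ m ρ : ℝ, m < 0 → 0 ≤ ρ →
      (∀ f ∈ gammaClass m ρ, ∃! T, IsWeylOperator θ₁₂ θ₃₄ f T) ∧
      IsNormDenseSubalgebra (weylImage θ₁₂ θ₃₄ (gammaClass m ρ))) ∧
    ((∀ f ∈ kInftyClass, ∃! T, IsWeylOperator θ₁₂ θ₃₄ f T) ∧
      IsNormDenseSubalgebra (weylImage θ₁₂ θ₃₄ kInftyClass)) :=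
  have hσ := (isSymplectic_coordinateForm (phaseEquiv h₁₂ h₃₄)).injective_flip
  have hweyl {F : Set (R4 → ℂ)} hF :=
    existsUnique_isWeylOperator_and_isNormDenseSubalgebra h₁₂ h₃₄ (F := F) hF
  ⟨hweyl (isMoyalAlgebra_schwartz hσ), fun _ _ hm hρ => hweyl (isMoyalAlgebra_isSymbol hσ hm hρ),
    hweyl (isMoyalAlgebra_vanishesAtInfinity hσ)⟩

theorem lemma1 (θ₁₂ θ₃₄ : ℝ) (h₁₂ : θ₁₂ ≠ 0) (h₃₄ : θ₃₄ ≠ 0) :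
    ((∀ f ∈ WeylQuantization.schwartzClass,
        ∃! T, WeylQuantization.IsWeylOperator θ₁₂ θ₃₄ f T) ∧
      WeylQuantization.IsNormDenseSubalgebra
        (WeylQuantization.weylImage θ₁₂ θ₃₄ WeylQuantization.schwartzClass)) ∧
    (∀ m ρ : ℝ, m < 0 → 0 < ρ → ρ ≤ 1 →
      (∀ f ∈ WeylQuantization.gammaClass m ρ,
        ∃! T, WeylQuantization.IsWeylOperator θ₁₂ θ₃₄ f T) ∧
      WeylQuantization.IsNormDenseSubalgebra
        (WeylQuantization.weylImage θ₁₂ θ₃₄ (WeylQuantization.gammaClass m ρ))) ∧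
    ((∀ f ∈ WeylQuantization.kInftyClass,
        ∃! T, WeylQuantization.IsWeylOperator θ₁₂ θ₃₄ f T) ∧
      WeylQuantization.IsNormDenseSubalgebra
        (WeylQuantization.weylImage θ₁₂ θ₃₄ WeylQuantization.kInftyClass)) :=
  have h := lemma1_general θ₁₂ θ₃₄ h₁₂ h₃₄
  ⟨h.1, fun m ρ hm hρ _ => h.2.1 m ρ hm hρ.le, h.2.2⟩
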